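/- **Theorem 4.2.** The bisimilarity problem for probabilistic visibly pushdown automata (pvPDA) is in EXPTIME. In particular, so is the bisimilarity problem for standard visibly pushdown automata (vPDA). Here a *probabilistic pushdown automaton* is a tuple $\Delta=(Q,\Gamma,\Sigma,\hookrightarrow)$ with finite sets $Q$ of control states, $\Gamma$ of stack symbols and $\Sigma$ of actions, and a finite set $\hookrightarrow\ \subseteq Q\times\Gamma\times\Sigma\times\mathcal D(Q\times\Gamma^{\le 2})$ of rules, where $\mathcal D(A)$ is the set of probability distributions on $A$ with rational values and $\Gamma^{\le 2}$ is the set of words over $\Gamma$ of length at most $2$. It is a *pvPDA* if it comes with a partition $\Sigma=\Sigma_r\cup\Sigma_{int}\cup\Sigma_c$ (parts may be empty) such that for every rule $(q,X,a,d)$ the support of $d$ is contained in $Q\times\{\varepsilon\}$, $Q\times\Gamma$ or $Q\times\Gamma\Gamma$ according to whether $a$ is in $\Sigma_r$, $\Sigma_{int}$ or $\Sigma_c$; it is a (standard) *vPDA* if moreover every such $d$ is Dirac. $\Delta$ generates a transition system on the configurations $Q\times\Gamma^*$: each rule $(q,X,a,d)$ and each $\beta\in\Gamma^*$ give a transition $qX\beta\xrightarrow{a}d'$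 with $d'(p\alpha\beta)=d(p\alpha)$ for all $p\alpha$ in the support of $d$. An equivalence relation $R$ on configurations is a *bisimulation* if whenever $s\mathrel R t$ and $s\xrightarrow{a}d$, there is $t\xrightarrow{a}d'$ with $d(E)=d'(E)$ for every $R$-class $E$; two configurations are *bisimilar* if some bisimulation relates them. The *bisimilarity problem* for pvPDA (respectively vPDA) is: given a pvPDA (respectively vPDA) $\Delta$, presented explicitly with the probabilities written as quotients of integers in binary, and two configurations $q_1\alpha_1$, $q_2\alpha_2$ of $\Delta$, decide whether $q_1\alpha_1$ and $q_2\alpha_2$ are bisimilar. EXPTIME is the class of languages decided by a deterministic Turing machine in time $2^{p(n)}$ for some polynomial $p$ in the length $n$ of the input. -/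

import Mathlib

open scoped ENNReal NNReal

noncomputable section

namespace PVPDA

/-! ### Probabilistic labelled transition systems and bisimilarity -/

/-- A probabilistic labelled transition system with states `S` and actions `A`;
`(s, a, d) ∈ tran` is a transition from `s` with label `a` to the distribution `d`. -/
structure PLTS (S A : Type) where
  tran : Set (S × A × PMF S)

/-- Two distributions are `R`-equivalent if they give the same probability to each
equivalence class of `R`. -/
def DistEquiv {S : Type} (R : Setoid S) (d d' : PMF S) : Prop :=
  ∀ E ∈ R.classes, d.toOuterMeasure E = d'.toOuterMeasure E

/-- An equivalence relation that is a (probabilistic) bisimulation relation. -/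
def PLTS.IsBisimulation {S A : Type} (L : PLTS S A) (R : Setoid S) : Prop :=
  ∀ s t, R s t → ∀ a d, (s, a, d) ∈ L.tran → ∃ d', (t, a, d') ∈ L.tran ∧ DistEquiv R d d'

/-- Bisimilarity: the union of all bisimulation relations. -/
def PLTS.Bisimilar {S A : Type} (L : PLTS S A) (s t : S) : Prop :=
  ∃ R : Setoid S, L.IsBisimulation R ∧ R s t

/-! ### Probabilistic (visibly) pushdown automata -/

/-- Words of length at most two over `Γ`. -/
abbrev ShortWord (Γ : Type) : Type := {α : List Γ // α.length ≤ 2}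

/-- A probabilistic pushdown automaton with control states `Q`, stack alphabet `Γ` and action
alphabet `A`: a finite set of rules `(q, X, a, d)`, where `d` is a distribution with rational
probabilities on `Q × Γ^{≤ 2}`. -/
structure PPDA (Q Γ A : Type) [Finite Q] [Finite Γ] [Finite A] where
  rules : Set (Q × Γ × A × PMF (Q × ShortWord Γ))
  finite_rules : rules.Finite
  rational : ∀ q X a d, (q, X, a, d) ∈ rules → ∀ x, ∃ r : ℚ≥0, d x = ((r : ℝ≥0) : ℝ≥0∞)

/-- Configurations: a control state and a stack content, with the top of the stack first. -/
abbrev Config (Q Γ : Type) : Type := Q × List Γ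

section

variable {Q Γ A : Type} [Finite Q] [Finite Γ] [Finite A]

/-- The generated transition system: a rule `(q, X, a, d)` induces, for each stack content `β`, the
transition from `q X β` with label `a` to the distribution that gives `p α β` the probability
`d (p, α)`. -/
def PPDA.toPLTS (D : PPDA Q Γ A) : PLTS (Config Q Γ) A where
  tran := {t | ∃ q X a d, (q, X, a, d) ∈ D.rules ∧ ∃ β : List Γ,
    t = ((q, X :: β), a, d.map fun x => (x.1, x.2.1 ++ β))}

/-- A standard (non-probabilistic) pushdown automaton: all distributions in the rules are Dirac. -/
def PPDA.IsStandard (D : PPDA Q Γ A) : Prop :=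
  ∀ q X a d, (q, X, a, d) ∈ D.rules → ∃ x, d = PMF.pure x

end

/-- The three parts of the action alphabet of a visibly pushdown automaton. -/
inductive StackKind
  | ret
  | int
  | call

/-- The length of the word that replaces the top stack symbol. -/
def StackKind.width : StackKind → ℕ
  | ret => 0
  | int => 1
  | call => 2

/-- A probabilistic visibly pushdown automaton: a probabilistic pushdown automaton with a partition
of its actions (the fibres of `kind`) into return, internal and call actions. -/
structure PvPDA (Q Γ A : Type) [Finite Q] [Finite Γ] [Finite A] extends PPDA Q Γ A where
  kind : A → StackKind
  visibly : ∀ q X a d, (q, X, a, d) ∈ rules → ∀ x ∈ d.support, x.2.1.length = (kind a).width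

/-! ### Instances of the bisimilarity problem as finite words -/

/-- An entry `(num / den) · (p, α)` of a written-out distribution. -/
structure Entry (nQ nΓ : ℕ) where
  num : ℕ
  den : ℕ+
  target : Fin nQ × ShortWord (Fin nΓ)

/-- The probability of an entry. -/
def Entry.weight {nQ nΓ : ℕ} (e : Entry nQ nΓ) : ℝ≥0∞ := (e.num : ℝ≥0∞) / ((e.den : ℕ) : ℝ≥0∞)

/-- The list of entries `l` is a presentation of `d`, as a formal sum. -/
def PresentsDist {nQ nΓ : ℕ} (l : List (Entry nQ nΓ))
    (d : PMF (Fin nQ × ShortWord (Fin nΓ))) : Prop :=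
  ∀ x, d x = (l.map fun e => if e.target = x then e.weight else 0).sum

/-- A written-out rule. -/
structure RawRule (nQ nΓ nA : ℕ) where
  state : Fin nQ
  top : Fin nΓ
  action : Fin nA
  dist : List (Entry nQ nΓ)

/-- A written-out instance of the bisimilarity problem: the numbers of control states and of stack
symbols, the kinds of the actions, a list of rules, and two configurations. -/
structure Instance where
  numStates : ℕ
  numSymbols : ℕ
  kinds : List StackKind
  rules : List (RawRule numStates numSymbols kinds.length)
  left : Config (Fin numStates) (Fin numSymbols)
  right : Config (Fin numStates) (Fin numSymbols)

/-- The written-out instance describes the automaton `D`: same partition of the actions, and same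
set of rules (in particular each written-out distribution is a probability distribution). -/
def Instance.Presents (I : Instance)
    (D : PvPDA (Fin I.numStates) (Fin I.numSymbols) (Fin I.kinds.length)) : Prop :=
  (∀ a, D.kind a = I.kinds.get a) ∧
  (∀ r ∈ I.rules, ∃ d, (r.state, r.top, r.action, d) ∈ D.rules ∧ PresentsDist r.dist d) ∧
  (∀ q X a d, (q, X, a, d) ∈ D.rules →
    ∃ r ∈ I.rules, r.state = q ∧ r.top = X ∧ r.action = a ∧ PresentsDist r.dist d)

/-- The alphabet in which instances are written. -/
inductive Letter
  | bit (b : Bool)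
  | mark
  | close
  deriving DecidableEq, Fintype

/-- A number in binary, least significant bit first. -/
def encNat (n : ℕ) : List Letter := n.bits.map Letter.bit ++ [Letter.close]

/-- A number in unary. -/
def encUnary (n : ℕ) : List Letter := List.replicate n Letter.mark ++ [Letter.close]

/-- A list, with a mark in front of each item. -/
def encList {β : Type} (f : β → List Letter) (l : List β) : List Letter :=
  (l.flatMap fun x => Letter.mark :: f x) ++ [Letter.close]

/-- A word of names of stack symbols. -/
def encWord {n : ℕ} (w : List (Fin n)) : List Letter := encList (fun X => encNat X.val) w

/-- An entry; the probability is a quotient of integers in binary. -/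
def encEntry {nQ nΓ : ℕ} (e : Entry nQ nΓ) : List Letter :=
  encNat e.num ++ encNat e.den ++ encNat e.target.1.val ++ encWord e.target.2.1

/-- A rule. -/
def encRule {nQ nΓ nA : ℕ} (r : RawRule nQ nΓ nA) : List Letter :=
  encNat r.state.val ++ encNat r.top.val ++ encNat r.action.val ++ encList encEntry r.dist

/-- A configuration. -/
def encConfig {nQ nΓ : ℕ} (c : Config (Fin nQ) (Fin nΓ)) : List Letter :=
  encNat c.1.val ++ encWord c.2

/-- The word that encodes an instance. Every state, symbol and action contributes to its length, so
that it is polynomially related to the usual size of an explicitly given automaton. -/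
def Instance.encode (I : Instance) : List Letter :=
  encUnary I.numStates ++ encUnary I.numSymbols ++ encList (fun k => encNat k.width) I.kinds ++
    encList encRule I.rules ++ encConfig I.left ++ encConfig I.right

/-- The bisimilarity problem for probabilistic visibly pushdown automata: the words that encode an
automaton with two bisimilar configurations. -/
def pvPDABisimilarity : Language Letter :=
  {w | ∃ I : Instance, I.encode = w ∧
    ∃ D : PvPDA (Fin I.numStates) (Fin I.numSymbols) (Fin I.kinds.length),
      I.Presents D ∧ D.toPLTS.Bisimilar I.left I.right}

/-- The bisimilarity problem for standard visibly pushdown automata. -/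
def vPDABisimilarity : Language Letter :=
  {w | ∃ I : Instance, I.encode = w ∧
    ∃ D : PvPDA (Fin I.numStates) (Fin I.numSymbols) (Fin I.kinds.length),
      I.Presents D ∧ D.IsStandard ∧ D.toPLTS.Bisimilar I.left I.right}

/-! ### Deterministic exponential time -/

open Classical in
/-- `L` is in EXPTIME: some deterministic multi-stack Turing machine, with finite stack alphabets,
decides on every input word `w` whether `w ∈ L`, within `2 ^ p (|w|)` steps for a polynomial `p`. -/
def InEXPTIME {α : Type} [Fintype α] (L : Language α) : Prop :=
  ∃ (p : Polynomial ℕ) (M : Turing.TM2ComputableInTime (fun w : List α => w)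
      Computability.encodeBool (fun w => decide (w ∈ L))),
    (∀ k, Finite (M.tm.Γ k)) ∧ ∀ n, M.time n ≤ 2 ^ p.eval n

end PVPDA

end

/-!
Consider the tables `T` that assign to stack symbols `X`, `Y` and a relation `B` between control
states a relation between control states `p`, `q`: the configurations `p X` and `q Y` are to be
equivalent if, once `X` and `Y` are popped, the control states that are related by `B` are. Both
sides pop at the same time since the automaton is visibly pushdown, and so bisimilarity on stacks is
determined from the bottom to the top by the greatest table that is stable under the back-and-forth
condition for the rules. There are `2 ^ poly` entries in a table, so the greatest stable table is
reached after that many rounds of refinement, and comparing two distributions amounts to comparing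
the probabilities of the sublists of their presentations. The whole computation is polynomial in the
length of the input and in a bound `2 ^ poly` for the numbers and lists that occur. Finally, the
functions on lists and unary numbers that are computable in polynomial time are shown to be closed
under bounded folds, by compiling them to a Turing machine with finitely many stacks.
-/

namespace StackProgram

/-- The work stacks of a program. The data lie on `val`; the other stacks are scratch space, with
`cnt` used as a counter. -/
inductive Stk
  | val
  | tmp₁
  | tmp₂
  | tmp₃
  | cnt
  deriving DecidableEq

instance : Fintype Stk :=
  ⟨{.val, .tmp₁, .tmp₂, .tmp₃, .cnt}, fun k => by cases k <;> simp⟩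

/-- The values of the register: the symbol popped last, `none` if the stack was empty. -/
abbrev Reg (α : Type) : Type := Option (α ⊕ Bool)

/-- The memory of a stack program over the input alphabet `α`. -/
structure State (α : Type) where
  reg : Reg α
  inp : List α
  val : List Bool
  tmp₁ : List Bool
  tmp₂ : List Bool
  tmp₃ : List Bool
  cnt : List Bool

namespace State

variable {α : Type}

/-- The contents of a work stack. -/
def get (s : State α) : Stk → List Bool
  | .val => s.val
  | .tmp₁ => s.tmp₁
  | .tmp₂ => s.tmp₂
  | .tmp₃ => s.tmp₃
  | .cnt => s.cnt

/-- The memory with the contents of one work stack replaced. -/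
def set (s : State α) : Stk → List Bool → State α
  | .val, l => { s with val := l }
  | .tmp₁, l => { s with tmp₁ := l }
  | .tmp₂, l => { s with tmp₂ := l }
  | .tmp₃, l => { s with tmp₃ := l }
  | .cnt, l => { s with cnt := l }

/-- The number of symbols on all stacks together. -/
def total (s : State α) : ℕ :=
  s.inp.length + s.val.length + s.tmp₁.length + s.tmp₂.length + s.tmp₃.length + s.cnt.length

theorem total_set (s : State α) (k : Stk) (l : List Bool) :
    (s.set k l).total + (s.get k).length = s.total + l.length := by
  cases k <;> simp only [set, get, total] <;> lia

end State

/-- Primitive instructions. The pushed bit may depend on the register. -/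
inductive Instr (α : Type)
  | push (k : Stk) (f : Reg α → Bool)
  | pop (k : Stk)
  | read
  | clear
  | skip

/-- The effect of a primitive instruction. -/
def Instr.exec {α : Type} : Instr α → State α → State α
  | push k f, s => s.set k (f s.reg :: s.get k)
  | pop k, s => { s.set k (s.get k).tail with reg := (s.get k).head?.map .inr }
  | read, s => { s with reg := s.inp.head?.map .inl, inp := s.inp.tail }
  | clear, s => { s with reg := none }
  | skip, s => s

/-- Structured programs. -/
inductive Cmd (α : Type)
  | instr (p : Instr α)
  | seq (a b : Cmd α)
  | ite (t : Reg α → Bool) (a b : Cmd α)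
  | loop (t : Reg α → Bool) (c : Cmd α)

/-- `Runs c s s' n`: the program `c` leads from `s` to `s'` in at most `n` steps. -/
inductive Runs {α : Type} : Cmd α → State α → State α → ℕ → Prop
  | instr {p : Instr α} {s s' : State α} : p.exec s = s' → Runs (.instr p) s s' 1
  | seq {a b : Cmd α} {s s' s'' : State α} {m n : ℕ} :
      Runs a s s' m → Runs b s' s'' n → Runs (.seq a b) s s'' (m + n)
  | iteTrue {t : Reg α → Bool} {a b : Cmd α} {s s' : State α} {m : ℕ} :
      t s.reg = true → Runs a s s' m → Runs (.ite t a b) s s' (m + 1)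
  | iteFalse {t : Reg α → Bool} {a b : Cmd α} {s s' : State α} {m : ℕ} :
      t s.reg = false → Runs b s s' m → Runs (.ite t a b) s s' (m + 1)
  | loopDone {t : Reg α → Bool} {c : Cmd α} {s : State α} :
      t s.reg = false → Runs (.loop t c) s s 1
  | loopStep {t : Reg α → Bool} {c : Cmd α} {s s' s'' : State α} {m n : ℕ} :
      t s.reg = true → Runs c s s' m → Runs (.loop t c) s' s'' n →
        Runs (.loop t c) s s'' (m + n + 1)
  | mono {c : Cmd α} {s s' : State α} {m n : ℕ} : Runs c s s' m → m ≤ n → Runs c s s' n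

section Runs

variable {α : Type}

theorem Runs.of_eq {c : Cmd α} {s s' t t' : State α} {m n : ℕ} (h : Runs c s s' m) (hs : s = t)
    (hs' : s' = t') (hmn : m ≤ n) : Runs c t t' n :=
  hs ▸ hs' ▸ h.mono hmn

theorem Instr.total_exec_le (p : Instr α) (s : State α) : (p.exec s).total ≤ s.total + 1 := by
  cases p with
  | push k f =>
    have := s.total_set k (f s.reg :: s.get k)
    simp only [Instr.exec, List.length_cons] at this ⊢
    lia
  | pop k =>
    have h := s.total_set k (s.get k).tail
    have htail : (s.get k).tail.length ≤ (s.get k).length := by simp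
    change (s.set k (s.get k).tail).total ≤ _
    lia
  | read => simp only [Instr.exec, State.total, List.length_tail]; lia
  | clear | skip => exact Nat.le_succ _

theorem Runs.total_le {c : Cmd α} {s s' : State α} {n : ℕ} (h : Runs c s s' n) :
    s'.total ≤ s.total + n := by
  induction h with
  | instr h => exact h ▸ Instr.total_exec_le _ _
  | _ => lia

end Runs

/-! ### Compilation into multi-stack Turing machines -/

open Turing (TM2.Stmt)

/-- The stack alphabets of the compiled machine; `none` is the input stack. -/
abbrev Alphabet (α : Type) : Option Stk → Type
  | none => α
  | some _ => Bool

/-- The labels of the compiled program: one for each of its subprograms that is not a `seq`. -/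
def Cmd.Label {α : Type} : Cmd α → Type
  | .instr _ => Unit
  | .seq a b => a.Label ⊕ b.Label
  | .ite _ a b => Option (a.Label ⊕ b.Label)
  | .loop _ c => Option c.Label

section Compilation

variable {α Λ : Type}

instance Cmd.finite_label (c : Cmd α) : Finite c.Label := by
  induction c <;> dsimp only [Cmd.Label] <;> infer_instance

/-- The label at which the compiled program starts. -/
def Cmd.entry : (c : Cmd α) → c.Label
  | .instr _ => ()
  | .seq a _ => Sum.inl a.entry
  | .ite _ _ _ => none
  | .loop _ _ => none

/-- The machine statement that executes a primitive instruction and jumps to the label `e`. -/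
def Instr.stmt (e : Λ) : Instr α → TM2.Stmt (Alphabet α) Λ (Reg α)
  | push k f => .push (some k) f (.goto fun _ => e)
  | pop k => .pop (some k) (fun _ x => x.map .inr) (.goto fun _ => e)
  | read => .pop none (fun _ x => x.map .inl) (.goto fun _ => e)
  | clear => .load (fun _ => none) (.goto fun _ => e)
  | skip => .goto fun _ => e

/-- The compiled program. The embedding `emb` places its labels among those of a larger machine, and
`e` is the label to continue with afterwards. -/
def Cmd.compile : (c : Cmd α) → (c.Label → Λ) → Λ → c.Label → TM2.Stmt (Alphabet α) Λ (Reg α)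
  | .instr p, _, e, _ => p.stmt e
  | .seq a b, emb, _, .inl l => a.compile (fun x => emb (.inl x)) (emb (.inr b.entry)) l
  | .seq _ b, emb, e, .inr l => b.compile (fun x => emb (.inr x)) e l
  | .ite t a b, emb, _, none =>
    .branch t (.goto fun _ => emb (some (.inl a.entry))) (.goto fun _ => emb (some (.inr b.entry)))
  | .ite _ a _, emb, e, some (.inl l) => a.compile (fun x => emb (some (.inl x))) e l
  | .ite _ _ b, emb, e, some (.inr l) => b.compile (fun x => emb (some (.inr x))) e l
  | .loop t c, emb, e, none =>
    .branch t (.goto fun _ => emb (some c.entry)) (.goto fun _ => e)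
  | .loop _ c, emb, _, some l => c.compile (fun x => emb (some x)) (emb none) l

/-- The contents of all stacks of the compiled machine. -/
def State.stacks (s : State α) : ∀ k, List (Alphabet α k)
  | none => s.inp
  | some k => s.get k

/-- The configuration of the compiled machine with memory `s` at the label `l`. -/
def State.cfg (s : State α) (l : Option Λ) : Turing.TM2.Cfg (Alphabet α) Λ (Reg α) :=
  ⟨l, s.reg, s.stacks⟩

theorem State.stacks_set (s : State α) (k : Stk) (l : List Bool) :
    (s.set k l).stacks = Function.update s.stacks (some k) l := by
  funext j
  rcases j with _ | j <;> cases k <;> first | rfl | (cases j <;> rfl)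

theorem State.reg_set (s : State α) (k : Stk) (l : List Bool) : (s.set k l).reg = s.reg := by
  cases k <;> rfl

theorem State.stacks_reg (s : State α) (r : Reg α) :
    State.stacks { s with reg := r } = s.stacks := by
  funext j
  rcases j with _ | _ | _ | _ | _ | _ <;> rfl

theorem State.stacks_inp (s : State α) (r : Reg α) (w : List α) :
    State.stacks { s with reg := r, inp := w } = Function.update s.stacks none w := by
  funext j
  rcases j with _ | _ | _ | _ | _ | _ <;> rfl

theorem Instr.stepAux_stmt (p : Instr α) (e : Λ) (s : State α) :
    Turing.TM2.stepAux (p.stmt e) s.reg s.stacks = (p.exec s).cfg (some e) := by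
  cases p with
  | push k f =>
    simp [Instr.stmt, Instr.exec, State.cfg, State.stacks_set, State.reg_set, State.stacks]
  | pop k => simp [Instr.stmt, Instr.exec, State.cfg, State.stacks_set, State.stacks_reg,
      State.stacks]
  | read => simp [Instr.stmt, Instr.exec, State.cfg, State.stacks_inp, State.stacks]
  | clear => simp [Instr.stmt, Instr.exec, State.cfg, State.stacks_reg]
  | skip => rfl

/-- The machine `M` leads from the configuration `a` to `b` in at most `n` steps. -/
def StepsWithin (M : Λ → TM2.Stmt (Alphabet α) Λ (Reg α)) (n : ℕ)
    (a b : Turing.TM2.Cfg (Alphabet α) Λ (Reg α)) : Prop :=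
  ∃ m ≤ n, (flip bind (Turing.TM2.step M))^[m] (some a) = some b

variable {M : Λ → TM2.Stmt (Alphabet α) Λ (Reg α)}

theorem StepsWithin.trans {m n : ℕ} {a b c : Turing.TM2.Cfg (Alphabet α) Λ (Reg α)}
    (h : StepsWithin M m a b) (h' : StepsWithin M n b c) : StepsWithin M (m + n) a c := by
  obtain ⟨k, hk, h⟩ := h
  obtain ⟨k', hk', h'⟩ := h'
  exact ⟨k' + k, by lia, by rw [Function.iterate_add_apply, h, h']⟩

theorem StepsWithin.single {l : Λ} {s : State α} {b : Turing.TM2.Cfg (Alphabet α) Λ (Reg α)}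
    (h : Turing.TM2.stepAux (M l) s.reg s.stacks = b) : StepsWithin M 1 (s.cfg (some l)) b :=
  ⟨1, le_rfl, h ▸ rfl⟩

theorem Runs.stepsWithin {c : Cmd α} {s s' : State α} {n : ℕ} (h : Runs c s s' n)
    (emb : c.Label → Λ) (e : Λ) (hM : ∀ l, M (emb l) = c.compile emb e l) :
    StepsWithin M n (s.cfg (some (emb c.entry))) (s'.cfg (some e)) := by
  induction h generalizing e with
  | @instr p s s' h =>
    exact .single (by rw [hM, ← h]; exact p.stepAux_stmt e s)
  | seq _ _ ih ih' =>
    exact (ih (fun x => emb (.inl x)) _ fun l => hM (.inl l)).trans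
      (ih' (fun x => emb (.inr x)) _ fun l => hM (.inr l))
  | @iteTrue t _ _ s _ m ht _ ih =>
    rw [Nat.add_comm]
    refine .trans (.single ?_) (ih (fun x => emb (some (.inl x))) _ fun l => hM (some (.inl l)))
    rw [hM]
    simp [Cmd.compile, Cmd.entry, ht, State.cfg]
  | @iteFalse t _ _ s _ m ht _ ih =>
    rw [Nat.add_comm]
    refine .trans (.single ?_) (ih (fun x => emb (some (.inr x))) _ fun l => hM (some (.inr l)))
    rw [hM]
    simp [Cmd.compile, Cmd.entry, ht, State.cfg]
  | loopDone ht =>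
    refine .single ?_
    rw [hM]
    simp [Cmd.compile, Cmd.entry, ht, State.cfg]
  | loopStep ht _ _ ih ih' =>
    rw [Nat.add_comm]
    refine .trans (.single ?_)
      ((ih (fun x => emb (some x)) _ fun l => hM (some l)).trans (ih' emb e hM))
    rw [hM]
    simp [Cmd.compile, Cmd.entry, ht, State.cfg]
  | mono _ hmn ih =>
    obtain ⟨k, hk, hsteps⟩ := ih emb e hM
    exact ⟨k, hk.trans hmn, hsteps⟩

end Compilation

section Machine

variable {α : Type} [Fintype α]

/-- The initial memory, with an input word. -/
def State.input (w : List α) : State α := ⟨none, w, [], [], [], [], []⟩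

/-- The final memory, with an output word. -/
def State.output (l : List Bool) : State α := ⟨none, [], l, [], [], [], []⟩

/-- The machine that runs a program and halts. -/
noncomputable def Cmd.machine (c : Cmd α) : Turing.FinTM2 where
  K := Option Stk
  k₀ := none
  k₁ := some .val
  Γ := Alphabet α
  Λ := Option c.Label
  main := some c.entry
  ΛFin := Fintype.ofFinite _
  σ := Reg α
  initialState := none
  Γk₀Fin := inferInstanceAs (Fintype α)
  m
    | none => .halt
    | some l => c.compile some none l

theorem initList_machine (c : Cmd α) (w : List α) :
    Turing.initList c.machine (w.map (Equiv.refl α)) =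
      (State.input w).cfg (some (some c.entry)) := by
  unfold Turing.initList State.cfg
  congr 1
  funext k
  rcases k with _ | _ | _ | _ | _ | _ <;> first | rfl | exact List.map_id w

theorem haltList_machine (c : Cmd α) (l : List Bool) :
    Turing.haltList c.machine (l.map (Equiv.refl Bool)) = (State.output l).cfg none := by
  unfold Turing.haltList State.cfg
  congr 1
  funext k
  rcases k with _ | _ | _ | _ | _ | _ <;> first | rfl | exact List.map_id l

theorem Runs.stepsWithin_machine {c : Cmd α} {s s' : State α} {n : ℕ} (h : Runs c s s' n) :
    StepsWithin c.machine.m (n + 1) (s.cfg (some (some c.entry))) (s'.cfg none) :=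
  (h.stepsWithin some none fun _ => rfl).trans (.single rfl)

/-- The machine of a program that computes `f : List α → Bool` within a time bound. -/
noncomputable def Cmd.computableInTime (c : Cmd α) (f : List α → Bool) (time : ℕ → ℕ)
    (h : ∀ w, Runs c (.input w) (.output [f w]) (time w.length)) :
    Turing.TM2ComputableInTime (fun w : List α => w) Computability.encodeBool f where
  tm := c.machine
  inputAlphabet := Equiv.refl α
  outputAlphabet := Equiv.refl Bool
  time n := time n + 1
  outputsFun w :=
    { steps := (h w).stepsWithin_machine.choose
      steps_le_m := (h w).stepsWithin_machine.choose_spec.1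
      evals_in_steps := by
        have hinit := congrArg some (initList_machine c w)
        have hhalt := congrArg some (haltList_machine c [f w])
        exact (congrArg _ hinit).trans
          ((h w).stepsWithin_machine.choose_spec.2.trans hhalt.symm) }

end Machine

/-! ### Binary trees as data -/

/-- Binary trees, the data that stack programs work on. -/
inductive Tree
  | nil
  | cons (a b : Tree)
  deriving DecidableEq

namespace Tree

/-- The representation of a tree on a stack, in Polish notation. -/
def word : Tree → List Bool
  | nil => [false]
  | cons a b => true :: (a.word ++ b.word)

/-- The number of nodes of a tree, which is also the length of its word. -/
def size (t : Tree) : ℕ := t.word.length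

@[simp] theorem size_nil : nil.size = 1 := rfl

@[simp] theorem size_cons (a b : Tree) : (cons a b).size = a.size + b.size + 1 := by
  simp [size, word]

theorem length_word (t : Tree) : t.word.length = t.size := rfl

theorem word_append_injective :
    ∀ {a b : Tree} {u v : List Bool}, a.word ++ u = b.word ++ v → a = b ∧ u = v
  | nil, nil, _, _, h => by simpa [word] using h
  | nil, cons _ _, _, _, h => by simp [word] at h
  | cons _ _, nil, _, _, h => by simp [word] at h
  | cons a b, cons c d, _, _, h => by
    simp only [word, List.cons_append, List.append_assoc, List.cons.injEq, true_and] at h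
    obtain ⟨hac, h⟩ := word_append_injective h
    obtain ⟨hbd, h⟩ := word_append_injective h
    exact ⟨by rw [hac, hbd], h⟩

theorem word_prefix_iff {a b : Tree} : a.word <+: b.word ↔ a = b := by
  refine ⟨fun ⟨u, hu⟩ => (word_append_injective (v := []) (by simpa using hu)).1, ?_⟩
  rintro rfl
  exact List.prefix_rfl

/-- A list of trees as a tree. -/
def ofList : List Tree → Tree
  | [] => nil
  | t :: l => cons t (ofList l)

theorem ofList_injective : Function.Injective ofList := by
  intro l
  induction l with
  | nil => intro l' h; cases l' <;> simp_all [ofList]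
  | cons t l ih =>
    intro l' h
    cases l' with
    | nil => simp [ofList] at h
    | cons t' l' =>
      simp only [ofList, cons.injEq] at h
      rw [h.1, ih h.2]

/-- The tree that represents a truth value. -/
def ofBool : Bool → Tree
  | false => nil
  | true => cons nil nil

end Tree

/-! ### Programs that manipulate trees on the value stack -/

infixr:60 " ;; " => Cmd.seq

section Programs

variable {α : Type}

/-- The register holds the bit `b`. -/
def regIs (b : Bool) : Reg α → Bool
  | some (.inr c) => c == b
  | _ => false

/-- Push a fixed bit. -/
def push (k : Stk) (b : Bool) : Cmd α := .instr (.push k fun _ => b)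

/-- Push the bit in the register. -/
def pushReg (k : Stk) : Cmd α := .instr (.push k (regIs true))

/-- Pop a bit into the register. -/
def pop (k : Stk) : Cmd α := .instr (.pop k)

/-- Clear the register. -/
def clear : Cmd α := .instr .clear

/-- Do nothing. -/
def skip : Cmd α := .instr .skip

/-- Move the contents of a stack onto another one, in reverse. -/
def move (k k' : Stk) : Cmd α := pop k ;; .loop Option.isSome (pushReg k' ;; pop k)

theorem runs_move_loop {k k' : Stk} (hk : k ≠ k') (l : List Bool) :
    ∀ s : State α, s.get k = l →
      Runs (.loop Option.isSome (pushReg k' ;; pop k))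
        { s.set k l.tail with reg := l.head?.map .inr }
        { (s.set k' (l.reverse ++ s.get k')).set k [] with reg := none } (3 * l.length + 1) := by
  induction l with
  | nil =>
    intro s _
    refine (Runs.loopDone (s := { s.set k [] with reg := none }) rfl).of_eq rfl ?_ (by simp)
    cases k' <;> rfl
  | cons b l ih =>
    intro s hs
    have hnext := ih ((s.set k' (b :: s.get k')).set k l) (by cases k <;> rfl)
    refine (Runs.loopStep (s := { s.set k l with reg := some (.inr b) }) rfl
      ((Runs.instr rfl).seq (Runs.instr ?_)) hnext).of_eq rfl ?_ ?_
    · cases k <;> cases k' <;> first | contradiction | (cases b <;> rfl)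
    · cases k <;> cases k' <;> first
        | contradiction
        | simp only [State.set, State.get, List.reverse_cons, List.append_assoc,
            List.cons_append, List.nil_append]
    · simp only [List.length_cons]; lia

theorem runs_move {k k' : Stk} (hk : k ≠ k') (s : State α) :
    Runs (move k k') s
      { (s.set k' ((s.get k).reverse ++ s.get k')).set k [] with reg := none }
      (3 * (s.get k).length + 2) :=
  ((Runs.instr rfl).seq (runs_move_loop hk (s.get k) s rfl)).mono (by lia)

/-- Empty a stack. -/
def discard (k : Stk) : Cmd α := pop k ;; .loop Option.isSome (pop k)

theorem runs_discard_loop (k : Stk) (l : List Bool) (s : State α) :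
    Runs (.loop Option.isSome (pop k)) { s.set k l.tail with reg := l.head?.map .inr }
      { s.set k [] with reg := none } (2 * l.length + 1) := by
  induction l with
  | nil => exact (Runs.loopDone rfl).mono (by simp)
  | cons b l ih =>
    refine (Runs.loopStep (s := { s.set k l with reg := some (.inr b) }) rfl
      (Runs.instr ?_) ih).mono ?_
    · cases k <;> rfl
    · simp only [List.length_cons]; lia

theorem runs_discard (k : Stk) (s : State α) :
    Runs (discard k) s { s.set k [] with reg := none } (2 * (s.get k).length + 2) :=
  ((Runs.instr rfl).seq (runs_discard_loop k (s.get k) s)).mono (by lia)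

/-- Push the bit in the register if a flag is set. -/
def pushIf (k : Stk) : Bool → Cmd α
  | true => pushReg k
  | false => skip

/-- The body of the loop of `scan`. -/
def scanBody (f₁ f₂ f₃ : Bool) : Cmd α :=
  pop .val ;; (pushIf .tmp₁ f₁ ;; pushIf .tmp₂ f₂ ;; pushIf .tmp₃ f₃) ;;
    .ite (regIs true) (push .cnt true ;; push .cnt true) skip ;; pop .cnt

/-- Pop the topmost tree of the value stack, copying its word in reverse to each of the flagged
stacks. The counter holds the number of subtrees that are still to come after the current one, in
unary. -/
def scan (f₁ f₂ f₃ : Bool) : Cmd α :=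
  push .cnt true ;; pop .cnt ;; .loop Option.isSome (scanBody f₁ f₂ f₃)

/-- Prepend the reverse of a list if a flag is set. -/
def prependIf (f : Bool) (l x : List Bool) : List Bool := if f then l.reverse ++ x else x

theorem prependIf_append (f : Bool) (l l' x : List Bool) :
    prependIf f (l ++ l') x = prependIf f l' (prependIf f l x) := by
  cases f <;> simp [prependIf]

theorem prependIf_cons (f : Bool) (b : Bool) (l x : List Bool) :
    prependIf f (b :: l) x = prependIf f l (prependIf f [b] x) :=
  prependIf_append f [b] l x

theorem runs_pushIfs (f₁ f₂ f₃ b : Bool) (v x₁ x₂ x₃ c : List Bool) :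
    Runs (α := α) (pushIf .tmp₁ f₁ ;; pushIf .tmp₂ f₂ ;; pushIf .tmp₃ f₃)
      ⟨some (.inr b), [], v, x₁, x₂, x₃, c⟩
      ⟨some (.inr b), [], v, prependIf f₁ [b] x₁, prependIf f₂ [b] x₂, prependIf f₃ [b] x₃, c⟩
      3 := by
  refine Runs.seq (m := 1) (n := 2)
    (s' := ⟨some (.inr b), [], v, prependIf f₁ [b] x₁, x₂, x₃, c⟩) ?_
    (Runs.seq (m := 1) (n := 1)
      (s' := ⟨some (.inr b), [], v, prependIf f₁ [b] x₁, prependIf f₂ [b] x₂, x₃, c⟩) ?_ ?_)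
  · cases f₁ <;> cases b <;> exact Runs.instr rfl
  · cases f₂ <;> cases b <;> exact Runs.instr rfl
  · cases f₃ <;> cases b <;> exact Runs.instr rfl

theorem runs_scanBody (f₁ f₂ f₃ : Bool) (r : Reg α) (b : Bool) (v x₁ x₂ x₃ c : List Bool) :
    Runs (scanBody f₁ f₂ f₃) ⟨r, [], b :: v, x₁, x₂, x₃, c⟩
      ⟨if b then some (.inr true) else c.head?.map .inr, [], v, prependIf f₁ [b] x₁,
        prependIf f₂ [b] x₂, prependIf f₃ [b] x₃, if b then true :: c else c.tail⟩ 8 := by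
  have hpop : Runs (pop .val) ⟨r, [], b :: v, x₁, x₂, x₃, c⟩
      ⟨some (.inr b), [], v, x₁, x₂, x₃, c⟩ 1 := Runs.instr rfl
  have hpush := runs_pushIfs (α := α) f₁ f₂ f₃ b v x₁ x₂ x₃ c
  cases b with
  | false =>
    exact (hpop.seq (hpush.seq ((Runs.iteFalse rfl (Runs.instr rfl)).seq
      (Runs.instr rfl)))).mono (by simp)
  | true =>
    exact hpop.seq (hpush.seq ((Runs.iteTrue rfl ((Runs.instr rfl).seq (Runs.instr rfl))).seq
      (Runs.instr rfl)))

theorem runs_scan_loop (f₁ f₂ f₃ : Bool) (t : Tree) :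
    ∀ (b : Bool) (rest x₁ x₂ x₃ c : List Bool) (s' : State α) (n : ℕ),
      Runs (.loop Option.isSome (scanBody f₁ f₂ f₃))
        ⟨c.head?.map .inr, [], rest, prependIf f₁ t.word x₁, prependIf f₂ t.word x₂,
          prependIf f₃ t.word x₃, c.tail⟩ s' n →
      Runs (.loop Option.isSome (scanBody f₁ f₂ f₃))
        ⟨some (.inr b), [], t.word ++ rest, x₁, x₂, x₃, c⟩ s' (n + 9 * t.size) := by
  induction t with
  | nil =>
    intro b rest x₁ x₂ x₃ c s' n h
    exact (Runs.loopStep rfl (runs_scanBody f₁ f₂ f₃ _ false rest x₁ x₂ x₃ c) h).mono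
      (by simp; lia)
  | cons a d iha ihd =>
    intro b rest x₁ x₂ x₃ c s' n h
    simp only [Tree.word, prependIf_cons (l := a.word ++ d.word), prependIf_append] at h
    have hsub := iha true _ _ _ _ (true :: c) _ _ (ihd true _ _ _ _ _ _ _ h)
    have hbody := runs_scanBody (α := α) f₁ f₂ f₃ (some (.inr b)) true (a.word ++ (d.word ++ rest))
      x₁ x₂ x₃ c
    refine (Runs.loopStep rfl hbody hsub).of_eq ?_ rfl ?_
    · simp [Tree.word]
    · simp; lia

/-- The memory between two tree operations: only the value stack and scratch stacks are in use. -/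
def base (v x₁ x₂ x₃ : List Bool) : State α := ⟨none, [], v, x₁, x₂, x₃, []⟩

theorem runs_scan (f₁ f₂ f₃ : Bool) (t : Tree) (rest x₁ x₂ x₃ : List Bool) :
    Runs (α := α) (scan f₁ f₂ f₃) (base (t.word ++ rest) x₁ x₂ x₃)
      (base rest (prependIf f₁ t.word x₁) (prependIf f₂ t.word x₂) (prependIf f₃ t.word x₃))
      (9 * t.size + 3) :=
  (Runs.seq (Runs.instr rfl) (Runs.seq (Runs.instr rfl)
    (runs_scan_loop f₁ f₂ f₃ t true rest x₁ x₂ x₃ [] _ 1 (Runs.loopDone rfl)))).mono (by lia)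

/-- Drop the topmost tree. -/
def drop : Cmd α := scan false false false

theorem runs_drop (t : Tree) (rest x₁ x₂ x₃ : List Bool) :
    Runs (α := α) drop (base (t.word ++ rest) x₁ x₂ x₃) (base rest x₁ x₂ x₃) (9 * t.size + 3) :=
  runs_scan false false false t rest x₁ x₂ x₃

/-- Duplicate the topmost tree. -/
def dup : Cmd α := scan true true false ;; move .tmp₁ .val ;; move .tmp₂ .val

theorem runs_dup (t : Tree) (rest : List Bool) :
    Runs (α := α) dup (base (t.word ++ rest) [] [] []) (base (t.word ++ (t.word ++ rest)) [] [] [])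
      (15 * t.size + 7) := by
  refine ((runs_scan true true false t rest [] [] []).seq
    ((runs_move (by simp) _).seq (runs_move (by simp) _))).of_eq rfl ?_ ?_
  · simp [base, State.set, State.get, prependIf]
  · simp [base, State.set, State.get, prependIf, Tree.size]; lia

/-- Exchange the two topmost trees. -/
def swap : Cmd α :=
  scan true false false ;; scan false true false ;; move .tmp₁ .val ;; move .tmp₂ .val

theorem runs_swap (a b : Tree) (rest x₃ : List Bool) :
    Runs (α := α) swap (base (a.word ++ (b.word ++ rest)) [] [] x₃)
      (base (b.word ++ (a.word ++ rest)) [] [] x₃) (12 * (a.size + b.size) + 10) := by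
  refine ((runs_scan true false false a _ [] [] x₃).seq
    ((runs_scan false true false b _ _ _ _).seq
    ((runs_move (by simp) _).seq (runs_move (by simp) _)))).of_eq rfl ?_ ?_
  · simp [base, State.set, State.get, prependIf]
  · simp [base, State.set, State.get, prependIf, Tree.size]; lia

/-- `Computes c t u n`: on a memory with `t` on top of the value stack, the program `c` replaces
`t` by `u` within `n` steps. -/
def Computes (c : Cmd α) (t u : Tree) (n : ℕ) : Prop :=
  ∀ rest, Runs c (base (t.word ++ rest) [] [] []) (base (u.word ++ rest) [] [] []) n

theorem Computes.mono {c : Cmd α} {t u : Tree} {m n : ℕ} (h : Computes c t u m) (hmn : m ≤ n) :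
    Computes c t u n :=
  fun rest => (h rest).mono hmn

theorem Computes.size_le {c : Cmd α} {t u : Tree} {n : ℕ} (h : Computes c t u n) :
    u.size ≤ t.size + n := by
  simpa [base, State.total, Tree.size] using (h []).total_le

theorem Computes.seq {c d : Cmd α} {t u v : Tree} {m n : ℕ} (h : Computes c t u m)
    (h' : Computes d u v n) : Computes (c ;; d) t v (m + n) :=
  fun rest => (h rest).seq (h' rest)

theorem computes_skip (t : Tree) : Computes (α := α) skip t t 1 := fun _ => Runs.instr rfl

/-- Pop a bit of the value stack and forget it. -/
def popVal : Cmd α := pop .val ;; clear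

theorem runs_popVal (b : Bool) (v : List Bool) :
    Runs (α := α) popVal (base (b :: v) [] [] []) (base v [] [] []) 2 :=
  (Runs.instr rfl).seq (Runs.instr rfl)

/-- Replace the topmost tree by its first subtree. -/
def takeFst : Cmd α := popVal ;; scan true false false ;; drop ;; move .tmp₁ .val

theorem computes_takeFst (a b : Tree) :
    Computes (α := α) takeFst (.cons a b) a (12 * (Tree.cons a b).size) := by
  intro rest
  refine ((runs_popVal true (a.word ++ (b.word ++ rest))).seq ((runs_scan true false false a
    (b.word ++ rest) [] [] []).seq ((runs_drop b _ _ _ _).seq (runs_move (by simp) _)))).of_eq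
    ?_ ?_ ?_
  · simp [Tree.word]
  · simp [base, State.set, State.get, prependIf]
  · simp [base, State.get, prependIf, Tree.size, Tree.word]; lia

/-- Replace the topmost tree by its second subtree. -/
def takeSnd : Cmd α := popVal ;; drop

theorem computes_takeSnd (a b : Tree) :
    Computes (α := α) takeSnd (.cons a b) b (12 * (Tree.cons a b).size) := by
  intro rest
  refine ((runs_popVal true (a.word ++ (b.word ++ rest))).seq
    (runs_drop a (b.word ++ rest) [] [] [])).of_eq ?_ rfl ?_
  · simp [Tree.word]
  · simp; lia

/-- Replace the topmost tree by the pair of its images under two programs. -/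
def pairUp (c d : Cmd α) : Cmd α := dup ;; d ;; swap ;; c ;; push .val true

theorem Computes.pairUp {c d : Cmd α} {t u v : Tree} {m n : ℕ} (h : Computes c t u m)
    (h' : Computes d t v n) :
    Computes (pairUp c d) t (.cons u v) (m + n + (27 * t.size + 12 * v.size + 18)) := by
  intro rest
  refine ((runs_dup t rest).seq ((h' _).seq ((runs_swap v t rest []).seq
    ((h _).seq (Runs.instr rfl))))).of_eq rfl ?_ ?_
  · simp [base, Instr.exec, State.set, State.get, Tree.word]
  · lia

/-- Push a constant word. -/
def pushWord : List Bool → Cmd α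
  | [] => skip
  | b :: l => pushWord l ;; push .val b

theorem runs_pushWord (l : List Bool) (s : State α) :
    Runs (pushWord l) s { s with val := l ++ s.val } (l.length + 1) := by
  induction l with
  | nil => exact Runs.instr rfl
  | cons b l ih => exact Runs.seq ih (Runs.instr rfl)

/-- Replace the topmost tree by a constant. -/
def constant (t : Tree) : Cmd α := drop ;; pushWord t.word

theorem computes_constant (t u : Tree) :
    Computes (α := α) (constant u) t u (9 * t.size + u.size + 4) := fun rest =>
  ((runs_drop t rest [] [] []).seq (runs_pushWord _ _)).mono (by simp only [Tree.size]; lia)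

/-- On a pair with an empty first component, drop that component and run `c`; on any other pair, run
`d`. -/
def branch (c d : Cmd α) : Cmd α :=
  pop .val ;; pop .val ;;
    .ite (regIs true) (push .val true ;; push .val true ;; clear ;; d) (clear ;; c)

theorem Computes.branch_nil {c d : Cmd α} {t u : Tree} {n : ℕ} (h : Computes c t u n) :
    Computes (branch c d) (.cons .nil t) u (n + 10) := fun rest =>
  ((Runs.instr rfl).seq ((Runs.instr rfl).seq
    (Runs.iteFalse rfl ((Runs.instr rfl).seq (h rest))))).mono (by lia)

theorem Computes.branch_cons {c d : Cmd α} {a b t u : Tree} {n : ℕ}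
    (h : Computes d (.cons (.cons a b) t) u n) :
    Computes (branch c d) (.cons (.cons a b) t) u (n + 10) := fun rest =>
  ((Runs.instr rfl).seq ((Runs.instr rfl).seq
    (Runs.iteTrue rfl ((Runs.instr rfl).seq ((Runs.instr rfl).seq ((Runs.instr rfl).seq
      (h rest))))))).mono (by lia)

/-! ### Loops over lists of trees -/

/-- The memory after the first bit of `v` has been popped from the value stack. -/
def popped (v : List Bool) : State α := ⟨v.head?.map .inr, [], v.tail, [], [], [], []⟩

/-- The body of the loop of `foldCmd`: from `cons a l` and the state on the value stack, it leads to
`l` and the next state, in each case with the first bit popped. -/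
def foldBody (c : Cmd α) : Cmd α :=
  clear ;; scan false false true ;; swap ;; move .tmp₃ .val ;; push .val true ;; c ;; swap ;;
    pop .val

theorem runs_foldBody {c : Cmd α} {a t u : Tree} {T : ℕ} (h : Computes c (.cons a t) u T) (l : Tree)
    (rest : List Bool) :
    Runs (foldBody c) (popped ((Tree.cons a l).word ++ (t.word ++ rest)))
      (popped (l.word ++ (u.word ++ rest)))
      (T + 12 * (a.size + t.size + u.size) + 24 * l.size + 28) := by
  have hclear : Runs (α := α) clear (popped ((Tree.cons a l).word ++ (t.word ++ rest)))
      (base (a.word ++ (l.word ++ (t.word ++ rest))) [] [] []) 1 :=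
    Runs.instr (by simp [Instr.exec, popped, base, Tree.word])
  have hmove : Runs (α := α) (move .tmp₃ .val)
      (base (t.word ++ (l.word ++ rest)) [] [] (prependIf true a.word []))
      (base (a.word ++ (t.word ++ (l.word ++ rest))) [] [] []) (3 * a.size + 2) :=
    (runs_move (by simp) _).of_eq rfl (by simp [base, State.set, State.get, prependIf])
      (by simp [base, State.get, prependIf, Tree.size])
  have hpush : Runs (α := α) (push .val true)
      (base (a.word ++ (t.word ++ (l.word ++ rest))) [] [] [])
      (base ((Tree.cons a t).word ++ (l.word ++ rest)) [] [] []) 1 :=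
    Runs.instr (by simp [base, Instr.exec, State.set, State.get, Tree.word])
  exact (hclear.seq ((runs_scan false false true a _ [] [] []).seq ((runs_swap l t rest _).seq
    (hmove.seq (hpush.seq ((h (l.word ++ rest)).seq
      ((runs_swap u l rest []).seq (Runs.instr rfl)))))))).mono (by lia)

/-- Fold the program `c` over a list of trees: from the pair of a list and a state, it computes the
last state. The program `c` gets the pair of an item and a state. -/
def foldCmd (c : Cmd α) : Cmd α :=
  pop .val ;; pop .val ;; .loop (regIs true) (foldBody c) ;; clear

section Fold

variable {β σ : Type} {code : β → Tree} {code' : σ → Tree} {c : Cmd α} {step : σ → β → σ} {T B : ℕ}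

theorem runs_foldCmd_loop (rest : List Bool) (l : List β) :
    ∀ s : σ, (∀ s, (code' s).size ≤ B → ∀ b ∈ l,
        Computes c (.cons (code b) (code' s)) (code' (step s b)) T) →
      (∀ l', l' <+: l → (code' (l'.foldl step s)).size ≤ B) →
      Runs (.loop (regIs true) (foldBody c))
        (popped ((Tree.ofList (l.map code)).word ++ ((code' s).word ++ rest)))
        (popped (Tree.nil.word ++ ((code' (l.foldl step s)).word ++ rest)))
        (l.length * (T + 24 * (Tree.ofList (l.map code)).size + 24 * B + 40) + 1) := by
  induction l with
  | nil => exact fun s _ _ => (Runs.loopDone rfl).mono (by simp)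
  | cons b l ih =>
    intro s hc hB
    have hs : (code' s).size ≤ B := hB [] List.nil_prefix
    have hs' : (code' (step s b)).size ≤ B := hB [b] (by simp)
    have hbody := runs_foldBody (hc s hs b (by simp)) (Tree.ofList (l.map code)) rest
    have hloop := ih (step s b) (fun s hs b hb => hc s hs b (by simp [hb]))
      fun l' hl' => hB (b :: l') ((List.prefix_cons_inj b).2 hl')
    refine (Runs.loopStep rfl hbody hloop).mono ?_
    simp only [List.map_cons, Tree.ofList, Tree.size_cons, List.length_cons]
    nlinarith [Nat.zero_le (l.length * (code b).size), Nat.zero_le l.length]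

theorem computes_foldCmd (l : List β) (s : σ)
    (hc : ∀ s, (code' s).size ≤ B → ∀ b ∈ l,
      Computes c (.cons (code b) (code' s)) (code' (step s b)) T)
    (hB : ∀ l', l' <+: l → (code' (l'.foldl step s)).size ≤ B) :
    Computes (foldCmd c) (.cons (Tree.ofList (l.map code)) (code' s)) (code' (l.foldl step s))
      (l.length * (T + 24 * (Tree.ofList (l.map code)).size + 24 * B + 40) + 5) := fun rest => by
  have hpop : Runs (α := α) (pop .val)
      ⟨some (.inr true), [], (Tree.ofList (l.map code)).word ++ (code' s).word ++ rest,
        [], [], [], []⟩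
      (popped ((Tree.ofList (l.map code)).word ++ ((code' s).word ++ rest))) 1 :=
    Runs.instr (by simp [Instr.exec, popped, State.set, State.get])
  exact ((Runs.instr rfl).seq (hpop.seq ((runs_foldCmd_loop rest l s hc hB).seq
    (Runs.instr rfl)))).mono (by lia)

end Fold

/-! ### Comparison of trees -/

/-- Compare the next bit of the second word with `b`; at a mismatch, raise the flag and leave the
loop, and otherwise pop the next bit of the first word. -/
def compareBit (b : Bool) : Cmd α :=
  pop .tmp₂ ;; .ite (regIs b) (pop .tmp₃) (push .tmp₁ true ;; clear)

/-- Check that the first word, on `tmp₃`, is a prefix of the second one, on `tmp₂`. The flag for a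
mismatch is the top of `tmp₁`. -/
def compareLoop : Cmd α :=
  .loop Option.isSome (.ite (regIs true) (compareBit true) (compareBit false))

theorem runs_compareLoop (v : List Bool) : ∀ x y : List Bool, ∃ x' y' : List Bool,
    x'.length ≤ x.length ∧ y'.length ≤ y.length ∧
      Runs (α := α) compareLoop ⟨x.head?.map .inr, [], v, [], y, x.tail, []⟩
        (base v (if x.isPrefixOf y then [] else [true]) y' x') (6 * x.length + 1)
  | [], y => ⟨[], y, le_rfl, le_rfl, by simpa [base, compareLoop] using Runs.loopDone rfl⟩
  | b :: x, y => by
    by_cases hb : y.head? = some b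
    · obtain ⟨y, rfl⟩ : ∃ z, y = b :: z := ⟨_, List.eq_cons_of_mem_head? hb⟩
      obtain ⟨x', y', hx', hy', h⟩ := runs_compareLoop v x y
      refine ⟨x', y', hx'.trans (by simp), hy'.trans (by simp), ?_⟩
      rw [List.isPrefixOf_cons_cons_self]
      have hbit : Runs (α := α) (compareBit b) ⟨some (.inr b), [], v, [], b :: y, x, []⟩
          ⟨x.head?.map .inr, [], v, [], y, x.tail, []⟩ 3 :=
        (Runs.instr rfl).seq
          (Runs.iteTrue (by simp [Instr.exec, regIs, State.get]) (Runs.instr rfl))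
      cases b
      · exact (Runs.loopStep rfl (Runs.iteFalse rfl hbit) h).mono (by simp; lia)
      · exact (Runs.loopStep rfl (Runs.iteTrue rfl hbit) h).mono (by simp; lia)
    · refine ⟨x, y.tail, by simp, by simp, ?_⟩
      rw [if_neg (by rw [List.isPrefixOf_iff_prefix]; rintro ⟨z, rfl⟩; simp at hb)]
      have hbit : Runs (α := α) (compareBit b) ⟨some (.inr b), [], v, [], y, x, []⟩
          (base v [true] y.tail x) 4 := by
        refine (Runs.instr rfl).seq (Runs.iteFalse ?_ ((Runs.instr rfl).seq (Runs.instr rfl)))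
        rcases y with _ | ⟨c, y⟩
        · rfl
        · cases b <;> cases c <;> first | rfl | simp at hb
      cases b
      · exact (Runs.loopStep rfl (Runs.iteFalse rfl hbit) (Runs.loopDone rfl)).mono (by simp)
      · exact (Runs.loopStep rfl (Runs.iteTrue rfl hbit) (Runs.loopDone rfl)).mono (by simp)

/-- Move the two components of a pair to `tmp₃` and `tmp₂`. -/
def unpack : Cmd α :=
  popVal ;; scan true false false ;; move .tmp₁ .tmp₃ ;; scan true false false ;; move .tmp₁ .tmp₂

theorem runs_unpack (a b : Tree) (rest : List Bool) :
    Runs (α := α) unpack (base ((Tree.cons a b).word ++ rest) [] [] [])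
      (base rest [] b.word a.word) (12 * (Tree.cons a b).size) := by
  refine ((runs_popVal true (a.word ++ (b.word ++ rest))).seq ((runs_scan true false false a
    (b.word ++ rest) [] [] []).seq ((runs_move (by simp) _).seq (Runs.seq
      ((runs_scan true false false b rest [] [] a.word).of_eq ?_ rfl le_rfl)
      (runs_move (by simp) _))))).of_eq ?_ ?_ ?_
  · simp [base, State.set, State.get, prependIf]
  · simp [Tree.word]
  · simp [base, State.set, State.get, prependIf]
  · simp [base, State.get, prependIf, Tree.size, Tree.word]; lia

/-- Replace the mismatch flag by the tree of the opposite truth value. -/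
def answer : Cmd α :=
  discard .tmp₂ ;; discard .tmp₃ ;; pop .tmp₁ ;;
    .ite Option.isSome (clear ;; pushWord (Tree.ofBool false).word)
      (pushWord (Tree.ofBool true).word)

theorem runs_answer (v y x : List Bool) (p : Bool) :
    Runs (α := α) answer (base v (if p then [] else [true]) y x)
      (base ((Tree.ofBool p).word ++ v) [] [] []) (2 * x.length + 2 * y.length + 11) := by
  cases p
  · exact ((runs_discard .tmp₂ _).seq ((runs_discard .tmp₃ _).seq ((Runs.instr rfl).seq
      (Runs.iteTrue rfl ((Runs.instr rfl).seq (runs_pushWord _ _)))))).mono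
        (by simp [base, State.get, State.set, Tree.ofBool, Tree.word]; lia)
  · exact ((runs_discard .tmp₂ _).seq ((runs_discard .tmp₃ _).seq ((Runs.instr rfl).seq
      (Runs.iteFalse rfl (runs_pushWord _ _))))).mono
        (by simp [base, State.get, State.set, Tree.ofBool, Tree.word]; lia)

/-- Replace a pair of trees by the truth value of their equality. Since Polish notation is
prefix-free, it suffices to check that one word is a prefix of the other. -/
def compare : Cmd α := unpack ;; pop .tmp₃ ;; compareLoop ;; answer

theorem computes_compare (a b : Tree) :
    Computes (α := α) compare (.cons a b) (Tree.ofBool (decide (a = b)))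
      (20 * (Tree.cons a b).size + 40) := by
  intro rest
  obtain ⟨x, y, hx, hy, hloop⟩ := runs_compareLoop (α := α) rest a.word b.word
  have hanswer := runs_answer (α := α) rest y x (a.word.isPrefixOf b.word)
  rw [Bool.eq_iff_iff.2 (by simpa using Tree.word_prefix_iff :
    a.word.isPrefixOf b.word = true ↔ decide (a = b) = true)] at hloop hanswer
  refine ((runs_unpack a b rest).seq ((Runs.instr rfl).seq (hloop.seq hanswer))).mono ?_
  simp only [Tree.length_word, Tree.size_cons] at hx hy ⊢
  lia

end Programs

/-! ### Data types coded by trees -/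

/-- A data type whose elements are coded by trees. -/
class Coded (α : Type) where
  code : α → Tree
  code_injective : Function.Injective code

open Coded (code)

/-- The size of the code of a datum. -/
def size {α : Type} [Coded α] (a : α) : ℕ := (code a).size

instance : Coded Unit := ⟨fun _ => .nil, fun _ _ _ => rfl⟩

instance : Coded Bool := ⟨Tree.ofBool, by intro a b; cases a <;> cases b <;> simp [Tree.ofBool]⟩

instance {α β : Type} [Coded α] [Coded β] : Coded (α × β) where
  code x := .cons (code x.1) (code x.2)
  code_injective := by
    rintro ⟨a, b⟩ ⟨c, d⟩ h
    simp only [Tree.cons.injEq] at h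
    rw [Coded.code_injective h.1, Coded.code_injective h.2]

instance {α : Type} [Coded α] : Coded (List α) where
  code l := Tree.ofList (l.map code)
  code_injective _ _ h := List.map_injective_iff.2 Coded.code_injective (Tree.ofList_injective h)

/-- Natural numbers are coded in unary. -/
instance : Coded ℕ where
  code n := code (List.replicate n ())
  code_injective m n h := by simpa using congrArg List.length (Coded.code_injective h)

section Size

variable {α β : Type} [Coded α] [Coded β]

@[simp] theorem size_unit (a : Unit) : size a = 1 := rfl

theorem size_bool_le (b : Bool) : size b ≤ 3 := by
  cases b <;> simp [size, code, Tree.ofBool]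

@[simp] theorem size_prod (x : α × β) : size x = size x.1 + size x.2 + 1 := Tree.size_cons _ _

@[simp] theorem size_nil : size ([] : List α) = 1 := rfl

@[simp] theorem size_cons (a : α) (l : List α) : size (a :: l) = size a + size l + 1 :=
  Tree.size_cons _ _

@[simp] theorem size_nat (n : ℕ) : size n = 2 * n + 1 := by
  change size (List.replicate n ()) = _
  induction n with
  | zero => rfl
  | succ n ih => rw [List.replicate_succ, size_cons, ih, size_unit]; lia

theorem length_le_size (l : List α) : l.length ≤ size l := by
  induction l with
  | nil => simp
  | cons a l ih => simp; lia

theorem size_le_of_mem {a : α} {l : List α} (h : a ∈ l) : size a ≤ size l := by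
  induction l with
  | nil => simp at h
  | cons b l ih =>
    rcases List.mem_cons.1 h with rfl | h
    · simp; lia
    · have := ih h; simp; lia

theorem size_append (l l' : List α) : size (l ++ l') + 1 = size l + size l' := by
  induction l with
  | nil => simp; lia
  | cons a l ih => simp; lia

theorem size_le_of_sublist {l l' : List α} (h : l.Sublist l') : size l ≤ size l' := by
  induction h with
  | slnil => rfl
  | cons a _ ih => simp; lia
  | cons_cons a _ ih => simp; lia

theorem size_list_le {l : List α} {c : ℕ} (h : ∀ a ∈ l, size a ≤ c) :
    size l ≤ l.length * (c + 1) + 1 := by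
  induction l with
  | nil => simp
  | cons a l ih =>
    have ha := h a (by simp)
    have hl := ih fun b hb => h b (by simp [hb])
    simp only [size_cons, List.length_cons]
    lia

end Size

/-! ### Polynomial and exponential bounds -/

/-- A function bounded by a polynomial in the size of the argument. -/
@[fun_prop]
def PolyBdd {α : Type} [Coded α] (g : α → ℕ) : Prop := ∃ k, ∀ a, g a ≤ (size a + 2) ^ k

/-- A function bounded by an exponential of a polynomial in the size of the argument. -/
@[fun_prop]
def ExpBdd {α : Type} [Coded α] (g : α → ℕ) : Prop := ∃ k, ∀ a, g a ≤ 2 ^ (size a + 2) ^ k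

section Bounds

variable {α β : Type} [Coded α] [Coded β]

theorem PolyBdd.mono {f g : α → ℕ} (h : PolyBdd g) (hfg : ∀ a, f a ≤ g a) : PolyBdd f :=
  let ⟨k, hk⟩ := h
  ⟨k, fun a => (hfg a).trans (hk a)⟩

@[fun_prop]
theorem polyBdd_const (c : ℕ) : PolyBdd fun _ : α => c :=
  ⟨c, fun a => (Nat.lt_two_pow_self (n := c)).le.trans (Nat.pow_le_pow_left (by lia) c)⟩

@[fun_prop]
theorem polyBdd_size : PolyBdd fun a : α => size a := ⟨1, fun a => by simp⟩

@[fun_prop]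
theorem PolyBdd.mul {f g : α → ℕ} (hf : PolyBdd f) (hg : PolyBdd g) :
    PolyBdd fun a => f a * g a :=
  let ⟨k, hk⟩ := hf
  let ⟨l, hl⟩ := hg
  ⟨k + l, fun a => by rw [pow_add]; exact Nat.mul_le_mul (hk a) (hl a)⟩

@[fun_prop]
theorem PolyBdd.add {f g : α → ℕ} (hf : PolyBdd f) (hg : PolyBdd g) :
    PolyBdd fun a => f a + g a := by
  obtain ⟨k, hk⟩ := hf
  obtain ⟨l, hl⟩ := hg
  refine ⟨max k l + 1, fun a => ?_⟩
  have hf := (hk a).trans (Nat.pow_le_pow_right (n := size a + 2) (by lia) (le_max_left k l))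
  have hg := (hl a).trans (Nat.pow_le_pow_right (n := size a + 2) (by lia) (le_max_right k l))
  rw [pow_succ]
  nlinarith [Nat.zero_le (size a * (size a + 2) ^ max k l)]

@[fun_prop]
theorem PolyBdd.pow {f : α → ℕ} (hf : PolyBdd f) (k : ℕ) : PolyBdd fun a => f a ^ k := by
  obtain ⟨l, hl⟩ := hf
  exact ⟨l * k, fun a => by rw [pow_mul]; exact Nat.pow_le_pow_left (hl a) k⟩

theorem PolyBdd.comp {g : β → ℕ} {f : α → β} (hg : PolyBdd g) (hf : PolyBdd fun a => size (f a)) :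
    PolyBdd fun a => g (f a) :=
  let ⟨k, hk⟩ := hg
  ((hf.add (polyBdd_const 2)).pow k).mono fun a => hk (f a)

theorem ExpBdd.mono {f g : α → ℕ} (h : ExpBdd g) (hfg : ∀ a, f a ≤ g a) : ExpBdd f :=
  let ⟨k, hk⟩ := h
  ⟨k, fun a => (hfg a).trans (hk a)⟩

@[fun_prop]
theorem PolyBdd.two_pow {f : α → ℕ} (h : PolyBdd f) : ExpBdd fun a => 2 ^ f a :=
  let ⟨k, hk⟩ := h
  ⟨k, fun a => Nat.pow_le_pow_right (by simp) (hk a)⟩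

@[fun_prop]
theorem PolyBdd.expBdd {f : α → ℕ} (h : PolyBdd f) : ExpBdd f :=
  h.two_pow.mono fun _ => Nat.lt_two_pow_self.le

@[fun_prop]
theorem ExpBdd.mul {f g : α → ℕ} (hf : ExpBdd f) (hg : ExpBdd g) : ExpBdd fun a => f a * g a := by
  obtain ⟨k, hk⟩ := hf
  obtain ⟨l, hl⟩ := hg
  have h : PolyBdd fun a : α => (size a + 2) ^ k + (size a + 2) ^ l := by fun_prop
  exact h.two_pow.mono fun a => by rw [pow_add]; exact Nat.mul_le_mul (hk a) (hl a)

theorem ExpBdd.add_one {f : α → ℕ} (hf : ExpBdd f) : ExpBdd fun a => f a + 1 := by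
  obtain ⟨k, hk⟩ := hf
  have h : PolyBdd fun a : α => (size a + 2) ^ k + 1 := by fun_prop
  refine h.two_pow.mono fun a => ?_
  have := hk a
  have := Nat.one_le_two_pow (n := (size a + 2) ^ k)
  rw [pow_succ]
  lia

@[fun_prop]
theorem ExpBdd.add {f g : α → ℕ} (hf : ExpBdd f) (hg : ExpBdd g) : ExpBdd fun a => f a + g a :=
  (hf.add_one.mul hg.add_one).mono fun a => by nlinarith [Nat.zero_le (f a * g a)]

theorem ExpBdd.pow {f : α → ℕ} (hf : ExpBdd f) (k : ℕ) : ExpBdd fun a => f a ^ k := by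
  induction k with
  | zero => exact (polyBdd_const 1).expBdd.mono (by simp)
  | succ k ih => exact (ih.mul hf).mono fun a => (pow_succ _ _).le

theorem PolyBdd.comp_exp {g : β → ℕ} {f : α → β} (hg : PolyBdd g)
    (hf : ExpBdd fun a => size (f a)) : ExpBdd fun a => g (f a) :=
  let ⟨k, hk⟩ := hg
  ((hf.add (polyBdd_const 2).expBdd).pow k).mono fun a => hk (f a)

theorem ExpBdd.comp_poly {g : β → ℕ} {f : α → β} (hg : ExpBdd g)
    (hf : PolyBdd fun a => size (f a)) : ExpBdd fun a => g (f a) :=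
  let ⟨k, hk⟩ := hg
  ((hf.add (polyBdd_const 2)).pow k).two_pow.mono fun a => hk (f a)

end Bounds

/-! ### Functions computable in polynomial or exponential time -/

/-- `ComputableIn f g`: a stack program computes `f` on codes, from `a` within `g a` steps. Such a
program exists for every input alphabet, since the input is not touched. -/
def ComputableIn {α β : Type} [Coded α] [Coded β] (f : α → β) (g : α → ℕ) : Prop :=
  ∀ Λ : Type, ∃ c : Cmd Λ, ∀ a, Computes c (code a) (code (f a)) (g a)

/-- A function computed by a stack program in polynomial time. -/
@[fun_prop]
def PolyTime {α β : Type} [Coded α] [Coded β] (f : α → β) : Prop :=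
  ∃ g : α → ℕ, PolyBdd g ∧ ComputableIn f g

/-- A function computed by a stack program in exponential time. -/
def ExpTime {α β : Type} [Coded α] [Coded β] (f : α → β) : Prop :=
  ∃ g : α → ℕ, ExpBdd g ∧ ComputableIn f g

section Composition

variable {α β γ : Type} [Coded α] [Coded β] [Coded γ]

theorem ComputableIn.size_le {f : α → β} {t : α → ℕ} (hf : ComputableIn f t) (a : α) :
    size (f a) ≤ size a + t a :=
  let ⟨_, hc⟩ := hf Empty
  (hc a).size_le

theorem ComputableIn.comp {g : β → γ} {f : α → β} {u : β → ℕ} {t : α → ℕ} (hg : ComputableIn g u)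
    (hf : ComputableIn f t) : ComputableIn (fun a => g (f a)) fun a => t a + u (f a) := fun Λ =>
  let ⟨c, hc⟩ := hf Λ
  let ⟨d, hd⟩ := hg Λ
  ⟨c ;; d, fun a => (hc a).seq (hd (f a))⟩

theorem ComputableIn.prodMk {f : α → β} {g : α → γ} {t u : α → ℕ} (hf : ComputableIn f t)
    (hg : ComputableIn g u) : ComputableIn (fun a => (f a, g a)) fun a =>
      t a + u a + (27 * size a + 12 * size (g a) + 18) := fun Λ =>
  let ⟨c, hc⟩ := hf Λ
  let ⟨d, hd⟩ := hg Λ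
  ⟨pairUp c d, fun a => (hc a).pairUp (hd a)⟩

@[fun_prop]
theorem PolyTime.size_bdd {f : α → β} (hf : PolyTime f) : PolyBdd fun a => size (f a) :=
  let ⟨_, hg, h⟩ := hf
  (polyBdd_size.add hg).mono h.size_le

theorem ExpTime.size_bdd {f : α → β} (hf : ExpTime f) : ExpBdd fun a => size (f a) :=
  let ⟨_, hg, h⟩ := hf
  (polyBdd_size.expBdd.add hg).mono h.size_le

theorem PolyTime.of_eq {f g : α → β} (hf : PolyTime f) (h : ∀ a, f a = g a) : PolyTime g :=
  funext h ▸ hf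

theorem PolyTime.of_code_eq {f : α → β} (h : ∀ a, code (f a) = code a) : PolyTime f :=
  ⟨_, polyBdd_const 1, fun _ => ⟨skip, fun a => h a ▸ computes_skip _⟩⟩

@[fun_prop]
theorem polyTime_id : PolyTime fun a : α => a := .of_code_eq fun _ => rfl

@[fun_prop]
theorem polyTime_const (b : β) : PolyTime fun _ : α => b :=
  ⟨fun a => 9 * size a + size b + 4, by fun_prop, fun _ =>
    ⟨constant (code b), fun a => computes_constant (code a) (code b)⟩⟩

@[fun_prop]
theorem PolyTime.comp {g : β → γ} {f : α → β} (hg : PolyTime g) (hf : PolyTime f) :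
    PolyTime fun a => g (f a) :=
  let ⟨_, ht, hft⟩ := hf
  let ⟨_, hu, hgu⟩ := hg
  ⟨_, ht.add (hu.comp hf.size_bdd), hgu.comp hft⟩

@[fun_prop]
theorem PolyTime.prodMk {f : α → β} {g : α → γ} (hf : PolyTime f) (hg : PolyTime g) :
    PolyTime fun a => (f a, g a) :=
  let ⟨_, ht, hft⟩ := hf
  let ⟨_, hu, hgu⟩ := hg
  ⟨_, by fun_prop, hft.prodMk hgu⟩

theorem PolyTime.comp_exp {g : β → γ} {f : α → β} (hg : PolyTime g) (hf : ExpTime f) :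
    ExpTime fun a => g (f a) :=
  let ⟨_, ht, hft⟩ := hf
  let ⟨_, hu, hgu⟩ := hg
  ⟨_, ht.add (hu.comp_exp hf.size_bdd), hgu.comp hft⟩

theorem ExpTime.comp_poly {g : β → γ} {f : α → β} (hg : ExpTime g) (hf : PolyTime f) :
    ExpTime fun a => g (f a) :=
  let ⟨_, ht, hft⟩ := hf
  let ⟨_, hu, hgu⟩ := hg
  ⟨_, ht.expBdd.add (hu.comp_poly hf.size_bdd), hgu.comp hft⟩

theorem ExpTime.prodMk {f : α → β} {g : α → γ} (hf : ExpTime f) (hg : ExpTime g) :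
    ExpTime fun a => (f a, g a) :=
  let ⟨_, ht, hft⟩ := hf
  let ⟨_, hu, hgu⟩ := hg
  have hs := hg.size_bdd
  ⟨_, by fun_prop, hft.prodMk hgu⟩

theorem ExpTime.of_eq {f g : α → β} (hf : ExpTime f) (h : ∀ a, f a = g a) : ExpTime g :=
  funext h ▸ hf

theorem PolyTime.expTime {f : α → β} (hf : PolyTime f) : ExpTime f :=
  let ⟨t, ht, hft⟩ := hf
  ⟨t, ht.expBdd, hft⟩

theorem polyTime_fst : PolyTime (Prod.fst : α × β → α) :=
  ⟨fun x => 12 * size x, by fun_prop, fun _ =>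
    ⟨takeFst, fun x => computes_takeFst (code x.1) (code x.2)⟩⟩

theorem polyTime_snd : PolyTime (Prod.snd : α × β → β) :=
  ⟨fun x => 12 * size x, by fun_prop, fun _ =>
    ⟨takeSnd, fun x => computes_takeSnd (code x.1) (code x.2)⟩⟩

@[fun_prop]
theorem PolyTime.fst {f : α → β × γ} (hf : PolyTime f) : PolyTime fun a => (f a).1 :=
  polyTime_fst.comp hf

@[fun_prop]
theorem PolyTime.snd {f : α → β × γ} (hf : PolyTime f) : PolyTime fun a => (f a).2 :=
  polyTime_snd.comp hf

@[fun_prop]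
theorem PolyTime.cons {l : α → List β} {b : α → β} (hb : PolyTime b) (hl : PolyTime l) :
    PolyTime fun a => b a :: l a :=
  (PolyTime.of_code_eq (f := fun x : β × List β => x.1 :: x.2) fun _ => rfl).comp (hb.prodMk hl)

theorem polyTime_eq [DecidableEq α] : PolyTime fun x : α × α => decide (x.1 = x.2) := by
  refine ⟨fun x => 20 * size x + 40, by fun_prop, fun Λ => ⟨compare, fun x => ?_⟩⟩
  have h := computes_compare (α := Λ) (code x.1) (code x.2)
  rwa [decide_eq_decide.2 (Coded.code_injective (α := α)).eq_iff] at h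

@[fun_prop]
theorem PolyTime.eq [DecidableEq β] {f g : α → β} (hf : PolyTime f) (hg : PolyTime g) :
    PolyTime fun a => decide (f a = g a) := polyTime_eq.comp (hf.prodMk hg)

end Composition

/-! ### Case distinctions -/

section Cases

variable {α β γ : Type} [Coded α] [Coded β] [Coded γ]

theorem PolyTime.list_casesOn {l : α → List β} {f : α → γ} {g : α → β → List β → γ}
    (hl : PolyTime l) (hf : PolyTime f)
    (hg : PolyTime fun x : α × β × List β => g x.1 x.2.1 x.2.2) :
    PolyTime fun a => match l a with
      | [] => f a
      | b :: t => g a b t := by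
  suffices h : PolyTime fun x : List β × α => match x.1 with
      | [] => f x.2
      | b :: t => g x.2 b t from h.comp (hl.prodMk polyTime_id)
  have hg' : PolyTime fun y : (β × List β) × α => g y.2 y.1.1 y.1.2 :=
    hg.comp (f := fun y : (β × List β) × α => (y.2, y.1.1, y.1.2)) (by fun_prop)
  obtain ⟨t, ⟨k, hk⟩, hft⟩ := hf
  obtain ⟨u, ⟨m, hm⟩, hgu⟩ := hg'
  refine ⟨fun x => (size x + 2) ^ k + (size x + 2) ^ m + 10, by fun_prop, fun Λ => ?_⟩
  obtain ⟨c, hc⟩ := hft Λ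
  obtain ⟨d, hd⟩ := hgu Λ
  refine ⟨branch c d, ?_⟩
  rintro ⟨_ | ⟨b, l⟩, a⟩
  · refine (hc a).branch_nil.mono (Nat.add_le_add_right ((hk a).trans ?_) 10)
    exact (Nat.pow_le_pow_left (by simp; lia) k).trans (Nat.le_add_right _ _)
  · refine (hd ((b, l), a)).branch_cons.mono (Nat.add_le_add_right ((hm _).trans ?_) 10)
    exact (Nat.pow_le_pow_left (by simp) m).trans (Nat.le_add_left _ _)

@[fun_prop]
theorem PolyTime.cond {b : α → Bool} {f g : α → β} (hb : PolyTime b) (hf : PolyTime f)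
    (hg : PolyTime g) : PolyTime fun a => cond (b a) (f a) (g a) := by
  have hlist : PolyTime fun b : Bool => if b then [()] else [] :=
    .of_code_eq fun b => by cases b <;> rfl
  convert (hlist.comp hb).list_casesOn hg (g := fun a _ _ => f a)
    (hf.comp (f := fun x : α × Unit × List Unit => x.1) (by fun_prop)) using 2 with a
  cases b a <;> rfl

@[fun_prop]
theorem PolyTime.isEmpty {l : α → List β} (hl : PolyTime l) : PolyTime fun a => (l a).isEmpty := by
  convert hl.list_casesOn (polyTime_const true)
    (g := fun _ _ _ => false) (by fun_prop) using 2 with a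
  cases l a <;> rfl

@[fun_prop]
theorem PolyTime.tail {l : α → List β} (hl : PolyTime l) : PolyTime fun a => (l a).tail := by
  convert hl.list_casesOn (polyTime_const []) (g := fun _ _ t => t) (by fun_prop) using 2 with a
  cases l a <;> rfl

@[fun_prop]
theorem PolyTime.headD {l : α → List β} {d : α → β} (hl : PolyTime l) (hd : PolyTime d) :
    PolyTime fun a => (l a).headD (d a) := by
  convert hl.list_casesOn hd (g := fun _ b _ => b) (by fun_prop) using 2 with a
  cases l a <;> rfl

@[fun_prop]
theorem PolyTime.not {b : α → Bool} (hb : PolyTime b) : PolyTime fun a => !(b a) := by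
  have h : PolyTime fun a => bif b a then false else true := by fun_prop
  convert h using 2 with a
  cases b a <;> rfl

@[fun_prop]
theorem PolyTime.and {b c : α → Bool} (hb : PolyTime b) (hc : PolyTime c) :
    PolyTime fun a => b a && c a := by
  have h : PolyTime fun a => bif b a then c a else false := by fun_prop
  convert h using 2 with a
  cases b a <;> rfl

@[fun_prop]
theorem PolyTime.or {b c : α → Bool} (hb : PolyTime b) (hc : PolyTime c) :
    PolyTime fun a => b a || c a := by
  have h : PolyTime fun a => bif b a then true else c a := by fun_prop
  convert h using 2 with a
  cases b a <;> rfl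

end Cases

/-! ### Iteration over lists -/

section Lists

variable {α β γ σ : Type} [Coded α] [Coded β] [Coded γ] [Coded σ]

/-- The time for a fold depends polynomially on a bound for the size of the states, whether or not
that bound is itself polynomial. -/
theorem PolyTime.exists_foldl_time {f : α → σ → β → σ}
    (hf : PolyTime fun x : α × σ × β => f x.1 x.2.1 x.2.2) :
    ∃ t : α × List β × ℕ → ℕ, PolyBdd t ∧ ∀ Λ : Type, ∃ c : Cmd Λ, ∀ a l s B,
      (∀ l', l' <+: l → size (l'.foldl (f a) s) ≤ B) →
        Computes c (code (l, a, s)) (code (l.foldl (f a) s)) (t (a, l, B)) := by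
  have hbody : PolyTime fun x : β × α × σ => (x.2.1, f x.2.1 x.2.2 x.1) :=
    polyTime_snd.fst.prodMk
      (hf.comp (f := fun x : β × α × σ => (x.2.1, x.2.2, x.1)) (by fun_prop))
  obtain ⟨u, ⟨k, hk⟩, hu⟩ := hbody
  refine ⟨fun x => x.2.1.length * ((size x + 2) ^ k + 24 * size x.2.1 + 24 * size x + 40) + 5 +
    12 * size x, ?_, fun Λ => ?_⟩
  · have hlen : PolyBdd fun x : α × List β × ℕ => x.2.1.length :=
      (polyTime_snd.fst.size_bdd).mono fun x => length_le_size _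
    fun_prop
  obtain ⟨c, hc⟩ := hu Λ
  refine ⟨foldCmd c ;; takeSnd, fun a l s B hB => ?_⟩
  have hfold : ∀ l' : List β, l'.foldl (fun (x : α × σ) b => (x.1, f x.1 x.2 b)) (a, s) =
      (a, l'.foldl (f a) s) := fun l' => by
    induction l' using List.reverseRecOn with
    | nil => rfl
    | append_singleton l' b ih => simp only [List.foldl_append, ih, List.foldl_cons, List.foldl_nil]
  have hsize : size (a, l, B) = size a + size l + 2 * B + 3 := by simp; lia
  have h := computes_foldCmd (B := size a + B + 1) (T := (size (a, l, B) + 2) ^ k) (c := c)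
    (code := code) (code' := code) (step := fun (x : α × σ) b => (x.1, f x.1 x.2 b)) l (a, s)
    (fun s' hs' b hb => (hc (b, s')).mono ((hk _).trans (Nat.pow_le_pow_left ?_ k)))
    fun l' hl' => ?_
  · rw [hfold] at h
    refine (h.seq (computes_takeSnd (code a) (code (l.foldl (f a) s)))).mono
      (Nat.add_le_add (Nat.add_le_add_right (Nat.mul_le_mul_left _ ?_) 5) ?_)
    · change _ + 24 * size l + _ + 40 ≤ _
      lia
    · change 12 * size (a, l.foldl (f a) s) ≤ _
      have := hB l List.prefix_rfl
      rw [size_prod, hsize]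
      lia
  · have : size b ≤ size l := size_le_of_mem hb
    change size (b, s') + 2 ≤ _
    change size s' ≤ _ at hs'
    rw [size_prod, hsize]
    lia
  · rw [hfold]
    have := hB l' hl'
    change size (a, l'.foldl (f a) s) ≤ _
    rw [size_prod]
    lia

theorem PolyTime.foldl {l : α → List β} {s : α → σ} {f : α → σ → β → σ} (hl : PolyTime l)
    (hs : PolyTime s) (hf : PolyTime fun x : α × σ × β => f x.1 x.2.1 x.2.2)
    (hB : ∃ g : α → ℕ, PolyBdd g ∧ ∀ a l', l' <+: l a → size (l'.foldl (f a) (s a)) ≤ g a) :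
    PolyTime fun a => (l a).foldl (f a) (s a) := by
  obtain ⟨g, hg, hB⟩ := hB
  obtain ⟨t, ht, hc⟩ := hf.exists_foldl_time
  obtain ⟨u, hu, hargs⟩ := hl.prodMk (polyTime_id.prodMk hs)
  refine ⟨fun a => u a + t (a, l a, g a),
    hu.add (ht.comp (f := fun a => (a, l a, g a)) (by simp only [size_prod, size_nat]; fun_prop)),
    fun Λ => ?_⟩
  obtain ⟨c, hc⟩ := hc Λ
  obtain ⟨d, hd⟩ := hargs Λ
  exact ⟨d ;; c, fun a => (hd a).seq (hc a (l a) (s a) (g a) (hB a))⟩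

theorem PolyTime.foldl_exp {l : α → List β} {s : α → σ} {f : α → σ → β → σ} (hl : PolyTime l)
    (hs : PolyTime s) (hf : PolyTime fun x : α × σ × β => f x.1 x.2.1 x.2.2)
    (hB : ∃ g : α → ℕ, ExpBdd g ∧ ∀ a l', l' <+: l a → size (l'.foldl (f a) (s a)) ≤ g a) :
    ExpTime fun a => (l a).foldl (f a) (s a) := by
  obtain ⟨g, hg, hB⟩ := hB
  obtain ⟨t, ht, hc⟩ := hf.exists_foldl_time
  obtain ⟨u, hu, hargs⟩ := hl.prodMk (polyTime_id.prodMk hs)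
  have ha := (polyBdd_size (α := α)).expBdd
  have hla := hl.size_bdd.expBdd
  refine ⟨fun a => u a + t (a, l a, g a), hu.expBdd.add
    (ht.comp_exp (f := fun a => (a, l a, g a)) (by simp only [size_prod, size_nat]; fun_prop)),
    fun Λ => ?_⟩
  obtain ⟨c, hc⟩ := hc Λ
  obtain ⟨d, hd⟩ := hargs Λ
  exact ⟨d ;; c, fun a => (hd a).seq (hc a (l a) (s a) (g a) (hB a))⟩

theorem PolyTime.foldl_of_add_le {l : α → List β} {s : α → σ} {f : α → σ → β → σ}
    (hl : PolyTime l) (hs : PolyTime s) (hf : PolyTime fun x : α × σ × β => f x.1 x.2.1 x.2.2)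
    (hB : ∃ g : α → ℕ, PolyBdd g ∧ ∀ a, ∀ s, ∀ b ∈ l a, size (f a s b) ≤ size s + g a) :
    PolyTime fun a => (l a).foldl (f a) (s a) := by
  obtain ⟨g, hg, hB⟩ := hB
  refine hl.foldl hs hf ⟨fun a => size (s a) + size (l a) * g a, by fun_prop, fun a l' hl' => ?_⟩
  suffices h : size (l'.foldl (f a) (s a)) ≤ size (s a) + l'.length * g a from
    h.trans (Nat.add_le_add_left
      (Nat.mul_le_mul_right _ (hl'.length_le.trans (length_le_size _))) _)
  have hmem : ∀ b ∈ l', b ∈ l a := fun b hb => hl'.subset hb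
  clear hl'
  induction l' using List.reverseRecOn with
  | nil => simp
  | append_singleton l' b ih =>
    have hfold := ih fun c hc => hmem c (by simp [hc])
    have hstep := hB a (l'.foldl (f a) (s a)) b (hmem b (by simp))
    simp only [List.foldl_append, List.foldl_cons, List.foldl_nil, List.length_append,
      List.length_singleton, add_mul, one_mul]
    lia

@[fun_prop]
theorem PolyTime.reverse {l : α → List β} (hl : PolyTime l) :
    PolyTime fun a => (l a).reverse := by
  refine (hl.foldl_of_add_le (f := fun _ s b => b :: s) (polyTime_const []) (by fun_prop)
    ⟨fun a => size (l a) + 1, by fun_prop, fun a s b hb => ?_⟩).of_eq fun a => by simp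
  have := size_le_of_mem hb
  simp only [size_cons]
  lia

theorem PolyTime.foldr_of_add_le {l : α → List β} {s : α → σ} {f : α → β → σ → σ}
    (hl : PolyTime l) (hs : PolyTime s) (hf : PolyTime fun x : α × β × σ => f x.1 x.2.1 x.2.2)
    (hB : ∃ g : α → ℕ, PolyBdd g ∧ ∀ a, ∀ s, ∀ b ∈ l a, size (f a b s) ≤ size s + g a) :
    PolyTime fun a => (l a).foldr (f a) (s a) := by
  obtain ⟨g, hg, hB⟩ := hB
  refine (hl.reverse.foldl_of_add_le (f := fun a s b => f a b s) hs ?_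
    ⟨g, hg, fun a s b hb => hB a s b (by simpa using hb)⟩).of_eq fun a => List.foldl_reverse
  exact hf.comp (f := fun x : α × σ × β => (x.1, x.2.2, x.2.1)) (by fun_prop)

@[fun_prop]
theorem PolyTime.append {l l' : α → List β} (hl : PolyTime l) (hl' : PolyTime l') :
    PolyTime fun a => l a ++ l' a := by
  refine (hl.foldr_of_add_le (f := fun _ b s => b :: s) hl' (by fun_prop)
    ⟨fun a => size (l a) + 1, by fun_prop, fun a s b hb => ?_⟩).of_eq fun a => by simp
  have := size_le_of_mem hb
  simp only [size_cons]
  lia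

theorem PolyTime.size_bdd_of_mem {l : α → List β} {f : α → β → γ} (hl : PolyTime l)
    (hf : PolyTime fun x : α × β => f x.1 x.2) :
    ∃ g : α → ℕ, PolyBdd g ∧ ∀ a, ∀ b ∈ l a, size (f a b) ≤ g a := by
  obtain ⟨k, hk⟩ := hf.size_bdd
  refine ⟨fun a => (size a + size (l a) + 3) ^ k, by fun_prop, fun a b hb =>
    (hk (a, b)).trans (Nat.pow_le_pow_left ?_ k)⟩
  have := size_le_of_mem hb
  simp only [size_prod]
  lia

@[fun_prop]
theorem PolyTime.flatMap {l : α → List β} {f : α → β → List γ} (hl : PolyTime l)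
    (hf : PolyTime fun x : α × β => f x.1 x.2) : PolyTime fun a => (l a).flatMap (f a) := by
  obtain ⟨g, hg, hB⟩ := hl.size_bdd_of_mem hf
  have : PolyTime fun x : α × List γ × β => f x.1 x.2.2 :=
    hf.comp (f := fun x : α × List γ × β => (x.1, x.2.2)) (by fun_prop)
  refine (hl.foldl_of_add_le (f := fun a s b => s ++ f a b) (polyTime_const []) (by fun_prop)
    ⟨g, hg, fun a s b hb => ?_⟩).of_eq fun a => List.flatMap_eq_foldl.symm
  have := hB a b hb
  have := size_append s (f a b)
  lia

@[fun_prop]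
theorem PolyTime.map {l : α → List β} {f : α → β → γ} (hl : PolyTime l)
    (hf : PolyTime fun x : α × β => f x.1 x.2) : PolyTime fun a => (l a).map (f a) :=
  (hl.flatMap (f := fun a b => [f a b]) (by fun_prop)).of_eq fun a =>
    List.map_eq_flatMap.symm

@[fun_prop]
theorem PolyTime.filter {l : α → List β} {p : α → β → Bool} (hl : PolyTime l)
    (hp : PolyTime fun x : α × β => p x.1 x.2) : PolyTime fun a => (l a).filter (p a) := by
  refine (hl.flatMap (f := fun a b => bif p a b then [b] else []) (by fun_prop)).of_eq fun a => ?_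
  induction l a with
  | nil => rfl
  | cons b l ih => cases h : p a b <;> simp [h, ih]

@[fun_prop]
theorem PolyTime.all {l : α → List β} {p : α → β → Bool} (hl : PolyTime l)
    (hp : PolyTime fun x : α × β => p x.1 x.2) : PolyTime fun a => (l a).all (p a) :=
  (hl.filter (p := fun a b => !p a b) (by fun_prop)).isEmpty.of_eq fun a => by
    rw [Bool.eq_iff_iff]; simp

@[fun_prop]
theorem PolyTime.any {l : α → List β} {p : α → β → Bool} (hl : PolyTime l)
    (hp : PolyTime fun x : α × β => p x.1 x.2) : PolyTime fun a => (l a).any (p a) :=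
  (hl.filter hp).isEmpty.not.of_eq fun a => by rw [Bool.eq_iff_iff]; simp

@[fun_prop]
theorem PolyTime.mem [BEq β] [LawfulBEq β] {b : α → β} {l : α → List β} (hb : PolyTime b)
    (hl : PolyTime l) : PolyTime fun a => decide (b a ∈ l a) := by
  classical
  exact (hl.any (p := fun a c => decide (b a = c)) (by fun_prop)).of_eq fun a => by
    rw [Bool.eq_iff_iff]; simp

end Lists

/-! ### Numbers in unary -/

section Unary

variable {α β γ σ : Type} [Coded α] [Coded β] [Coded γ] [Coded σ]

@[fun_prop]
theorem PolyTime.replicate_unit {n : α → ℕ} (hn : PolyTime n) :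
    PolyTime fun a => List.replicate (n a) () :=
  (PolyTime.of_code_eq (f := fun n => List.replicate n ()) fun _ => rfl).comp hn

@[fun_prop]
theorem PolyTime.length {l : α → List β} (hl : PolyTime l) : PolyTime fun a => (l a).length := by
  have hunit : PolyTime fun l : List Unit => l.length := .of_code_eq fun l => by
    exact congrArg code (List.eq_replicate_iff.2 ⟨rfl, fun _ _ => rfl⟩ :
      l = List.replicate l.length ()).symm
  exact (hunit.comp (hl.map (f := fun _ _ => ()) (polyTime_const ()))).of_eq fun a => by simp

omit [Coded σ] in
theorem foldl_replicate_unit (f : σ → σ) (n : ℕ) (s : σ) :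
    (List.replicate n ()).foldl (fun s _ => f s) s = f^[n] s := by
  induction n generalizing s with
  | zero => rfl
  | succ n ih => simp [List.replicate_succ, ih]

theorem PolyTime.iterate {n : α → ℕ} {s : α → σ} {f : α → σ → σ} (hn : PolyTime n)
    (hs : PolyTime s) (hf : PolyTime fun x : α × σ => f x.1 x.2)
    (hB : ∃ g : α → ℕ, PolyBdd g ∧ ∀ a, ∀ i ≤ n a, size ((f a)^[i] (s a)) ≤ g a) :
    PolyTime fun a => (f a)^[n a] (s a) := by
  obtain ⟨g, hg, hB⟩ := hB
  refine (hn.replicate_unit.foldl (f := fun a s _ => f a s) hs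
    (hf.comp (f := fun x : α × σ × Unit => (x.1, x.2.1)) (by fun_prop))
    ⟨g, hg, fun a l hl => ?_⟩).of_eq fun a => foldl_replicate_unit _ _ _
  obtain ⟨hlen, hrep⟩ := List.prefix_replicate_iff.1 hl
  rw [hrep, foldl_replicate_unit]
  exact hB a _ hlen

@[fun_prop]
theorem PolyTime.add {m n : α → ℕ} (hm : PolyTime m) (hn : PolyTime n) :
    PolyTime fun a => m a + n a :=
  (hm.replicate_unit.append hn.replicate_unit).length.of_eq fun a => by simp

@[fun_prop]
theorem PolyTime.mul {m n : α → ℕ} (hm : PolyTime m) (hn : PolyTime n) :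
    PolyTime fun a => m a * n a :=
  (hm.replicate_unit.flatMap (f := fun a _ => List.replicate (n a) ())
    (hn.comp polyTime_fst).replicate_unit).length.of_eq fun a => by simp

@[fun_prop]
theorem PolyTime.drop {l : α → List β} {n : α → ℕ} (hl : PolyTime l) (hn : PolyTime n) :
    PolyTime fun a => (l a).drop (n a) := by
  refine (hn.iterate (f := fun _ => List.tail) hl (by fun_prop)
    ⟨fun a => size (l a), by fun_prop, fun a i _ => ?_⟩).of_eq fun a => by rw [List.tail_iterate]
  rw [List.tail_iterate]
  exact size_le_of_sublist (List.drop_sublist i (l a))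

@[fun_prop]
theorem PolyTime.take {l : α → List β} {n : α → ℕ} (hl : PolyTime l) (hn : PolyTime n) :
    PolyTime fun a => (l a).take (n a) := by
  have hlength : PolyTime fun a => ((l a).drop (n a)).length := by fun_prop
  refine ((hl.reverse.drop hlength).reverse).of_eq fun a => ?_
  rw [List.drop_reverse, List.reverse_reverse, List.length_drop]
  rcases le_total (n a) (l a).length with h | h
  · rw [Nat.sub_sub_self h]
  · rw [Nat.sub_eq_zero_of_le h, Nat.sub_zero, List.take_length, List.take_of_length_le h]

@[fun_prop]
theorem PolyTime.zip {l : α → List β} {l' : α → List γ} (hl : PolyTime l) (hl' : PolyTime l') :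
    PolyTime fun a => (l a).zip (l' a) := by
  let step (s : List γ × List (β × γ)) (b : β) : List γ × List (β × γ) :=
    (s.1.tail, (s.1.take 1).map (fun c => (b, c)) ++ s.2)
  have hstep : ∀ (l : List β) (l' : List γ) (acc : List (β × γ)),
      (l.foldl step (l', acc)).2 = (l.zip l').reverse ++ acc := by
    intro l
    induction l with
    | nil => simp
    | cons b l ih => rintro (_ | ⟨c, l'⟩) acc <;> exact (ih _ _).trans (by simp)
  refine ((hl.foldl_of_add_le (s := fun a => (l' a, [])) (f := fun _ => step) (by fun_prop)
    (by fun_prop) ⟨fun a => size (l a) + 1, by fun_prop, ?_⟩).snd.reverse).of_eq fun a => by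
      simp [hstep]
  rintro a ⟨_ | ⟨c, t⟩, acc⟩ b hb
  · simp [step]
  · have := size_le_of_mem hb
    simp only [step, List.tail_cons, List.take_succ_cons, List.take_zero, List.map_cons,
      List.map_nil, List.cons_append, List.nil_append, size_prod, size_cons]
    lia

@[fun_prop]
theorem PolyTime.sub {m n : α → ℕ} (hm : PolyTime m) (hn : PolyTime n) :
    PolyTime fun a => m a - n a :=
  (hm.replicate_unit.drop hn).length.of_eq fun a => by simp

@[fun_prop]
theorem PolyTime.le {m n : α → ℕ} (hm : PolyTime m) (hn : PolyTime n) :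
    PolyTime fun a => decide (m a ≤ n a) :=
  ((hm.sub hn).eq (polyTime_const 0)).of_eq fun a => by simp [Nat.sub_eq_zero_iff_le]

@[fun_prop]
theorem PolyTime.lt {m n : α → ℕ} (hm : PolyTime m) (hn : PolyTime n) :
    PolyTime fun a => decide (m a < n a) :=
  (hm.add (polyTime_const 1)).le hn

@[fun_prop]
theorem PolyTime.min {m n : α → ℕ} (hm : PolyTime m) (hn : PolyTime n) :
    PolyTime fun a => min (m a) (n a) :=
  (hm.sub (hm.sub hn)).of_eq fun a => by lia

@[fun_prop]
theorem PolyTime.range {n : α → ℕ} (hn : PolyTime n) : PolyTime fun a => List.range (n a) := by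
  have hiter : ∀ i, (fun l : List ℕ => l ++ [l.length])^[i] [] = List.range i := by
    intro i
    induction i with
    | zero => rfl
    | succ i ih => rw [Function.iterate_succ_apply', ih, List.range_succ, List.length_range]
  refine (hn.iterate (f := fun _ l => l ++ [l.length]) (polyTime_const []) (by fun_prop)
    ⟨fun a => size (n a) * (size (n a) + 1) + 1, by fun_prop, fun a i hi => ?_⟩).of_eq fun a =>
      hiter (n a)
  rw [hiter]
  refine (size_list_le (c := size (n a)) fun j hj => ?_).trans
    (Nat.add_le_add_right (Nat.mul_le_mul_right _ ?_) 1)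
  · rw [List.mem_range] at hj
    simp only [size_nat]
    lia
  · simp only [List.length_range, size_nat]
    lia

theorem expTime_two_pow : ExpTime fun x : List Unit => 2 ^ x.length := by
  have hfold : ∀ l : List Unit, l.foldl (fun n _ => n + n) 1 = 2 ^ l.length := fun l => by
    induction l using List.reverseRecOn with
    | nil => rfl
    | append_singleton l u ih => simp [ih, pow_succ, mul_two]
  simp only [← hfold]
  refine polyTime_id.foldl_exp (f := fun _ n _ => n + n) (polyTime_const 1) (by fun_prop)
    ⟨fun l => 2 * 2 ^ size l + 1, by fun_prop, fun l l' hl' => ?_⟩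
  rw [hfold, size_nat]
  have := Nat.pow_le_pow_right (n := 2) (by simp) (hl'.length_le.trans (length_le_size l))
  lia

end Unary

/-! ### Machines for polynomial time functions -/

section Machine

variable {Λ : Type} [Coded Λ]

open Classical in
/-- Push the code of the input symbol in the register, if it is one of the listed symbols. -/
noncomputable def pushCode : List Λ → Cmd Λ
  | [] => skip
  | x :: l => .ite (fun r => decide (r = some (.inl x))) (pushWord (code x).word) (pushCode l)

theorem runs_pushCode {x : Λ} {l : List Λ} (hx : x ∈ l) (i : List Λ) (v : List Bool) :
    Runs (pushCode l) ⟨some (.inl x), i, v, [], [], [], []⟩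
      ⟨some (.inl x), i, (code x).word ++ v, [], [], [], []⟩ (l.length + size x + 1) := by
  induction l with
  | nil => simp at hx
  | cons y l ih =>
    by_cases h : x = y
    · subst h
      exact ((runs_pushWord (code x).word _).iteTrue (by simp)).mono
        (by simp [size, Tree.length_word])
    · exact ((ih ((List.mem_cons.1 hx).resolve_left h)).iteFalse (by simp [h])).mono
        (by simp)

/-- Move the input to the value stack, as a list in reverse order. -/
noncomputable def readInput [Fintype Λ] : Cmd Λ :=
  push .val false ;; .instr .read ;;
    .loop Option.isSome (pushCode Finset.univ.toList ;; push .val true ;; .instr .read)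

theorem runs_readInput_loop [Fintype Λ] {K : ℕ} (hK : ∀ x : Λ, size x ≤ K) (w u : List Λ) :
    Runs (.loop Option.isSome (pushCode Finset.univ.toList ;; push .val true ;; .instr .read))
      ⟨w.head?.map .inl, w.tail, (code u).word, [], [], [], []⟩
      (base (code (w.reverse ++ u)).word [] [] [])
      ((Fintype.card Λ + K + 4) * w.length + 1) := by
  induction w generalizing u with
  | nil => exact Runs.loopDone rfl
  | cons x w ih =>
    have hpush := runs_pushCode (Finset.mem_toList.2 (Finset.mem_univ x)) w (code u).word
    have hword : true :: ((code x).word ++ (code u).word) = (code (x :: u)).word := by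
      simp [code, Tree.ofList, Tree.word]
    have hread : Runs (.instr .read) ⟨some (.inl x), w, (code (x :: u)).word, [], [], [], []⟩
      ⟨w.head?.map .inl, w.tail, (code (x :: u)).word, [], [], [], []⟩ 1 := .instr rfl
    refine (Runs.loopStep rfl (hpush.seq (.seq (.instr rfl) (hword ▸ hread)))
      (ih (x :: u))).of_eq rfl (by simp) ?_
    · have := hK x
      simp only [Finset.length_toList, Finset.card_univ, List.length_cons, mul_add, mul_one]
      lia

theorem runs_readInput [Fintype Λ] {K : ℕ} (hK : ∀ x : Λ, size x ≤ K) (w : List Λ) :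
    Runs readInput (.input w) (base (code w.reverse).word [] [] [])
      ((Fintype.card Λ + K + 4) * w.length + 3) := by
  have hloop := runs_readInput_loop hK w []
  rw [List.append_nil] at hloop
  exact ((Runs.instr rfl).seq ((Runs.instr rfl).seq hloop)).mono (by lia)

/-- Replace the code of a truth value by the corresponding bit. -/
def writeOutput : Cmd Λ :=
  pop .val ;; .ite (regIs true) (popVal ;; popVal ;; push .val true) (clear ;; push .val false)

omit [Coded Λ] in
theorem runs_writeOutput (b : Bool) :
    Runs (α := Λ) writeOutput (base (code b).word [] [] []) (.output [b]) 10 := by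
  cases b
  · exact ((Runs.instr rfl).seq (.iteFalse rfl ((Runs.instr rfl).seq (.instr rfl)))).mono
      (by simp)
  · exact ((Runs.instr rfl).seq (.iteTrue rfl (((Runs.instr rfl).seq (.instr rfl)).seq
      (((Runs.instr rfl).seq (.instr rfl)).seq (.instr rfl))))).mono (by simp)

theorem runs_of_computes [Fintype Λ] {K : ℕ} (hK : ∀ x : Λ, size x ≤ K) {c : Cmd Λ}
    {w : List Λ} {b : Bool} {n : ℕ} (hc : Computes c (code w.reverse) (code b) n) :
    Runs (readInput ;; c ;; writeOutput) (.input w) (.output [b])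
      ((Fintype.card Λ + K + 4) * w.length + n + 13) := by
  have h := hc []
  simp only [List.append_nil] at h
  exact ((runs_readInput hK w).seq (h.seq (runs_writeOutput _))).mono (by lia)

theorem two_pow_add_le (a b : ℕ) : 2 ^ a + b ≤ 2 ^ (a + b) := by
  have ha : 1 ≤ 2 ^ a := Nat.one_le_two_pow
  have hb : b < 2 ^ b := Nat.lt_two_pow_self
  rw [pow_add]
  calc 2 ^ a + b ≤ 2 ^ a + 2 ^ a * b := by gcongr; exact Nat.le_mul_of_pos_left b ha
    _ = 2 ^ a * (b + 1) := by ring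
    _ ≤ 2 ^ a * 2 ^ b := Nat.mul_le_mul_left _ hb

open Classical in
/-- The function `f` has access to an exponentially large number in unary. -/
theorem inEXPTIME_of_polyTime [Fintype Λ] (L : Language Λ) {q : List Λ → ℕ} (hq : PolyTime q)
    {f : List Λ × ℕ → Bool} (hf : PolyTime f) (h : ∀ w, w ∈ L ↔ f (w, 2 ^ q w) = true) :
    PVPDA.InEXPTIME L := by
  have hexp : ExpTime fun w : List Λ => f (w.reverse, 2 ^ q w.reverse) :=
    hf.comp_exp (polyTime_id.reverse.expTime.prodMk
      ((expTime_two_pow.comp_poly (hq.comp polyTime_id.reverse).replicate_unit).of_eq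
        fun w => by simp))
  obtain ⟨t, ⟨k, hk⟩, ht⟩ := hexp
  obtain ⟨c, hc⟩ := ht Λ
  obtain ⟨K, hK⟩ := Finite.exists_le (size : Λ → ℕ)
  have hsize : ∀ w : List Λ, size w.reverse + 2 ≤ (K + 1) * w.length + 3 := fun w => by
    have := size_list_le (l := w.reverse) fun x _ => hK x
    rw [List.length_reverse] at this
    lia
  set m := Fintype.card Λ + K + 4
  set time : ℕ → ℕ := fun n => m * n + 2 ^ ((K + 1) * n + 3) ^ k + 13
  have hrun : ∀ w, Runs (readInput ;; c ;; writeOutput) (.input w) (.output [decide (w ∈ L)])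
      (time w.length) := fun w => by
    have hw : f (w.reverse.reverse, 2 ^ q w.reverse.reverse) = decide (w ∈ L) := by
      rw [Bool.eq_iff_iff, List.reverse_reverse, ← h w, decide_eq_true_iff]
    have htime : t w.reverse ≤ 2 ^ ((K + 1) * w.length + 3) ^ k := (hk _).trans
      (Nat.pow_le_pow_right (by simp) (Nat.pow_le_pow_left (hsize w) k))
    have hcw := runs_of_computes hK (hc w.reverse)
    simp only [hw] at hcw
    exact hcw.mono (by simp only [time, m]; lia)
  refine ⟨(.C (K + 1) * .X + 3) ^ k + (.C m * .X + 14),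
    (readInput ;; c ;; writeOutput).computableInTime _ time hrun, ?_, fun n => ?_⟩
  · rintro (_ | _)
    · exact inferInstanceAs (Finite Λ)
    · exact inferInstanceAs (Finite Bool)
  · change m * n + 2 ^ ((K + 1) * n + 3) ^ k + 13 + 1 ≤ _
    simp only [Polynomial.eval_add, Polynomial.eval_pow, Polynomial.eval_mul, Polynomial.eval_X,
      Polynomial.eval_ofNat, Polynomial.eval_C]
    exact le_of_eq_of_le (by lia) (two_pow_add_le _ _)

end Machine

end StackProgram

namespace PVPDA

/-! ### Bisimilarity by liftings of arbitrary relations -/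

/-- The lifting of a relation to distributions: each set has at most the probability of its image.
Unlike the equality of the probabilities of classes, this makes sense for every relation, and by
Strassen's theorem it is the existence of a coupling. -/
def Lift {S T : Type} (R : S → T → Prop) (d : PMF S) (d' : PMF T) : Prop :=
  ∀ U : Set S, d.toOuterMeasure U ≤ d'.toOuterMeasure {t | ∃ s ∈ U, R s t}

namespace Lift

variable {S T V : Type}

theorem mono {R R' : S → T → Prop} {d : PMF S} {d' : PMF T} (h : Lift R d d')
    (hR : ∀ s t, R s t → R' s t) : Lift R' d d' := fun U =>
  (h U).trans (d'.toOuterMeasure.mono fun _ ⟨s, hs, hst⟩ => ⟨s, hs, hR _ _ hst⟩)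

theorem refl {R : S → S → Prop} (hR : ∀ s, R s s) (d : PMF S) : Lift R d d := fun _ =>
  d.toOuterMeasure.mono fun s hs => ⟨s, hs, hR s⟩

theorem trans {R : S → T → Prop} {R' : T → V → Prop} {d : PMF S} {d' : PMF T} {d'' : PMF V}
    (h : Lift R d d') (h' : Lift R' d' d'') : Lift (fun s v => ∃ t, R s t ∧ R' t v) d d'' := by
  intro U
  refine (h U).trans ((h' _).trans (d''.toOuterMeasure.mono ?_))
  rintro v ⟨t, ⟨s, hs, hst⟩, htv⟩
  exact ⟨s, hs, t, hst, htv⟩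

theorem toOuterMeasure_add_compl (d : PMF S) (U : Set S) :
    d.toOuterMeasure U + d.toOuterMeasure Uᶜ = 1 := by
  classical
  rw [PMF.toOuterMeasure_apply, PMF.toOuterMeasure_apply, ← ENNReal.tsum_add, ← d.tsum_coe]
  congr 1
  funext s
  by_cases hs : s ∈ U <;> simp [hs]

theorem symm {R : S → T → Prop} {d : PMF S} {d' : PMF T} (h : Lift R d d') :
    Lift (fun t s => R s t) d' d := by
  intro V
  set W : Set S := {s | ∃ t ∈ V, R s t}
  have h₁ := h Wᶜ
  have h₂ : d'.toOuterMeasure {t | ∃ s ∈ Wᶜ, R s t} ≤ d'.toOuterMeasure Vᶜ := by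
    refine d'.toOuterMeasure.mono ?_
    rintro t ⟨s, hs, hst⟩ ht
    exact hs ⟨t, ht, hst⟩
  have h₃ := toOuterMeasure_add_compl d W
  have h₄ := toOuterMeasure_add_compl d' V
  have h₅ : d.toOuterMeasure Wᶜ ≠ ⊤ := by
    intro h
    rw [h] at h₃
    simp at h₃
  refine (ENNReal.add_le_add_iff_right h₅).1 ?_
  rw [h₃, ← h₄]
  gcongr
  exact h₁.trans h₂

theorem map_iff {S' T' : Type} {R : S' → T' → Prop} {f : S → S'} {g : T → T'} {d : PMF S}
    {d' : PMF T} : Lift R (d.map f) (d'.map g) ↔ Lift (fun s t => R (f s) (g t)) d d' := by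
  constructor
  · intro h U
    have := h (f '' U)
    rw [PMF.toOuterMeasure_map_apply, PMF.toOuterMeasure_map_apply] at this
    refine (d.toOuterMeasure.mono (Set.subset_preimage_image f U)).trans
      (this.trans (d'.toOuterMeasure.mono ?_))
    rintro t ⟨_, ⟨s, hs, rfl⟩, hst⟩
    exact ⟨s, hs, hst⟩
  · intro h U
    rw [PMF.toOuterMeasure_map_apply, PMF.toOuterMeasure_map_apply]
    refine (h _).trans (d'.toOuterMeasure.mono ?_)
    rintro t ⟨s, hs, hst⟩
    exact ⟨f s, hs, hst⟩

theorem inter_support {R : S → T → Prop} {d : PMF S} {d' : PMF T} (h : Lift R d d') :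
    Lift (fun s t => s ∈ d.support ∧ t ∈ d'.support ∧ R s t) d d' := by
  intro U
  rw [← PMF.toOuterMeasure_apply_inter_support]
  refine (h _).trans ?_
  rw [← PMF.toOuterMeasure_apply_inter_support]
  refine d'.toOuterMeasure.mono ?_
  rintro t ⟨⟨s, ⟨hs, hs'⟩, hst⟩, ht⟩
  exact ⟨s, hs, hs', ht, hst⟩

theorem of_distEquiv {R : Setoid S} {d d' : PMF S} (h : DistEquiv R d d') :
    Lift (fun s t => R s t) d d' := by
  have hq : d.map (Quotient.mk R) = d'.map (Quotient.mk R) := by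
    refine PMF.ext fun x => ?_
    induction x using Quotient.inductionOn with
    | h s =>
      have := h {t | R t s} (Setoid.mem_classes R s)
      have e : Quotient.mk R ⁻¹' {Quotient.mk R s} = {t | R t s} := by
        ext t
        simp only [Set.mem_preimage, Set.mem_singleton_iff, Set.mem_ofPred_eq]
        exact Quotient.eq
      rw [← PMF.toOuterMeasure_apply_singleton, ← PMF.toOuterMeasure_apply_singleton,
        PMF.toOuterMeasure_map_apply, PMF.toOuterMeasure_map_apply, e, this]
  have h₁ : Lift Eq (d.map (Quotient.mk R)) (d'.map (Quotient.mk R)) := by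
    rw [hq]
    exact Lift.refl (fun _ => rfl) _
  exact (map_iff.1 h₁).mono fun s t e => Quotient.exact e

theorem distEquiv {R : Setoid S} {d d' : PMF S} (h : Lift (fun s t => R s t) d d') :
    DistEquiv R d d' := by
  have key : ∀ {d d' : PMF S}, Lift (fun s t => R s t) d d' → ∀ E ∈ R.classes,
      d.toOuterMeasure E ≤ d'.toOuterMeasure E := by
    rintro d d' h E ⟨x, rfl⟩
    refine (h _).trans (d'.toOuterMeasure.mono ?_)
    rintro t ⟨s, hs, hst⟩
    exact R.trans (R.symm hst) hs
  intro E hE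
  exact le_antisymm (key h E hE) (key (h.symm.mono fun s t hst => R.symm hst) E hE)

end Lift

/-- The back-and-forth condition of bisimulations, for the steps `M` and `N` of two states: each
step of one side is answered by a step of the other side with the same label and an `R`-related
distribution. -/
def BackAndForth {S T A : Type} (R : S → T → Prop) (M : A → PMF S → Prop) (N : A → PMF T → Prop) :
    Prop :=
  (∀ a d, M a d → ∃ d', N a d' ∧ Lift R d d') ∧ ∀ a d', N a d' → ∃ d, M a d ∧ Lift R d d'

namespace BackAndForth

variable {S T V A : Type} {R : S → T → Prop} {M : A → PMF S → Prop} {N : A → PMF T → Prop}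

theorem imp {R' : S → T → Prop} (h : BackAndForth R M N)
    (hR : ∀ a d d', M a d → N a d' → Lift R d d' → Lift R' d d') : BackAndForth R' M N :=
  ⟨fun a d hd => (h.1 a d hd).imp fun d' hd' => ⟨hd'.1, hR a d d' hd hd'.1 hd'.2⟩,
    fun a d' hd' => (h.2 a d' hd').imp fun d hd => ⟨hd.1, hR a d d' hd.1 hd' hd.2⟩⟩

theorem mono {R' : S → T → Prop} (h : BackAndForth R M N) (hR : ∀ s t, R s t → R' s t) :
    BackAndForth R' M N :=
  h.imp fun _ _ _ _ _ hd => hd.mono hR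

theorem refl {R : S → S → Prop} (hR : ∀ s, R s s) (M : A → PMF S → Prop) : BackAndForth R M M :=
  ⟨fun _ d hd => ⟨d, hd, Lift.refl hR d⟩, fun _ d hd => ⟨d, hd, Lift.refl hR d⟩⟩

theorem symm (h : BackAndForth R M N) : BackAndForth (fun t s => R s t) N M :=
  ⟨fun a d hd => (h.2 a d hd).imp fun _ hd' => ⟨hd'.1, hd'.2.symm⟩,
    fun a d hd => (h.1 a d hd).imp fun _ hd' => ⟨hd'.1, hd'.2.symm⟩⟩

theorem trans {R' : T → V → Prop} {P : A → PMF V → Prop} (h : BackAndForth R M N)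
    (h' : BackAndForth R' N P) : BackAndForth (fun s v => ∃ t, R s t ∧ R' t v) M P := by
  constructor
  · intro a d hd
    obtain ⟨d', hd', hl⟩ := h.1 a d hd
    obtain ⟨d'', hd'', hl'⟩ := h'.1 a d' hd'
    exact ⟨d'', hd'', hl.trans hl'⟩
  · intro a d'' hd''
    obtain ⟨d', hd', hl'⟩ := h'.2 a d'' hd''
    obtain ⟨d, hd, hl⟩ := h.2 a d' hd'
    exact ⟨d, hd, hl.trans hl'⟩

theorem map_iff {S' T' : Type} {R : S' → T' → Prop} {f : S → S'} {g : T → T'} :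
    BackAndForth R (fun a e => ∃ d, M a d ∧ e = d.map f) (fun a e => ∃ d, N a d ∧ e = d.map g) ↔
      BackAndForth (fun s t => R (f s) (g t)) M N := by
  simp only [BackAndForth, ← Lift.map_iff]
  constructor
  · rintro ⟨forth, back⟩
    refine ⟨fun a d hd => ?_, fun a d' hd' => ?_⟩
    · obtain ⟨_, ⟨d', hd', rfl⟩, hl⟩ := forth a _ ⟨d, hd, rfl⟩
      exact ⟨d', hd', hl⟩
    · obtain ⟨_, ⟨d, hd, rfl⟩, hl⟩ := back a _ ⟨d', hd', rfl⟩
      exact ⟨d, hd, hl⟩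
  · rintro ⟨forth, back⟩
    refine ⟨?_, ?_⟩
    · rintro a _ ⟨d, hd, rfl⟩
      obtain ⟨d', hd', hl⟩ := forth a d hd
      exact ⟨_, ⟨d', hd', rfl⟩, hl⟩
    · rintro a _ ⟨d', hd', rfl⟩
      obtain ⟨d, hd, hl⟩ := back a d' hd'
      exact ⟨_, ⟨d, hd, rfl⟩, hl⟩

theorem false_left_iff : BackAndForth R (fun _ _ => False) N ↔ ∀ a d, ¬N a d := by
  simp [BackAndForth]

theorem false_right_iff : BackAndForth R M (fun _ _ => False) ↔ ∀ a d, ¬M a d := by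
  simp [BackAndForth]

end BackAndForth

namespace PLTS

variable {S A : Type} {L : PLTS S A}

/-- The labelled steps of a state. -/
def steps (L : PLTS S A) (s : S) (a : A) (d : PMF S) : Prop := (s, a, d) ∈ L.tran

/-- A bisimulation that need not be an equivalence relation, with `Lift` in place of the equality
of the probabilities of classes. -/
def IsTransfer (L : PLTS S A) (R : S → S → Prop) : Prop :=
  ∀ s t, R s t → BackAndForth R (L.steps s) (L.steps t)

/-- The union of all the relations that satisfy `PLTS.IsTransfer`. -/
def transferRel (L : PLTS S A) (s t : S) : Prop := ∃ R, L.IsTransfer R ∧ R s t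

theorem isTransfer_transferRel : L.IsTransfer L.transferRel := fun s t ⟨R, hR, hst⟩ =>
  (hR s t hst).mono fun _ _ h => ⟨R, hR, h⟩

theorem equivalence_transferRel : Equivalence L.transferRel where
  refl _ := ⟨Eq, fun s _ h => h ▸ BackAndForth.refl (fun _ => rfl) (L.steps s), rfl⟩
  symm {_ _} h :=
    ⟨fun s t => L.transferRel t s, fun s t hst => (isTransfer_transferRel t s hst).symm, h⟩
  trans {_ t _} h h' :=
    ⟨fun s u => ∃ t, L.transferRel s t ∧ L.transferRel t u, fun s u ⟨t, hst, htu⟩ =>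
      (isTransfer_transferRel s t hst).trans (isTransfer_transferRel t u htu), t, h, h'⟩

theorem IsTransfer.bisimilar {R : S → S → Prop} (hR : L.IsTransfer R) {s t : S} (h : R s t) :
    L.Bisimilar s t := by
  refine ⟨⟨L.transferRel, equivalence_transferRel⟩, fun s t hst a d hd => ?_, R, hR, h⟩
  obtain ⟨d', hd', hl⟩ := (isTransfer_transferRel s t hst).1 a d hd
  exact ⟨d', hd', Lift.distEquiv hl⟩

theorem isTransfer_bisimilar : L.IsTransfer L.Bisimilar := by
  rintro s t ⟨R, hR, hst⟩
  suffices h : BackAndForth (fun s t => R s t) (L.steps s) (L.steps t) from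
    h.mono fun _ _ hst => ⟨R, hR, hst⟩
  constructor
  · intro a d hd
    obtain ⟨d', hd', h⟩ := hR s t hst a d hd
    exact ⟨d', hd', Lift.of_distEquiv h⟩
  · intro a d' hd'
    obtain ⟨d, hd, h⟩ := hR t s (R.symm hst) a d' hd'
    exact ⟨d, hd, (Lift.of_distEquiv h).symm.mono fun s t h => R.symm h⟩

end PLTS

/-! ### The finite table that determines bisimilarity -/

section Table

variable {Q Γ A : Type}

/-- A table: `T X Y B p q` is meant to say that `pXβ` and `qYβ'` are bisimilar if `B` is the
relation between the control states that are bisimilar on `β` and `β'`. -/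
abbrev Table (Q Γ : Type) : Type := Γ → Γ → (Q → Q → Prop) → Q → Q → Prop

/-- The relation between targets of rules that is prescribed by a table `T` if the control states
on the remaining stacks are related by `B`. -/
def Table.targetRel (T : Table Q Γ) (B : Q → Q → Prop) (x y : Q × List Γ) : Prop :=
  match x.2, y.2 with
  | [], [] => B x.1 y.1
  | [X], [Y] => T X Y B x.1 y.1
  | [X, X'], [Y, Y'] => T X Y (T X' Y' B) x.1 y.1
  | _, _ => False

/-- A table that is monotone in the relation. -/
def Table.Mono (T : Table Q Γ) : Prop := ∀ X Y, Monotone (T X Y)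

theorem Table.targetRel_mono {T T' : Table Q Γ} {B B' : Q → Q → Prop} (hT : T.Mono)
    (hTT' : T ≤ T') (hB : B ≤ B') {x y : Q × List Γ} (h : T.targetRel B x y) :
    T'.targetRel B' x y := by
  rcases x with ⟨p, _ | ⟨X, _ | ⟨X', _ | _⟩⟩⟩ <;> rcases y with ⟨q, _ | ⟨Y, _ | ⟨Y', _ | _⟩⟩⟩ <;>
    simp only [Table.targetRel] at h ⊢
  · exact hB _ _ h
  · exact hTT' _ _ _ _ _ (hT _ _ hB _ _ h)
  · exact hTT' _ _ _ _ _ (hT _ _ ((hT _ _ hB).trans (hTT' _ _ _)) _ _ h)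

variable [Finite Q] [Finite Γ] [Finite A]

namespace PPDA

/-- The rules for a control state and a topmost symbol. -/
def heads (D : PPDA Q Γ A) (p : Q) (X : Γ) (a : A) (d : PMF (Q × ShortWord Γ)) : Prop :=
  (p, X, a, d) ∈ D.rules

/-- One step of the refinement of a table: the back-and-forth condition for the rules. -/
def refine (D : PPDA Q Γ A) (T : Table Q Γ) : Table Q Γ := fun X Y B p q =>
  BackAndForth (fun x y => T.targetRel B (x.1, x.2.1) (y.1, y.2.1)) (D.heads p X) (D.heads q Y)

theorem refine_mono (D : PPDA Q Γ A) {T T' : Table Q Γ} (hT : T.Mono) (hTT' : T ≤ T') {X Y : Γ}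
    {B B' : Q → Q → Prop} (hB : B ≤ B') : D.refine T X Y B ≤ D.refine T' X Y B' := fun _ _ h =>
  h.mono fun _ _ => Table.targetRel_mono hT hTT' hB

/-- The approximations from above of the greatest table that is stable under the refinement. -/
def approx (D : PPDA Q Γ A) (k : ℕ) : Table Q Γ := D.refine^[k] ⊤

theorem approx_succ (D : PPDA Q Γ A) (k : ℕ) : D.approx (k + 1) = D.refine (D.approx k) :=
  Function.iterate_succ_apply' _ _ _

theorem approx_mono (D : PPDA Q Γ A) (k : ℕ) : (D.approx k).Mono := by
  induction k with
  | zero => exact fun _ _ _ _ _ => le_rfl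
  | succ k ih =>
    rw [approx_succ]
    exact fun X Y B B' hB => D.refine_mono ih le_rfl hB

theorem approx_antitone (D : PPDA Q Γ A) (k : ℕ) : D.approx (k + 1) ≤ D.approx k := by
  induction k with
  | zero => exact le_top
  | succ k ih =>
    rw [approx_succ D k, approx_succ]
    exact fun X Y B => D.refine_mono (D.approx_mono _) ih le_rfl

theorem approx_stable (D : PPDA Q Γ A) {k : ℕ}
    (hk : Nat.card (Γ × Γ × (Q → Q → Prop) × Q × Q) ≤ k) : D.approx (k + 1) = D.approx k := by
  set F : ℕ → Set (Γ × Γ × (Q → Q → Prop) × Q × Q) := fun j =>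
    {v | D.approx j v.1 v.2.1 v.2.2.1 v.2.2.2.1 v.2.2.2.2}
  have hF : Antitone F := antitone_nat_of_succ_le fun j _ hv => D.approx_antitone j _ _ _ _ _ hv
  have heq : ∀ j, (F j)ᶜ.ncard = (F (j + 1))ᶜ.ncard → D.approx (j + 1) = D.approx j := by
    intro j hj
    have hcompl : (F j)ᶜ = (F (j + 1))ᶜ :=
      Set.eq_of_subset_of_ncard_le (Set.compl_subset_compl.2 (hF j.le_succ)) hj.ge
    funext X Y B p q
    exact propext (Set.ext_iff.1 (compl_injective hcompl) (X, Y, B, p, q)).symm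
  have hstable : ∀ l ≥ Nat.card (Γ × Γ × (Q → Q → Prop) × Q × Q),
      (F l)ᶜ.ncard = (F (Nat.card (Γ × Γ × (Q → Q → Prop) × Q × Q)))ᶜ.ncard := fun l hl =>
    Nat.stabilises_of_monotone (f := fun j => (F j)ᶜ.ncard)
      (fun i j hij => Set.ncard_le_ncard (Set.compl_subset_compl.2 (hF hij)))
      (fun j => Set.ncard_le_card _)
      (fun j hj => by
        have happrox : D.approx (j + 2) = D.approx (j + 1) := by
          rw [D.approx_succ (j + 1), heq j hj, ← D.approx_succ, heq j hj]
        simp only [F, happrox]) hl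
  exact heq k ((hstable k hk).trans (hstable (k + 1) (hk.trans k.le_succ)).symm)

theorem steps_nil (D : PPDA Q Γ A) (p : Q) : D.toPLTS.steps (p, []) = fun _ _ => False := by
  funext a e
  refine eq_false ?_
  rintro ⟨q, Y, b, d, _, γ, h⟩
  simp at h

theorem steps_cons (D : PPDA Q Γ A) (p : Q) (X : Γ) (β : List Γ) : D.toPLTS.steps (p, X :: β) =
    fun a e => ∃ d, D.heads p X a d ∧ e = d.map fun x => (x.1, x.2.1 ++ β) := by
  funext a e
  refine propext ⟨?_, ?_⟩
  · rintro ⟨q, Y, b, d, hd, γ, h⟩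
    simp only [Prod.mk.injEq, List.cons.injEq] at h
    obtain ⟨⟨rfl, rfl, rfl⟩, rfl, rfl⟩ := h
    exact ⟨d, hd, rfl⟩
  · rintro ⟨d, hd, rfl⟩
    exact ⟨p, X, a, d, hd, β, rfl⟩

/-- A control state without a rule for the topmost symbol. -/
def Stuck (D : PPDA Q Γ A) (p : Q) (X : Γ) : Prop := ∀ a d, ¬D.heads p X a d

theorem forall_not_steps_cons_iff (D : PPDA Q Γ A) (p : Q) (X : Γ) (β : List Γ) :
    (∀ a e, ¬D.toPLTS.steps (p, X :: β) a e) ↔ D.Stuck p X := by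
  simp only [steps_cons, Stuck, not_exists, not_and]
  exact ⟨fun h a d hd => h a _ d hd rfl, fun h a _ d hd _ => h a d hd⟩

theorem backAndForth_nil_cons_iff (D : PPDA Q Γ A) {R : Config Q Γ → Config Q Γ → Prop}
    {p q : Q} {Y : Γ} {β' : List Γ} :
    BackAndForth R (D.toPLTS.steps (p, [])) (D.toPLTS.steps (q, Y :: β')) ↔ D.Stuck q Y := by
  rw [steps_nil, BackAndForth.false_left_iff, forall_not_steps_cons_iff]

theorem backAndForth_cons_nil_iff (D : PPDA Q Γ A) {R : Config Q Γ → Config Q Γ → Prop}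
    {p q : Q} {X : Γ} {β : List Γ} :
    BackAndForth R (D.toPLTS.steps (p, X :: β)) (D.toPLTS.steps (q, [])) ↔ D.Stuck p X := by
  rw [steps_nil, BackAndForth.false_right_iff, forall_not_steps_cons_iff]

theorem backAndForth_cons_cons_iff (D : PPDA Q Γ A) {R : Config Q Γ → Config Q Γ → Prop}
    {p q : Q} {X Y : Γ} {β β' : List Γ} :
    BackAndForth R (D.toPLTS.steps (p, X :: β)) (D.toPLTS.steps (q, Y :: β')) ↔
      BackAndForth (fun x y => R (x.1, x.2.1 ++ β) (y.1, y.2.1 ++ β')) (D.heads p X)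
        (D.heads q Y) := by
  rw [steps_cons, steps_cons, BackAndForth.map_iff]

/-- The relation between control states on two stack contents that is prescribed by a table. -/
def stackRel (D : PPDA Q Γ A) (T : Table Q Γ) : List Γ → List Γ → Q → Q → Prop
  | [], [] => fun _ _ => True
  | [], Y :: _ => fun _ q => D.Stuck q Y
  | X :: _, [] => fun p _ => D.Stuck p X
  | X :: β, Y :: β' => T X Y (D.stackRel T β β')

theorem stackRel_append_of_targetRel (D : PPDA Q Γ A) (T : Table Q Γ) {β β' : List Γ}
    {x y : Q × List Γ} (h : T.targetRel (D.stackRel T β β') x y) :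
    D.stackRel T (x.2 ++ β) (y.2 ++ β') x.1 y.1 := by
  rcases x with ⟨p, _ | ⟨X, _ | ⟨X', _ | _⟩⟩⟩ <;> rcases y with ⟨q, _ | ⟨Y, _ | ⟨Y', _ | _⟩⟩⟩ <;>
    simp only [Table.targetRel] at h <;> exact h

theorem isTransfer_stackRel (D : PPDA Q Γ A) {T : Table Q Γ} (hT : T ≤ D.refine T) :
    D.toPLTS.IsTransfer fun s t => D.stackRel T s.2 t.2 s.1 t.1 := by
  rintro ⟨p, _ | ⟨X, β⟩⟩ ⟨q, _ | ⟨Y, β'⟩⟩ h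
  · rw [steps_nil, steps_nil, BackAndForth.false_left_iff]
    exact fun _ _ => id
  · exact D.backAndForth_nil_cons_iff.2 h
  · exact D.backAndForth_cons_nil_iff.2 h
  · exact D.backAndForth_cons_cons_iff.2
      ((hT _ _ _ _ _ h).mono fun x y => D.stackRel_append_of_targetRel T)

end PPDA

namespace PvPDA

theorem length_eq_of_mem_support (D : PvPDA Q Γ A) {p q : Q} {X Y : Γ} {a : A}
    {d d' : PMF (Q × ShortWord Γ)} (hd : D.heads p X a d) (hd' : D.heads q Y a d')
    {x y : Q × ShortWord Γ} (hx : x ∈ d.support) (hy : y ∈ d'.support) :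
    x.2.1.length = y.2.1.length :=
  (D.visibly _ _ _ _ hd _ hx).trans (D.visibly _ _ _ _ hd' _ hy).symm

theorem approx_of_bisimilar (D : PvPDA Q Γ A) (k : ℕ) {X Y : Γ} {β β' : List Γ} {p q : Q}
    (h : D.toPLTS.Bisimilar (p, X :: β) (q, Y :: β')) :
    D.approx k X Y (fun p q => D.toPLTS.Bisimilar (p, β) (q, β')) p q := by
  induction k generalizing X Y β β' p q with
  | zero => trivial
  | succ k ih =>
    have hrules := D.backAndForth_cons_cons_iff.1 (PLTS.isTransfer_bisimilar _ _ h)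
    rw [PPDA.approx_succ]
    refine hrules.imp fun a d d' hd hd' hl => hl.inter_support.mono ?_
    rintro ⟨p', u, hu⟩ ⟨q', v, hv⟩ ⟨hx, hy, hxy⟩
    have hlen : u.length = v.length := D.length_eq_of_mem_support hd hd' hx hy
    rcases u with _ | ⟨X₁, _ | ⟨X₂, _ | _⟩⟩ <;> rcases v with _ | ⟨Y₁, _ | ⟨Y₂, _ | _⟩⟩ <;>
      simp at hlen hu hv
    · exact hxy
    · exact ih hxy
    · exact D.approx_mono k _ _ (fun p q h => ih h) _ _ (ih hxy)

theorem stackRel_of_bisimilar (D : PvPDA Q Γ A) (k : ℕ) {α α' : List Γ} {p q : Q}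
    (h : D.toPLTS.Bisimilar (p, α) (q, α')) : D.stackRel (D.approx k) α α' p q :=
  match α, α', PLTS.isTransfer_bisimilar _ _ h with
  | [], [], _ => trivial
  | [], _ :: _, hsteps => D.backAndForth_nil_cons_iff.1 hsteps
  | _ :: _, [], hsteps => D.backAndForth_cons_nil_iff.1 hsteps
  | _ :: _, _ :: _, _ => D.approx_mono k _ _ (fun _ _ h' => D.stackRel_of_bisimilar k h') _ _
      (D.approx_of_bisimilar k h)

theorem bisimilar_iff (D : PvPDA Q Γ A) {k : ℕ} (hk : D.approx (k + 1) = D.approx k)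
    (s t : Config Q Γ) : D.toPLTS.Bisimilar s t ↔ D.stackRel (D.approx k) s.2 t.2 s.1 t.1 := by
  refine ⟨D.stackRel_of_bisimilar k, (D.isTransfer_stackRel ?_).bisimilar⟩
  rw [← PPDA.approx_succ, hk]

end PvPDA

end Table

open StackProgram

/-! ### Numbers in binary -/

/-- The successor of a number in binary. -/
def incr : List Bool → List Bool
  | [] => [true]
  | false :: l => true :: l
  | true :: l => false :: incr l

theorem bits_succ (n : ℕ) : (n + 1).bits = incr n.bits := by
  induction n using Nat.binaryRec' with
  | zero => simp [incr]
  | bit b n hb ih =>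
    rw [Nat.bits_append_bit n b hb]
    cases b
    · have e : Nat.bit false n + 1 = Nat.bit true n := rfl
      rw [e, Nat.bits_append_bit _ _ (by simp), incr]
    · have e : Nat.bit true n + 1 = Nat.bit false (n + 1) := by
        simp only [Nat.bit_val, Bool.toNat_true, Bool.toNat_false]
        ring
      rw [e, Nat.bits_append_bit _ _ (by simp), ih, incr]

theorem iterate_incr (n : ℕ) : incr^[n] [] = n.bits := by
  induction n with
  | zero => simp
  | succ n ih => rw [Function.iterate_succ_apply', ih, bits_succ]

/-- Adds a carry to a bit: the state consists of the carry and of the reversed list of the bits that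
have already been dealt with. -/
def addCarry (s : Bool × List Bool) (b : Bool) : Bool × List Bool :=
  (b && s.1, cond s.1 (!b) b :: s.2)

/-- The result of `addCarry`: the last carry becomes the most significant bit. -/
def finishCarry (s : Bool × List Bool) : List Bool := (cond s.1 (true :: s.2) s.2).reverse

theorem finishCarry_foldl_addCarry (l : List Bool) (c : Bool) (acc : List Bool) :
    finishCarry (l.foldl addCarry (c, acc)) = acc.reverse ++ cond c (incr l) l := by
  induction l generalizing c acc with
  | nil => cases c <;> simp [incr, finishCarry]
  | cons b l ih =>
    rw [List.foldl_cons, addCarry, ih]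
    cases b <;> cases c <;> simp [incr]

theorem polyTime_incr : PolyTime incr := by
  have hf : PolyTime finishCarry := by unfold finishCarry; fun_prop
  refine PolyTime.of_eq (hf.comp (PolyTime.foldl_of_add_le (l := fun l : List Bool => l)
    (s := fun _ => (true, [])) (f := fun _ => addCarry) (by fun_prop) (by fun_prop)
    (by unfold addCarry; fun_prop) ⟨_, polyBdd_const 8, ?_⟩)) fun l => ?_
  · intro l s b _
    have hcarry := size_bool_le (b && s.1)
    have hbit := size_bool_le (cond s.1 (!b) b)
    have hs := size_prod s
    simp only [addCarry, size_prod, size_cons] at hs ⊢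
    lia
  · simp [finishCarry_foldl_addCarry]

@[fun_prop]
theorem polyTime_bits {α : Type} [Coded α] {n : α → ℕ} (hn : PolyTime n) :
    PolyTime fun a => (n a).bits := by
  suffices h : PolyTime fun n : ℕ => incr^[n] [] by
    simp only [iterate_incr] at h
    exact h.comp hn
  refine PolyTime.iterate (f := fun _ l => incr l) (by fun_prop) (by fun_prop)
    (polyTime_incr.comp (by fun_prop)) ⟨fun n => size n * 4 + 1, by fun_prop, fun n i hi => ?_⟩
  rw [iterate_incr]
  have hlength : i.bits.length ≤ i := by
    rw [Nat.size_eq_bits_len, Nat.size_le]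
    exact Nat.lt_two_pow_self
  refine (size_list_le fun b _ => size_bool_le b).trans ?_
  simp only [size_nat]
  lia

/-- The value of a number in binary, truncated at `N` as numbers are coded in unary. -/
def bitsValue (N : ℕ) (l : List Bool) : ℕ := l.foldr (fun b n => min N (n + n + cond b 1 0)) 0

theorem bitsValue_bits (N n : ℕ) : bitsValue N n.bits = min N n := by
  induction n using Nat.binaryRec' with
  | zero => simp [bitsValue]
  | bit b n hb ih =>
    rw [bitsValue] at ih
    rw [Nat.bits_append_bit n b hb, bitsValue, List.foldr_cons, ih, Nat.bit_val]
    cases b <;> simp only [cond_true, cond_false, Bool.toNat_true, Bool.toNat_false] <;> lia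

theorem polyTime_bitsValue : PolyTime fun x : ℕ × List Bool => bitsValue x.1 x.2 := by
  refine PolyTime.foldr_of_add_le (l := fun x : ℕ × List Bool => x.2)
    (f := fun x b n => min x.1 (n + n + cond b 1 0)) (by fun_prop)
    (by fun_prop) (by fun_prop) ⟨_, polyBdd_size, ?_⟩
  rintro ⟨N, l⟩ n b _
  simp only [size_prod, size_nat]
  lia

/-! ### Encodings -/

/-- The trees that code the letters; any four different ones would do. -/
def letterCode : Letter → Tree
  | .bit false => .nil
  | .bit true => .cons .nil .nil
  | .mark => .cons .nil (.cons .nil .nil)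
  | .close => .cons (.cons .nil .nil) .nil

instance : Coded Letter := ⟨letterCode, by
  intro a b
  rcases a with (_ | _) | _ | _ <;> rcases b with (_ | _) | _ | _ <;> simp [letterCode]⟩

/-- A configuration in which all names are natural numbers. -/
abbrev NatConfig : Type := ℕ × List ℕ

namespace NatConfig

/-- The control state. -/
abbrev state (c : NatConfig) : ℕ := c.1

/-- The stack content. -/
abbrev stack (c : NatConfig) : List ℕ := c.2

end NatConfig

/-- An entry of a distribution, in which all names are natural numbers. -/
abbrev NatEntry : Type := ℕ × ℕ × NatConfig

namespace NatEntry

/-- The numerator of the probability. -/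
abbrev num (e : NatEntry) : ℕ := e.1

/-- The denominator of the probability, which may be `0`. -/
abbrev den (e : NatEntry) : ℕ := e.2.1

/-- The control state and the word that replaces the topmost symbol. -/
abbrev target (e : NatEntry) : NatConfig := e.2.2

end NatEntry

/-- A rule in which all names are natural numbers. -/
abbrev NatRule : Type := ℕ × ℕ × ℕ × List NatEntry

namespace NatRule

/-- The control state. -/
abbrev state (r : NatRule) : ℕ := r.1

/-- The topmost symbol. -/
abbrev top (r : NatRule) : ℕ := r.2.1

/-- The action. -/
abbrev action (r : NatRule) : ℕ := r.2.2.1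

/-- The written-out distribution. -/
abbrev dist (r : NatRule) : List NatEntry := r.2.2.2

end NatRule

/-- An instance of the bisimilarity problem in which all names are natural numbers. Unlike an
`Instance` it need not be well-formed, so that all of these form one simple type. -/
abbrev NatInstance : Type := ℕ × ℕ × List ℕ × List NatRule × NatConfig × NatConfig

namespace NatInstance

/-- The number of control states. -/
abbrev numStates (x : NatInstance) : ℕ := x.1

/-- The number of stack symbols. -/
abbrev numSymbols (x : NatInstance) : ℕ := x.2.1

/-- The widths of the kinds of the actions. -/
abbrev widths (x : NatInstance) : List ℕ := x.2.2.1

/-- The rules. -/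
abbrev rules (x : NatInstance) : List NatRule := x.2.2.2.1

/-- The first configuration. -/
abbrev left (x : NatInstance) : NatConfig := x.2.2.2.2.1

/-- The second configuration. -/
abbrev right (x : NatInstance) : NatConfig := x.2.2.2.2.2

end NatInstance

/-- The concatenation of two encodings. -/
def encSeq {α β : Type} (e : α → List Letter) (e' : β → List Letter) (x : α × β) : List Letter :=
  e x.1 ++ e' x.2

/-- The encoding of a configuration, as in `encConfig`. -/
def encNatConfig : NatConfig → List Letter := encSeq encNat (encList encNat)

/-- The encoding of an entry, as in `encEntry`. -/
def encNatEntry : NatEntry → List Letter := encSeq encNat (encSeq encNat encNatConfig)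

/-- The encoding of a rule, as in `encRule`. -/
def encNatRule : NatRule → List Letter :=
  encSeq encNat (encSeq encNat (encSeq encNat (encList encNatEntry)))

/-- The encoding of an instance, as in `Instance.encode`. -/
def encNatInstance : NatInstance → List Letter :=
  encSeq encUnary (encSeq encUnary (encSeq (encList encNat) (encSeq (encList encNatRule)
    (encSeq encNatConfig encNatConfig))))

section

variable {α β : Type} [Coded α] [Coded β]

theorem polyTime_encSeq {e : α → List Letter} {e' : β → List Letter} (he : PolyTime e)
    (he' : PolyTime e') : PolyTime (encSeq e e') := by
  unfold encSeq
  fun_prop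

theorem polyTime_encList {e : α → List Letter} (he : PolyTime e) : PolyTime (encList e) := by
  unfold encList
  fun_prop

end

theorem polyTime_encUnary : PolyTime encUnary := by
  have h : PolyTime fun n : ℕ =>
      (List.replicate n ()).map (fun _ => Letter.mark) ++ [Letter.close] := by fun_prop
  exact h.of_eq fun n => by simp [encUnary]

theorem polyTime_bit : PolyTime Letter.bit := by
  have h : PolyTime fun b => cond b (Letter.bit true) (Letter.bit false) := by fun_prop
  exact h.of_eq fun b => by cases b <;> rfl

theorem polyTime_encNat : PolyTime encNat := by
  have h := polyTime_bit
  unfold encNat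
  fun_prop

theorem polyTime_encNatInstance : PolyTime encNatInstance := by
  have hnat := polyTime_encNat
  have hunary := polyTime_encUnary
  have hconfig : PolyTime encNatConfig := polyTime_encSeq hnat (polyTime_encList hnat)
  have hentry : PolyTime encNatEntry := polyTime_encSeq hnat (polyTime_encSeq hnat hconfig)
  have hrule : PolyTime encNatRule :=
    polyTime_encSeq hnat (polyTime_encSeq hnat (polyTime_encSeq hnat (polyTime_encList hentry)))
  exact polyTime_encSeq hunary (polyTime_encSeq hunary (polyTime_encSeq (polyTime_encList hnat)
    (polyTime_encSeq (polyTime_encList hrule) (polyTime_encSeq hconfig hconfig))))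

/-! ### Parsers

A parser gets a bound `N` and a word, and returns a value and the remaining word. Numbers above the
bound may be misread, as their codes in unary would be too long. There is no failure: a word is
recognized as ill-formed by encoding the value again. -/

namespace WordParser

variable {α β : Type} {p : ℕ × List Letter → α × List Letter}
  {q : ℕ × List Letter → β × List Letter} {e : α → List Letter} {e' : β → List Letter}

/-- A parser that runs in polynomial time and does not lengthen the word. -/
structure Feasible [Coded α] (p : ℕ × List Letter → α × List Letter) : Prop where
  polyTime : PolyTime p
  size_rest_le : ∀ x, size (p x).2 ≤ size x.2

/-- The parser `p` inverts the encoding `e`, if the bound is large enough. -/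
def Inverts (p : ℕ × List Letter → α × List Letter) (e : α → List Letter) : Prop :=
  ∀ N x rest, 2 ^ (e x ++ rest).length ≤ N → p (N, e x ++ rest) = (x, rest)

/-- Parse two parts. -/
def seq (p : ℕ × List Letter → α × List Letter) (q : ℕ × List Letter → β × List Letter)
    (x : ℕ × List Letter) : (α × β) × List Letter :=
  (((p x).1, (q (x.1, (p x).2)).1), (q (x.1, (p x).2)).2)

/-- Parse one more item, provided that the next letter passes a test. -/
def manyStep (test : Letter → Bool) (p : ℕ × List Letter → α × List Letter) (N : ℕ)
    (s : List α × List Letter) : List α × List Letter :=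
  cond (test (s.2.headD .close)) (s.1 ++ [(p (N, s.2)).1], (p (N, s.2)).2) s

/-- Parse items as long as the next letter passes a test, and then drop a letter. -/
def many (test : Letter → Bool) (p : ℕ × List Letter → α × List Letter) (x : ℕ × List Letter) :
    List α × List Letter :=
  let r := (manyStep test p x.1)^[x.2.length] ([], x.2)
  (r.1, r.2.tail)

/-- Parse a list. -/
def list (p : ℕ × List Letter → α × List Letter) : ℕ × List Letter → List α × List Letter :=
  many (fun x => decide (x = .mark)) fun x => p (x.1, x.2.tail)

/-- Parse a number in unary, as a list of trivial items. -/
def unary : ℕ × List Letter → ℕ × List Letter := fun x =>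
  let r := list (fun x => ((), x.2)) x
  (r.1.length, r.2)

/-- Parse one bit; a letter that is not a bit is read as `false`. -/
def bit : ℕ × List Letter → Bool × List Letter := fun x =>
  (decide (x.2.headD .close = .bit true), x.2.tail)

/-- Parse a sequence of bits. -/
def bits : ℕ × List Letter → List Bool × List Letter :=
  many (fun x => decide (x = .bit true) || decide (x = .bit false)) bit

/-- Parse a number in binary. -/
def nat : ℕ × List Letter → ℕ × List Letter := fun x => (bitsValue x.1 (bits x).1, (bits x).2)

/-- Parse a configuration. -/
def config : ℕ × List Letter → NatConfig × List Letter := seq nat (list nat)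

/-- Parse an entry. -/
def entry : ℕ × List Letter → NatEntry × List Letter := seq nat (seq nat config)

/-- Parse a rule. -/
def rule : ℕ × List Letter → NatRule × List Letter := seq nat (seq nat (seq nat (list entry)))

/-- Parse an instance. -/
def inst : ℕ × List Letter → NatInstance × List Letter :=
  seq unary (seq unary (seq (list nat) (seq (list rule) (seq config config))))

section Feasible

variable [Coded α] [Coded β]

theorem Feasible.seq (hp : Feasible p) (hq : Feasible q) : Feasible (seq p q) := by
  obtain ⟨hp, hp_rest⟩ := hp
  obtain ⟨hq, hq_rest⟩ := hq
  refine ⟨?_, fun x => (hq_rest _).trans (hp_rest x)⟩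
  have : PolyTime fun x : ℕ × List Letter => q (x.1, (p x).2) := hq.comp (by fun_prop)
  unfold WordParser.seq
  fun_prop

theorem size_manyStep_iterate_le {test : Letter → Bool} {k : ℕ}
    (hk : ∀ x, size (p x) ≤ (size x + 2) ^ k) (hp : ∀ x, size (p x).2 ≤ size x.2) (N : ℕ)
    (w : List Letter) (i : ℕ) :
    size ((manyStep test p N)^[i] ([], w)).1 ≤ i * ((size (N, w) + 2) ^ k + 1) + 1 ∧
      size ((manyStep test p N)^[i] ([], w)).2 ≤ size w := by
  induction i with
  | zero => simp
  | succ i ih =>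
    rw [Function.iterate_succ_apply']
    set r := (manyStep test p N)^[i] ([], w)
    obtain ⟨hitems, hrest⟩ := ih
    rw [Nat.add_mul, manyStep]
    cases test (r.2.headD .close)
    · exact ⟨hitems.trans (by lia), hrest⟩
    · refine ⟨?_, (hp _).trans hrest⟩
      have happend := size_append r.1 [(p (N, r.2)).1]
      have hitem : size (p (N, r.2)).1 ≤ size (p (N, r.2)) := by
        have := size_prod (p (N, r.2))
        lia
      have hmono : (size (N, r.2) + 2) ^ k ≤ (size (N, w) + 2) ^ k := by
        simp only [size_prod]
        gcongr
      have := hk (N, r.2)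
      simp only [cond_true, size_cons, size_nil] at happend ⊢
      lia

theorem size_tail_le (l : List α) : size l.tail ≤ size l := size_le_of_sublist l.tail_sublist

theorem Feasible.many {test : Letter → Bool} (ht : PolyTime test) (hp : Feasible p) :
    Feasible (many test p) := by
  obtain ⟨hp, hp_rest⟩ := hp
  obtain ⟨k, hk⟩ := hp.size_bdd
  have hsize := size_manyStep_iterate_le (test := test) hk hp_rest
  refine ⟨?_, fun x => (size_tail_le _).trans (hsize x.1 x.2 x.2.length).2⟩
  have hstep : PolyTime fun y : (ℕ × List Letter) × List α × List Letter =>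
      manyStep test p y.1.1 y.2 := by
    have : PolyTime fun y : (ℕ × List Letter) × List α × List Letter => p (y.1.1, y.2.2) :=
      hp.comp (by fun_prop)
    have : PolyTime fun y : (ℕ × List Letter) × List α × List Letter =>
      test (y.2.2.headD .close) := ht.comp (by fun_prop)
    unfold manyStep
    fun_prop
  have hiterate : PolyTime fun x : ℕ × List Letter =>
      (manyStep test p x.1)^[x.2.length] ([], x.2) := by
    refine PolyTime.iterate (f := fun (x : ℕ × List Letter) s => manyStep test p x.1 s)
      (by fun_prop) (by fun_prop) hstep
      ⟨fun x => size x * ((size x + 2) ^ k + 1) + 1 + size x + 1, ?_, ?_⟩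
    · have : PolyBdd fun x : ℕ × List Letter => (size x + 2) ^ k := ⟨k, fun _ => le_rfl⟩
      fun_prop
    · rintro ⟨N, w⟩ i (hi : i ≤ w.length)
      obtain ⟨hitems, hrest⟩ := hsize N w i
      have hw : size (N, w) = size N + size w + 1 := size_prod (N, w)
      have hi' : i ≤ size (N, w) := by
        have := length_le_size w
        lia
      have hmul := Nat.mul_le_mul_right ((size (N, w) + 2) ^ k + 1) hi'
      have hr := size_prod ((manyStep test p N)^[i] ([], w))
      lia
  unfold WordParser.many
  fun_prop

theorem Feasible.list (hp : Feasible p) : Feasible (list p) :=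
  Feasible.many (by fun_prop) ⟨hp.polyTime.comp (by fun_prop),
    fun x => (hp.size_rest_le _).trans (size_tail_le _)⟩

end Feasible

theorem feasible_unary : Feasible unary := by
  have hitem : Feasible fun x : ℕ × List Letter => ((), x.2) := ⟨by fun_prop, fun _ => le_rfl⟩
  have hlist := hitem.list.polyTime
  refine ⟨?_, fun x => hitem.list.size_rest_le x⟩
  unfold unary
  fun_prop

theorem feasible_nat : Feasible nat := by
  have hbit : Feasible bit := ⟨by unfold bit; fun_prop, fun x => size_tail_le _⟩
  have hbits : Feasible bits := Feasible.many (by fun_prop) hbit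
  have hbits' := hbits.polyTime
  exact ⟨(polyTime_bitsValue.comp (f := fun x : ℕ × List Letter => (x.1, (bits x).1))
    (by fun_prop)).prodMk (by fun_prop), fun x => hbits.size_rest_le x⟩

theorem feasible_inst : Feasible inst := by
  have hnat := feasible_nat
  have hunary := feasible_unary
  have hconfig : Feasible config := hnat.seq hnat.list
  have hrule : Feasible rule := hnat.seq (hnat.seq (hnat.seq (hnat.seq (hnat.seq hconfig)).list))
  exact hunary.seq (hunary.seq (hnat.list.seq (hrule.list.seq (hconfig.seq hconfig))))

theorem Inverts.seq (hp : Inverts p e) (hq : Inverts q e') :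
    Inverts (seq p q) (encSeq e e') := by
  rintro N ⟨a, b⟩ rest hN
  simp only [encSeq, List.append_assoc] at hN ⊢
  have ha := hp N a _ hN
  have hb := hq N b rest ((Nat.pow_le_pow_right (by simp) (by simp)).trans hN)
  simp [WordParser.seq, ha, hb]

section Many

variable {test : Letter → Bool} {N : ℕ}

theorem manyStep_iterate (ht : ∀ x rest, test ((e x ++ rest).headD .close) = true)
    (hc : test .close = false) (hp : Inverts p e) (rest : List Letter) {l : List α} {i : ℕ}
    (hi : l.length ≤ i) (hN : 2 ^ (l.flatMap e ++ .close :: rest).length ≤ N) (acc : List α) :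
    (manyStep test p N)^[i] (acc, l.flatMap e ++ .close :: rest) = (acc ++ l, .close :: rest) := by
  induction l generalizing i acc with
  | nil =>
    rw [List.flatMap_nil, List.nil_append, List.append_nil]
    exact Function.iterate_fixed (by simp [manyStep, hc]) i
  | cons x l ih =>
    obtain ⟨i, rfl⟩ : ∃ j, i = j + 1 := Nat.exists_eq_add_one.2 (by simp at hi; lia)
    simp only [List.flatMap_cons, List.append_assoc] at hN ⊢
    have hstep : manyStep test p N (acc, e x ++ (l.flatMap e ++ .close :: rest))
        = (acc ++ [x], l.flatMap e ++ .close :: rest) := by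
      simp only [manyStep, ht, cond_true, hp _ _ _ hN]
    rw [Function.iterate_succ_apply, hstep, ih (by simpa using hi)
      ((Nat.pow_le_pow_right (by simp) (by simp)).trans hN), List.append_assoc,
      List.singleton_append]

theorem many_eq (he : ∀ x, e x ≠ []) (ht : ∀ x rest, test ((e x ++ rest).headD .close) = true)
    (hc : test .close = false) (hp : Inverts p e) (l : List α) (rest : List Letter)
    (hN : 2 ^ (l.flatMap e ++ .close :: rest).length ≤ N) :
    many test p (N, l.flatMap e ++ .close :: rest) = (l, rest) := by
  have hl : l.length ≤ (l.flatMap e).length := by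
    rw [List.length_flatMap, ← List.length_map (fun x => (e x).length)]
    refine List.length_le_sum_of_one_le _ fun n hn => ?_
    obtain ⟨x, -, rfl⟩ := List.mem_map.1 hn
    exact List.length_pos_of_ne_nil (he x)
  have h := manyStep_iterate ht hc hp rest
    (hl.trans (List.sublist_append_left _ (.close :: rest)).length_le) hN []
  rw [many, h, List.nil_append, List.tail_cons]

end Many

theorem Inverts.list (hp : Inverts p e) : Inverts (list p) (encList e) := by
  intro N l rest hN
  simp only [encList, List.append_assoc, List.singleton_append] at hN ⊢
  refine many_eq (e := fun x => Letter.mark :: e x) (by simp) (by simp) (by simp) ?_ l rest hN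
  exact fun N x rest hN => hp N x rest ((Nat.pow_le_pow_right (by simp) (by simp)).trans hN)

theorem inverts_unary : Inverts unary encUnary := by
  have hitem : Inverts (fun x => ((), x.2)) (fun _ : Unit => []) := fun _ _ _ _ => rfl
  intro N n rest hN
  have e : encUnary n = encList (fun _ : Unit => []) (List.replicate n ()) := by
    simp [encUnary, encList, List.flatMap_replicate]
  rw [e] at hN ⊢
  simp [unary, hitem.list N _ rest hN]

theorem le_two_pow_length_encNat (n : ℕ) : n ≤ 2 ^ (encNat n).length := by
  refine (Nat.lt_size_self n).le.trans (Nat.pow_le_pow_right (by simp) ?_)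
  simp [encNat, ← Nat.size_eq_bits_len]

theorem inverts_nat : Inverts nat encNat := by
  intro N n rest hN
  have hn : n ≤ N := (le_two_pow_length_encNat n).trans
    ((Nat.pow_le_pow_right (by simp) (by simp)).trans hN)
  have e : encNat n ++ rest = n.bits.flatMap (fun b => [Letter.bit b]) ++ .close :: rest := by
    rw [encNat, List.map_eq_flatMap]
    simp
  have hbit : Inverts bit fun b => [Letter.bit b] := by
    intro _ b _ _
    cases b <;> simp [bit]
  rw [e] at hN ⊢
  have hbits : bits (N, _) = (n.bits, rest) :=
    many_eq (by simp) (by intro b; cases b <;> simp) (by simp) hbit n.bits rest hN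
  simp [nat, hbits, bitsValue_bits, hn]

theorem inverts_inst : Inverts inst encNatInstance := by
  have hnat := inverts_nat
  have hunary := inverts_unary
  have hconfig : Inverts config encNatConfig := hnat.seq hnat.list
  have hrule : Inverts rule encNatRule :=
    hnat.seq (hnat.seq (hnat.seq (hnat.seq (hnat.seq hconfig)).list))
  exact hunary.seq (hunary.seq (hnat.list.seq (hrule.list.seq (hconfig.seq hconfig))))

end WordParser

/-! ### The decision procedure -/

/-- The list of the sublists of a list, truncated at `N` in each step. -/
def boundedSublists {α : Type} (N : ℕ) (l : List α) : List (List α) :=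
  l.foldr (fun a s => (s ++ s.map fun u => a :: u).take N) [[]]

theorem length_boundedSublists_le {α : Type} (N : ℕ) (l : List α) :
    (boundedSublists N l).length ≤ N + 1 := by
  cases l with
  | nil => simp [boundedSublists]
  | cons a l =>
    rw [boundedSublists, List.foldr_cons, List.length_take]
    exact (min_le_left _ _).trans (Nat.le_succ N)

theorem boundedSublists_subset {α : Type} (N : ℕ) (l : List α) :
    boundedSublists N l ⊆ l.sublists' := by
  induction l with
  | nil => simp [boundedSublists]
  | cons a l ih =>
    rw [List.sublists'_cons]
    refine List.Subset.trans (List.take_subset _ _) (List.append_subset.2 ⟨?_, ?_⟩)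
    · exact List.subset_append_of_subset_left _ ih
    · exact List.subset_append_of_subset_right _ (List.map_subset _ ih)

theorem boundedSublists_eq {α : Type} {N : ℕ} {l : List α} (hN : 2 ^ l.length ≤ N) :
    boundedSublists N l = l.sublists' := by
  induction l with
  | nil => rfl
  | cons a l ih =>
    have hl : 2 ^ l.length ≤ N := (Nat.pow_le_pow_right (by simp) (by simp)).trans hN
    have hcons : boundedSublists N (a :: l) = (boundedSublists N l ++
      (boundedSublists N l).map fun u => a :: u).take N := rfl
    rw [hcons, ih hl, ← List.sublists'_cons, List.take_of_length_le]
    rwa [List.length_sublists']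

/-- One step of the addition of the probabilities of a list of entries, where fractions are pairs of
a numerator and a denominator, both truncated at `N`. -/
def addFrac (N : ℕ) (e : NatEntry) (s : ℕ × ℕ) : ℕ × ℕ :=
  (min N (s.1 * e.den + e.num * s.2), min N (s.2 * e.den))

/-- The sum of the probabilities of a list of entries, as a fraction. -/
def fracSum (N : ℕ) (l : List NatEntry) : ℕ × ℕ := l.foldr (addFrac N) (0, 1)

/-- Tests whether the probability of one list of entries is at most that of another one. -/
def fracLe (N : ℕ) (l l' : List NatEntry) : Bool :=
  decide ((fracSum N l).1 * (fracSum N l').2 ≤ (fracSum N l').1 * (fracSum N l).2)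

/-- All pairs of control states. -/
def pairs (n : ℕ) : List (ℕ × ℕ) :=
  (List.range n).flatMap fun p => (List.range n).map fun q => (p, q)

/-- A tuple `(X, Y, B, p, q)`. A `Table` is represented by the list of the tuples for which
`T X Y B p q` holds, and the relation `B` by a list of pairs. -/
abbrev TableTuple : Type := ℕ × ℕ × List (ℕ × ℕ) × ℕ × ℕ

/-- The relation `T X Y B` for a table `T`. -/
def lookup (n : ℕ) (T : List TableTuple) (X Y : ℕ) (B : List (ℕ × ℕ)) : List (ℕ × ℕ) :=
  (pairs n).filter fun x => decide ((X, Y, B, x) ∈ T)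

/-- The relation that a table prescribes on two stacks above the relation `B`. Only as many symbols
as are on both stacks matter. -/
def relAbove (n : ℕ) (T : List TableTuple) (α β : List ℕ) (B : List (ℕ × ℕ)) : List (ℕ × ℕ) :=
  (α.zip β).foldr (fun z B => lookup n T z.1 z.2 B) B

/-- Tests `Table.targetRel`. -/
def targetTest (n : ℕ) (T : List TableTuple) (B : List (ℕ × ℕ)) (x y : NatConfig) : Bool :=
  decide (x.stack.length = y.stack.length) &&
    decide ((x.state, y.state) ∈ relAbove n T x.stack y.stack B)

/-- Tests `Lift rel` on written-out distributions. -/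
def liftTest (N : ℕ) (rel : NatConfig → NatConfig → Bool) (l l' : List NatEntry) : Bool :=
  (boundedSublists N l).all fun u =>
    fracLe N u (l'.filter fun e' => u.any fun e => rel e.target e'.target)

/-- Tests whether a rule is one for the control state `p` and the topmost symbol `X`. -/
def applies (p X : ℕ) (r : NatRule) : Bool := decide (r.state = p) && decide (r.top = X)

/-- Tests whether each rule for `p` and `X` is matched, up to `rel`, by a rule for `q` and `Y`. -/
def simulates (rel : List NatEntry → List NatEntry → Bool) (rs : List NatRule) (p X q Y : ℕ) :
    Bool :=
  rs.all fun r => !applies p X r || rs.any fun r' =>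
    applies q Y r' && (decide (r'.action = r.action) && rel r.dist r'.dist)

/-- Tests `PPDA.refine`. -/
def refineTest (N n : ℕ) (rs : List NatRule) (T : List TableTuple) (X Y : ℕ) (B : List (ℕ × ℕ))
    (p q : ℕ) : Bool :=
  simulates (fun l l' => liftTest N (targetTest n T B) l l') rs p X q Y &&
    simulates (fun l' l => liftTest N (targetTest n T B) l l') rs q Y p X

/-- The greatest table. -/
def allTuples (N n m : ℕ) : List TableTuple :=
  (List.range m).flatMap fun X => (List.range m).flatMap fun Y =>
    (boundedSublists N (pairs n)).flatMap fun B => (pairs n).map fun x => (X, Y, B, x)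

/-- The greatest table that is stable under the refinement. It is reached after as many steps as
there are tuples. -/
def stableTable (N n m : ℕ) (rs : List NatRule) : List TableTuple :=
  (fun T => (allTuples N n m).filter fun t =>
    refineTest N n rs T t.1 t.2.1 t.2.2.1 t.2.2.2.1 t.2.2.2.2)^[(allTuples N n m).length]
      (allTuples N n m)

/-- Tests `PPDA.Stuck`. -/
def stuckTest (rs : List NatRule) (p X : ℕ) : Bool := rs.all fun r => !applies p X r

/-- The relation `PPDA.stackRel` on what remains of two stacks when as many symbols as are on both
stacks have been removed. -/
def bottomRel (n : ℕ) (rs : List NatRule) (α β : List ℕ) : List (ℕ × ℕ) :=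
  (pairs n).filter fun x =>
    ((α.drop β.length).take 1).all (fun X => stuckTest rs x.1 X) &&
      ((β.drop α.length).take 1).all fun Y => stuckTest rs x.2 Y

/-- Tests whether the two configurations of an instance are bisimilar. -/
def bisimTest (N : ℕ) (x : NatInstance) : Bool :=
  decide ((x.left.state, x.right.state) ∈ relAbove x.numStates
    (stableTable N x.numStates x.numSymbols x.rules) x.left.stack x.right.stack
    (bottomRel x.numStates x.rules x.left.stack x.right.stack))

/-- Tests whether a configuration is one with `n` control states and `m` stack symbols. -/
def configTest (n m : ℕ) (c : NatConfig) : Bool :=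
  decide (c.state < n) && c.stack.all fun X => decide (X < m)

/-- Tests whether an entry comes from an `Entry n m`. -/
def entryTest (n m : ℕ) (e : NatEntry) : Bool :=
  decide (0 < e.den) && (configTest n m e.target && decide (e.target.stack.length ≤ 2))

/-- Tests whether a rule comes from a `RawRule n m a`. -/
def ruleTest (n m a : ℕ) (r : NatRule) : Bool :=
  decide (r.state < n) && (decide (r.top < m) && (decide (r.action < a) &&
    r.dist.all fun e => entryTest n m e))

/-- Tests whether an instance comes from an `Instance`. -/
def instanceTest (x : NatInstance) : Bool :=
  (x.widths.all fun k => decide (k ≤ 2)) &&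
    ((x.rules.all fun r => ruleTest x.numStates x.numSymbols x.widths.length r) &&
      (configTest x.numStates x.numSymbols x.left && configTest x.numStates x.numSymbols x.right))

/-- Tests whether the rules are those of a probabilistic visibly pushdown automaton: the
probabilities add up to `1` and the targets have the prescribed width. -/
def visiblyTest (N : ℕ) (x : NatInstance) : Bool :=
  x.rules.all fun r => decide ((fracSum N r.dist).1 = (fracSum N r.dist).2) &&
    r.dist.all fun e => decide (e.num = 0) ||
      decide (e.target.stack.length = (x.widths.drop r.action).headD 0)

/-- Tests `PPDA.IsStandard`. -/
def diracTest (x : NatInstance) : Bool :=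
  x.rules.all fun r => r.dist.all fun e => r.dist.all fun e' =>
    decide (e.num = 0) || (decide (e'.num = 0) || decide (e.target = e'.target))

/-- Tests whether an instance is well-formed with bisimilar configurations. -/
def acceptTest (N : ℕ) (x : NatInstance) : Bool :=
  instanceTest x && (visiblyTest N x && bisimTest N x)

/-- The instance that a word encodes, provided that there is one. -/
def decode (y : List Letter × ℕ) : NatInstance := (WordParser.inst (y.2, y.1)).1

/-- The decision procedure for probabilistic visibly pushdown automata. It is given a word and a
bound for all the numbers and lists that occur. -/
def decidePvPDA (y : List Letter × ℕ) : Bool :=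
  decide (encNatInstance (decode y) = y.1) && acceptTest y.2 (decode y)

/-- The decision procedure for visibly pushdown automata. -/
def decideVPDA (y : List Letter × ℕ) : Bool := decidePvPDA y && diracTest (decode y)

/-! ### The decision procedure runs in polynomial time -/

section

variable {α β : Type} [Coded α] [Coded β] {N n m : α → ℕ} {rs : α → List NatRule}

@[fun_prop]
theorem polyTime_boundedSublists {l : α → List β} (hN : PolyTime N) (hl : PolyTime l) :
    PolyTime fun a => boundedSublists (N a) (l a) := by
  have hfold : ∀ a (l : List β), l.foldl (fun s b => (s ++ s.map fun u => b :: u).take (N a)) [[]] =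
      boundedSublists (N a) l.reverse := fun a l => by rw [boundedSublists, List.foldr_reverse]
  refine (hl.reverse.foldl (f := fun a s b => (s ++ s.map fun u => b :: u).take (N a))
    (polyTime_const [[]]) (by fun_prop)
    ⟨fun a => (size (N a) + 1) * (size (l a) + 1) + 1, by fun_prop, fun a l' hl' => ?_⟩).of_eq
      fun a => by rw [hfold, List.reverse_reverse]
  have hsub : l'.reverse.Sublist (l a) := by
    simpa using hl'.sublist.reverse
  rw [hfold]
  refine (size_list_le (c := size (l a)) fun u hu => ?_).trans
    (Nat.add_le_add_right (Nat.mul_le_mul_right _ ?_) 1)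
  · exact size_le_of_sublist
      ((List.mem_sublists'.1 (boundedSublists_subset _ _ hu)).trans hsub)
  · refine (length_boundedSublists_le _ _).trans ?_
    simp only [size_nat]
    lia

@[fun_prop]
theorem polyTime_fracSum {l : α → List NatEntry} (hN : PolyTime N) (hl : PolyTime l) :
    PolyTime fun a => fracSum (N a) (l a) := by
  refine hl.foldr_of_add_le (f := fun a => addFrac (N a)) (by fun_prop)
    (by unfold addFrac; fun_prop) ⟨fun a => 2 * size (N a), by fun_prop, fun a s e _ => ?_⟩
  simp only [addFrac, size_prod, size_nat]
  lia

@[fun_prop]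
theorem polyTime_pairs (hn : PolyTime n) : PolyTime fun a => pairs (n a) := by
  unfold pairs
  fun_prop

@[fun_prop]
theorem polyTime_relAbove {T : α → List TableTuple} {l l' : α → List ℕ} {B : α → List (ℕ × ℕ)}
    (hn : PolyTime n) (hT : PolyTime T) (hl : PolyTime l) (hl' : PolyTime l') (hB : PolyTime B) :
    PolyTime fun a => relAbove (n a) (T a) (l a) (l' a) (B a) := by
  refine (hl.zip hl').foldr_of_add_le (f := fun a z B => lookup (n a) (T a) z.1 z.2 B) hB
    (by unfold lookup; fun_prop) ⟨fun a => size (pairs (n a)), by fun_prop, fun a B z _ => ?_⟩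
  exact (size_le_of_sublist List.filter_sublist).trans (Nat.le_add_left _ _)

@[fun_prop]
theorem polyTime_applies {p X : α → ℕ} {r : α → NatRule} (hp : PolyTime p) (hX : PolyTime X)
    (hr : PolyTime r) : PolyTime fun a => applies (p a) (X a) (r a) := by
  unfold applies
  fun_prop

theorem polyTime_refineTest : PolyTime fun x : (ℕ × ℕ × List NatRule) × List TableTuple ×
    TableTuple => refineTest x.1.1 x.1.2.1 x.1.2.2 x.2.1 x.2.2.1 x.2.2.2.1 x.2.2.2.2.1
      x.2.2.2.2.2.1 x.2.2.2.2.2.2 := by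
  simp only [refineTest, simulates, liftTest, fracLe, targetTest]
  fun_prop

@[fun_prop]
theorem polyTime_stableTable (hN : PolyTime N) (hn : PolyTime n) (hm : PolyTime m)
    (hrs : PolyTime rs) : PolyTime fun a => stableTable (N a) (n a) (m a) (rs a) := by
  have hall : PolyTime fun a => allTuples (N a) (n a) (m a) := by
    unfold allTuples
    fun_prop
  have hrefine : PolyTime fun x : (α × List TableTuple) × TableTuple =>
      refineTest (N x.1.1) (n x.1.1) (rs x.1.1) x.1.2 x.2.1 x.2.2.1 x.2.2.2.1 x.2.2.2.2.1
        x.2.2.2.2.2 :=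
    polyTime_refineTest.comp
      (f := fun x : (α × List TableTuple) × TableTuple =>
        ((N x.1.1, n x.1.1, rs x.1.1), x.1.2, x.2)) (by fun_prop)
  refine PolyTime.iterate (f := fun a T => (allTuples (N a) (n a) (m a)).filter fun t =>
    refineTest (N a) (n a) (rs a) T t.1 t.2.1 t.2.2.1 t.2.2.2.1 t.2.2.2.2) (by fun_prop) hall
    ((hall.comp polyTime_fst).filter hrefine) ⟨_, hall.size_bdd, fun a i _ => ?_⟩
  cases i with
  | zero => exact le_rfl
  | succ i =>
    rw [Function.iterate_succ_apply']
    exact size_le_of_sublist List.filter_sublist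

@[fun_prop]
theorem polyTime_acceptTest {x : α → NatInstance} (hN : PolyTime N) (hx : PolyTime x) :
    PolyTime fun a => acceptTest (N a) (x a) := by
  simp only [acceptTest, instanceTest, ruleTest, entryTest, configTest, visiblyTest, bisimTest,
    bottomRel, stuckTest]
  fun_prop

@[fun_prop]
theorem polyTime_diracTest {x : α → NatInstance} (hx : PolyTime x) :
    PolyTime fun a => diracTest (x a) := by
  unfold diracTest
  fun_prop

end

@[fun_prop]
theorem polyTime_decode : PolyTime decode :=
  (WordParser.feasible_inst.polyTime.comp (by fun_prop)).fst

@[fun_prop]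
theorem polyTime_decidePvPDA : PolyTime decidePvPDA := by
  have henc : PolyTime fun y => encNatInstance (decode y) :=
    polyTime_encNatInstance.comp polyTime_decode
  unfold decidePvPDA
  fun_prop

theorem polyTime_decideVPDA : PolyTime decideVPDA := by
  unfold decideVPDA
  fun_prop

/-! ### Instances with numbers as names -/

section

variable {n m k : ℕ}

/-- The configuration of natural numbers for a configuration of an instance. -/
def natConfig (c : Config (Fin n) (Fin m)) : NatConfig := (c.1.val, c.2.map Fin.val)

/-- The configuration of natural numbers for the target of an entry. -/
def natTarget (x : Fin n × ShortWord (Fin m)) : NatConfig := natConfig (x.1, x.2.1)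

/-- The tuple of natural numbers for an entry. -/
def Entry.toNat (e : Entry n m) : NatEntry := (e.num, e.den, natTarget e.target)

/-- The tuple of natural numbers for a rule. -/
def RawRule.toNat (r : RawRule n m k) : NatRule :=
  (r.state.val, r.top.val, r.action.val, r.dist.map Entry.toNat)

/-- The tuple of natural numbers for an instance. -/
def Instance.toNat (I : Instance) : NatInstance :=
  (I.numStates, I.numSymbols, I.kinds.map StackKind.width, I.rules.map RawRule.toNat,
    natConfig I.left, natConfig I.right)

theorem natConfig_injective :
    Function.Injective (natConfig : Config (Fin n) (Fin m) → NatConfig) :=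
  Fin.val_injective.prodMap (List.map_injective_iff.2 Fin.val_injective)

theorem natTarget_injective :
    Function.Injective (natTarget : Fin n × ShortWord (Fin m) → NatConfig) :=
  natConfig_injective.comp (Function.injective_id.prodMap Subtype.val_injective)

theorem encList_map {α β : Type} (f : β → List Letter) (g : α → β) (l : List α) :
    encList f (l.map g) = encList (fun x => f (g x)) l := by
  simp only [encList, List.flatMap_map]

theorem encNatConfig_natConfig (c : Config (Fin n) (Fin m)) :
    encNatConfig (natConfig c) = encConfig c := by
  simp [encNatConfig, encSeq, natConfig, encConfig, encWord, encList_map]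

theorem encNatEntry_toNat (e : Entry n m) : encNatEntry e.toNat = encEntry e := by
  simp [encNatEntry, encSeq, Entry.toNat, natTarget, encNatConfig_natConfig, encConfig, encEntry]

theorem encNatRule_toNat (r : RawRule n m k) : encNatRule r.toNat = encRule r := by
  simp [encNatRule, encSeq, RawRule.toNat, encRule, encList_map, encNatEntry_toNat]

theorem encNatInstance_toNat (I : Instance) : encNatInstance I.toNat = I.encode := by
  simp [encNatInstance, encSeq, Instance.toNat, Instance.encode, encList_map, encNatRule_toNat,
    encNatConfig_natConfig]

theorem exists_map_eq_iff {α β : Type} {f : α → β} {l : List β} :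
    (∃ l' : List α, l'.map f = l) ↔ ∀ y ∈ l, ∃ x, f x = y :=
  Set.ext_iff.1 (Set.range_list_map f) l

theorem configTest_iff {c : NatConfig} :
    configTest n m c = true ↔ ∃ c' : Config (Fin n) (Fin m), natConfig c' = c := by
  simp only [configTest, Bool.and_eq_true, decide_eq_true_eq, List.all_eq_true]
  constructor
  · rintro ⟨hp, hα⟩
    obtain ⟨α, hα⟩ : ∃ α : List (Fin m), α.map Fin.val = c.stack :=
      exists_map_eq_iff.2 fun X hX => ⟨⟨X, hα X hX⟩, rfl⟩
    exact ⟨(⟨c.state, hp⟩, α), Prod.ext rfl hα⟩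
  · rintro ⟨c', rfl⟩
    simp [natConfig, NatConfig.state, NatConfig.stack]

theorem entryTest_iff {e : NatEntry} :
    entryTest n m e = true ↔ ∃ e' : Entry n m, e'.toNat = e := by
  simp only [entryTest, Bool.and_eq_true, decide_eq_true_eq, configTest_iff]
  constructor
  · rintro ⟨hden, ⟨c, hc⟩, hlen⟩
    have hlen : c.2.length ≤ 2 := by simpa [← hc, natConfig, NatConfig.stack] using hlen
    exact ⟨⟨e.num, ⟨e.den, hden⟩, c.1, c.2, hlen⟩, Prod.ext rfl (Prod.ext rfl hc)⟩
  · rintro ⟨e', rfl⟩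
    exact ⟨e'.den.pos, ⟨(e'.target.1, e'.target.2.1), rfl⟩, by
      simpa [Entry.toNat, natTarget, natConfig, NatEntry.target, NatConfig.stack]
        using e'.target.2.2⟩

theorem ruleTest_iff {r : NatRule} :
    ruleTest n m k r = true ↔ ∃ r' : RawRule n m k, r'.toNat = r := by
  simp only [ruleTest, Bool.and_eq_true, decide_eq_true_eq, List.all_eq_true, entryTest_iff]
  rw [← exists_map_eq_iff]
  constructor
  · rintro ⟨hp, hX, ha, l, hl⟩
    exact ⟨⟨⟨_, hp⟩, ⟨_, hX⟩, ⟨_, ha⟩, l⟩,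
      Prod.ext rfl (Prod.ext rfl (Prod.ext rfl hl))⟩
  · rintro ⟨r', rfl⟩
    exact ⟨r'.state.2, r'.top.2, r'.action.2, r'.dist, rfl⟩

theorem StackKind.exists_width_eq_iff {i : ℕ} : (∃ s : StackKind, s.width = i) ↔ i ≤ 2 := by
  constructor
  · rintro ⟨_ | _ | _, rfl⟩ <;> simp [StackKind.width]
  · intro hi
    interval_cases i
    exacts [⟨.ret, rfl⟩, ⟨.int, rfl⟩, ⟨.call, rfl⟩]

theorem instanceTest_iff {x : NatInstance} :
    instanceTest x = true ↔ ∃ I : Instance, I.toNat = x := by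
  obtain ⟨n, m, widths, rules, left, right⟩ := x
  simp only [instanceTest, NatInstance.numStates, NatInstance.numSymbols, NatInstance.widths,
    NatInstance.rules, NatInstance.left, NatInstance.right, Bool.and_eq_true, decide_eq_true_eq,
    List.all_eq_true, ruleTest_iff, configTest_iff, ← StackKind.exists_width_eq_iff]
  rw [← exists_map_eq_iff, ← exists_map_eq_iff]
  constructor
  · rintro ⟨⟨kinds, hkinds⟩, ⟨rs, hrs⟩, ⟨c, hc⟩, ⟨c', hc'⟩⟩
    have hlength : widths.length = kinds.length := by simp [← hkinds]
    refine ⟨⟨n, m, kinds, rs.map fun r => ⟨r.state, r.top, r.action.cast hlength, r.dist⟩, c, c'⟩,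
      ?_⟩
    simp only [Instance.toNat, ← hkinds, ← hrs, ← hc, ← hc', List.map_map]
    rfl
  · rintro ⟨I, hI⟩
    obtain ⟨rfl, rfl, rfl, rfl, rfl, rfl⟩ := by simpa only [Instance.toNat, Prod.mk.injEq] using hI
    have hlength : I.kinds.length = (I.kinds.map StackKind.width).length := by simp
    refine ⟨⟨_, rfl⟩, ⟨I.rules.map fun r => ⟨r.state, r.top, r.action.cast hlength, r.dist⟩, ?_⟩,
      ⟨_, rfl⟩, ⟨_, rfl⟩⟩
    simp only [List.map_map]
    rfl

end

/-! ### Bounds for the numbers that occur -/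

/-- A bound for the numerators and the denominators of all the partial sums of the probabilities of
a list of entries. -/
def fracBound (l : List NatEntry) : ℕ := (l.map fun e => e.num + e.den).prod

theorem fracBound_cons (e : NatEntry) (l : List NatEntry) :
    fracBound (e :: l) = (e.num + e.den) * fracBound l := by
  rw [fracBound, List.map_cons, List.prod_cons, fracBound]

theorem fracBound_le_of_sublist {l l' : List NatEntry} (h : l.Sublist l')
    (hl' : ∀ e ∈ l', 0 < e.den) : fracBound l ≤ fracBound l' := by
  refine (h.map _).prod_le_prod' fun x hx => ?_
  obtain ⟨e, he, rfl⟩ := List.mem_map.1 hx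
  exact (hl' e he).trans_le (Nat.le_add_left _ _)

theorem encList_cons {α : Type} (f : α → List Letter) (x : α) (l : List α) :
    encList f (x :: l) = Letter.mark :: f x ++ encList f l := by
  simp only [encList, List.flatMap_cons, List.append_assoc]

theorem length_le_encList {α : Type} (f : α → List Letter) (l : List α) :
    l.length ≤ (encList f l).length := by
  induction l with
  | nil => simp
  | cons x l ih =>
    rw [encList_cons, List.length_append, List.length_cons, List.length_cons]
    lia

theorem length_le_encList_of_mem {α : Type} (f : α → List Letter) {l : List α} {x : α}
    (h : x ∈ l) : (f x).length ≤ (encList f l).length := by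
  induction l with
  | nil => simp at h
  | cons y l ih =>
    rw [encList_cons, List.length_append, List.length_cons]
    rcases List.mem_cons.1 h with rfl | h
    · lia
    · exact (ih h).trans (Nat.le_add_left _ _)

theorem num_add_den_le (e : NatEntry) : e.num + e.den ≤ 2 ^ (encNatEntry e).length * 2 := by
  have hnum := WordParser.le_two_pow_length_encNat e.num
  have hden := WordParser.le_two_pow_length_encNat e.den
  have hlength : (encNat e.num).length ≤ (encNatEntry e).length ∧
      (encNat e.den).length ≤ (encNatEntry e).length := by
    simp only [encNatEntry, encSeq, List.length_append]
    lia
  have hnum' := hnum.trans (Nat.pow_le_pow_right two_pos hlength.1)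
  have hden' := hden.trans (Nat.pow_le_pow_right two_pos hlength.2)
  lia

theorem fracBound_le (l : List NatEntry) : fracBound l ≤ 2 ^ (encList encNatEntry l).length := by
  induction l with
  | nil => exact Nat.one_le_two_pow
  | cons e l ih =>
    rw [fracBound_cons, encList_cons, List.length_append, pow_add, List.length_cons, pow_succ]
    exact Nat.mul_le_mul (num_add_den_le e) ih

/-- The number `N` exceeds all the numbers that occur in the tests for `I`. -/
structure Instance.Bounded (I : Instance) (N : ℕ) : Prop where
  states : 2 ^ (I.numStates * I.numStates) ≤ N
  entries : ∀ r ∈ I.rules, 2 ^ r.dist.length ≤ N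
  frac : ∀ r ∈ I.rules, fracBound (r.dist.map Entry.toNat) ≤ N

theorem Instance.bounded (I : Instance) :
    I.Bounded (2 ^ (I.encode.length * I.encode.length + I.encode.length)) := by
  have hstates : I.numStates ≤ I.encode.length := by
    simp only [Instance.encode, encUnary, List.length_append, List.length_replicate]
    lia
  have hdist : ∀ r ∈ I.rules, (encList encEntry r.dist).length ≤ I.encode.length := by
    intro r hr
    have hrule := length_le_encList_of_mem encRule hr
    simp only [encRule, Instance.encode, List.length_append] at hrule ⊢
    lia
  refine ⟨Nat.pow_le_pow_right two_pos ?_, fun r hr => Nat.pow_le_pow_right two_pos ?_,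
    fun r hr => (fracBound_le _).trans (Nat.pow_le_pow_right two_pos ?_)⟩
  · exact (Nat.mul_le_mul hstates hstates).trans (Nat.le_add_right _ _)
  · exact (length_le_encList encEntry r.dist).trans
      ((hdist r hr).trans (Nat.le_add_left _ _))
  · simp only [encList_map, encNatEntry_toNat]
    exact (hdist r hr).trans (Nat.le_add_left _ _)

/-! ### Sums of probabilities -/

/-- The total probability of a list of entries. -/
noncomputable def natWeight (l : List NatEntry) : ℝ≥0 :=
  (l.map fun e => (e.num : ℝ≥0) / (e.den : ℝ≥0)).sum

theorem natWeight_cons (e : NatEntry) (l : List NatEntry) :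
    natWeight (e :: l) = (e.num : ℝ≥0) / (e.den : ℝ≥0) + natWeight l := by
  rw [natWeight, List.map_cons, List.sum_cons, natWeight]

theorem fracSum_spec {N : ℕ} {l : List NatEntry} (hl : ∀ e ∈ l, 0 < e.den)
    (hN : fracBound l ≤ N) : (fracSum N l).1 + (fracSum N l).2 ≤ fracBound l ∧
      0 < (fracSum N l).2 ∧ ((fracSum N l).1 : ℝ≥0) / (fracSum N l).2 = natWeight l := by
  induction l with
  | nil => simp [fracSum, fracBound, natWeight]
  | cons e l ih =>
    have he := hl e List.mem_cons_self
    rw [fracBound_cons] at hN ⊢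
    obtain ⟨hle, hpos, hdiv⟩ := ih (fun e' h => hl e' (List.mem_cons_of_mem e h)) (by nlinarith)
    have hsum : fracSum N (e :: l) = addFrac N e (fracSum N l) := rfl
    generalize fracSum N l = s at hle hpos hdiv hsum
    have hle' : s.1 * e.den + e.num * s.2 + s.2 * e.den ≤ (e.num + e.den) * fracBound l := by
      nlinarith
    rw [hsum, addFrac, min_eq_right (by lia), min_eq_right (by lia), natWeight_cons, ← hdiv]
    refine ⟨hle', Nat.mul_pos hpos he, ?_⟩
    have hs : (s.2 : ℝ≥0) ≠ 0 := by exact_mod_cast hpos.ne'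
    have hden : (e.den : ℝ≥0) ≠ 0 := by exact_mod_cast he.ne'
    rw [div_add_div _ _ hden hs]
    push_cast
    congr 1 <;> ring

theorem fracSum_eq_iff {N : ℕ} {l : List NatEntry} (hl : ∀ e ∈ l, 0 < e.den)
    (hN : fracBound l ≤ N) : (fracSum N l).1 = (fracSum N l).2 ↔ natWeight l = 1 := by
  obtain ⟨-, hpos, hdiv⟩ := fracSum_spec hl hN
  rw [← hdiv, div_eq_one_iff_eq (by exact_mod_cast hpos.ne')]
  norm_cast

theorem fracLe_iff {N : ℕ} {l l' : List NatEntry} (hl : ∀ e ∈ l, 0 < e.den)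
    (hN : fracBound l ≤ N) (hl' : ∀ e ∈ l', 0 < e.den) (hN' : fracBound l' ≤ N) :
    fracLe N l l' = true ↔ natWeight l ≤ natWeight l' := by
  obtain ⟨-, hpos, hdiv⟩ := fracSum_spec hl hN
  obtain ⟨-, hpos', hdiv'⟩ := fracSum_spec hl' hN'
  rw [← hdiv, ← hdiv', div_le_div_iff₀ (by exact_mod_cast hpos) (by exact_mod_cast hpos'), fracLe,
    decide_eq_true_eq]
  norm_cast

/-! ### Written-out distributions -/

section

variable {n m : ℕ} {l l' : List (Entry n m)} {d d' : PMF (Fin n × ShortWord (Fin m))}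

theorem coe_natWeight (l : List (Entry n m)) :
    ((natWeight (l.map Entry.toNat) : ℝ≥0) : ℝ≥0∞) = (l.map Entry.weight).sum := by
  induction l with
  | nil => simp [natWeight]
  | cons e l ih =>
    have hweight : (((e.num : ℝ≥0) / ((e.den : ℕ) : ℝ≥0) : ℝ≥0) : ℝ≥0∞) = e.weight := by
      rw [ENNReal.coe_div (by exact_mod_cast e.den.ne_zero), ENNReal.coe_natCast,
        ENNReal.coe_natCast, Entry.weight]
    rw [List.map_cons, natWeight_cons, ENNReal.coe_add, ih, List.map_cons, List.sum_cons,
      ← hweight]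
    rfl

theorem den_toNat_pos (l : List (Entry n m)) : ∀ e ∈ l.map Entry.toNat, 0 < e.den := by
  intro e he
  obtain ⟨e, -, rfl⟩ := List.mem_map.1 he
  exact e.den.pos

theorem Entry.weight_eq_zero_iff (e : Entry n m) : e.weight = 0 ↔ e.num = 0 := by
  simp [Entry.weight, ENNReal.div_eq_zero_iff]

theorem tsum_indicator_entries (l : List (Entry n m)) (U : Set (Fin n × ShortWord (Fin m)))
    [DecidablePred (· ∈ U)] :
    ∑' x, U.indicator (fun x => (l.map fun e => if e.target = x then e.weight else 0).sum) x =
      ((l.filter fun e => e.target ∈ U).map Entry.weight).sum := by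
  induction l with
  | nil => simp
  | cons e l ih =>
    have hcons : ∀ x, U.indicator (fun x => ((e :: l).map fun e =>
        if e.target = x then e.weight else 0).sum) x =
        (if x = e.target then U.indicator (fun _ => e.weight) e.target else 0) +
        U.indicator (fun x => (l.map fun e => if e.target = x then e.weight else 0).sum) x := by
      intro x
      rcases eq_or_ne x e.target with rfl | hx
      · by_cases hU : e.target ∈ U <;> simp [hU]
      · by_cases hU : x ∈ U <;> simp [hU, hx, hx.symm]
    simp only [hcons]
    rw [ENNReal.tsum_add, tsum_ite_eq, ih, List.filter_cons]
    by_cases hU : e.target ∈ U <;> simp [hU]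

theorem PresentsDist.toOuterMeasure_apply (h : PresentsDist l d)
    (U : Set (Fin n × ShortWord (Fin m))) [DecidablePred (· ∈ U)] :
    d.toOuterMeasure U = ((l.filter fun e => e.target ∈ U).map Entry.weight).sum := by
  rw [PMF.toOuterMeasure_apply, ← tsum_indicator_entries, funext h]

theorem PresentsDist.unique (h : PresentsDist l d) (h' : PresentsDist l d') : d = d' :=
  PMF.ext fun x => (h x).trans (h' x).symm

theorem exists_presentsDist_iff : (∃ d, PresentsDist l d) ↔ (l.map Entry.weight).sum = 1 := by
  have htotal := tsum_indicator_entries l Set.univ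
  simp only [Set.indicator_univ, Set.mem_univ, decide_true, List.filter_true] at htotal
  constructor
  · rintro ⟨d, hd⟩
    rw [← d.tsum_coe, ← htotal, funext hd]
  · intro hsum
    refine ⟨⟨fun x => (l.map fun e => if e.target = x then e.weight else 0).sum, ?_⟩,
      fun _ => rfl⟩
    rw [← hsum, ← htotal]
    exact ENNReal.summable.hasSum

theorem PresentsDist.mem_support_iff (h : PresentsDist l d) (x : Fin n × ShortWord (Fin m)) :
    x ∈ d.support ↔ ∃ e ∈ l, e.num ≠ 0 ∧ e.target = x := by
  rw [PMF.mem_support_iff, h x, Ne, List.sum_eq_zero_iff]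
  simp only [List.mem_map, forall_exists_index, and_imp, forall_apply_eq_imp_iff₂, ite_eq_right_iff,
    Entry.weight_eq_zero_iff]
  push Not
  exact exists_congr fun e => and_congr_right fun _ => and_comm

theorem PresentsDist.rational (h : PresentsDist l d) (x : Fin n × ShortWord (Fin m)) :
    ∃ r : ℚ≥0, d x = ((r : ℝ≥0) : ℝ≥0∞) := by
  rw [h x]
  clear h
  induction l with
  | nil => exact ⟨0, by simp⟩
  | cons e l ih =>
    obtain ⟨r, hr⟩ := ih
    rw [List.map_cons, List.sum_cons, hr]
    split_ifs
    · refine ⟨(e.num : ℚ≥0) / ((e.den : ℕ) : ℚ≥0) + r, ?_⟩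
      rw [Entry.weight, NNRat.cast_add, ENNReal.coe_add, NNRat.cast_div, NNRat.cast_natCast,
        NNRat.cast_natCast, ENNReal.coe_div (by exact_mod_cast e.den.ne_zero), ENNReal.coe_natCast,
        ENNReal.coe_natCast]
    · exact ⟨r, by simp⟩

theorem PresentsDist.exists_eq_pure_iff (h : PresentsDist l d) : (∃ x, d = PMF.pure x) ↔
    ∀ e ∈ l, ∀ e' ∈ l, e.num = 0 ∨ e'.num = 0 ∨ e.target = e'.target := by
  have hsupport : (∃ x, d = PMF.pure x) ↔ d.support.Subsingleton := by
    constructor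
    · rintro ⟨x, rfl⟩
      rw [PMF.support_pure]
      exact Set.subsingleton_singleton
    · intro hd
      obtain ⟨x, hx⟩ := d.support_nonempty
      have hsingle : d.support = {x} := hd.eq_singleton_of_mem hx
      classical
      refine ⟨x, PMF.ext fun y => ?_⟩
      rw [PMF.pure_apply]
      split_ifs with hy
      · rw [hy, PMF.apply_eq_one_iff, hsingle]
      · rw [PMF.apply_eq_zero_iff, hsingle]
        exact hy
  simp only [hsupport, Set.Subsingleton, h.mem_support_iff]
  constructor
  · intro hl e he e' he'
    by_contra! hne
    exact hne.2.2 (hl ⟨e, he, hne.1, rfl⟩ ⟨e', he', hne.2.1, rfl⟩)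
  · rintro hl _ ⟨e, he, hnum, rfl⟩ _ ⟨e', he', hnum', rfl⟩
    exact ((hl e he e' he').resolve_left hnum).resolve_left hnum'

theorem sum_weight_le_of_sublist (h : l.Sublist l') :
    (l.map Entry.weight).sum ≤ (l'.map Entry.weight).sum :=
  (h.map _).sum_le_sum fun _ _ => zero_le

open Classical in
theorem lift_iff_sublist (h : PresentsDist l d) (h' : PresentsDist l' d')
    (R : Fin n × ShortWord (Fin m) → Fin n × ShortWord (Fin m) → Prop) :
    Lift R d d' ↔ ∀ u : List (Entry n m), u.Sublist l → (u.map Entry.weight).sum ≤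
      ((l'.filter fun e' => ∃ e ∈ u, R e.target e'.target).map Entry.weight).sum := by
  constructor
  · intro hR u hu
    have hU := hR {x | ∃ e ∈ u, e.target = x}
    rw [h.toOuterMeasure_apply, h'.toOuterMeasure_apply] at hU
    have hsub : u.Sublist (l.filter fun e => e.target ∈ {x | ∃ e ∈ u, e.target = x}) := by
      have hfilter := hu.filter fun e => e.target ∈ {x | ∃ e ∈ u, e.target = x}
      rwa [List.filter_eq_self.2 fun e he => decide_eq_true ⟨e, he, rfl⟩] at hfilter
    refine (sum_weight_le_of_sublist hsub).trans (hU.trans_eq ?_)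
    simp
  · intro hl U
    rw [h.toOuterMeasure_apply, h'.toOuterMeasure_apply]
    refine (hl _ List.filter_sublist).trans (sum_weight_le_of_sublist ?_)
    refine List.monotone_filter_right _ fun e' he' => ?_
    simp only [List.mem_filter, decide_eq_true_eq] at he'
    obtain ⟨e, ⟨-, he⟩, hR⟩ := he'
    exact decide_eq_true ⟨_, he, hR⟩

theorem liftTest_iff {N : ℕ} (h : PresentsDist l d) (h' : PresentsDist l' d')
    (hl : 2 ^ l.length ≤ N) (hN : fracBound (l.map Entry.toNat) ≤ N)
    (hN' : fracBound (l'.map Entry.toNat) ≤ N) {rel : NatConfig → NatConfig → Bool}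
    {R : Fin n × ShortWord (Fin m) → Fin n × ShortWord (Fin m) → Prop}
    (hR : ∀ x y, rel (natTarget x) (natTarget y) = true ↔ R x y) :
    liftTest N rel (l.map Entry.toNat) (l'.map Entry.toNat) = true ↔ Lift R d d' := by
  classical
  have hle : ∀ u : List (Entry n m), u.Sublist l → (fracLe N (u.map Entry.toNat)
      ((l'.map Entry.toNat).filter fun e' =>
        (u.map Entry.toNat).any fun e => rel e.target e'.target) = true ↔
      (u.map Entry.weight).sum ≤
        ((l'.filter fun e' => ∃ e ∈ u, R e.target e'.target).map Entry.weight).sum) := by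
    intro u hu
    have hfilter : (l'.map Entry.toNat).filter (fun e' =>
        (u.map Entry.toNat).any fun e => rel e.target e'.target) =
        (l'.filter fun e' => ∃ e ∈ u, R e.target e'.target).map Entry.toNat := by
      rw [List.filter_map]
      congr 1
      refine List.filter_congr fun e' _ => ?_
      rw [Bool.eq_iff_iff, Function.comp, List.any_map, List.any_eq_true, decide_eq_true_eq]
      exact exists_congr fun e => and_congr_right fun _ => hR _ _
    rw [hfilter, fracLe_iff (den_toNat_pos _) _ (den_toNat_pos _) _, ← ENNReal.coe_le_coe,
      coe_natWeight, coe_natWeight]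
    · exact (fracBound_le_of_sublist (hu.map _) (den_toNat_pos _)).trans hN
    · exact (fracBound_le_of_sublist (List.filter_sublist.map _) (den_toNat_pos _)).trans hN'
  rw [lift_iff_sublist h h' R, liftTest, boundedSublists_eq (by rwa [List.length_map]),
    List.all_eq_true]
  simp only [List.mem_sublists', List.sublist_map_iff, forall_exists_index, and_imp]
  exact ⟨fun H u hu => (hle u hu).1 (H _ u hu rfl), by
    rintro H _ u hu rfl
    exact (hle u hu).2 (H u hu)⟩

end

/-! ### Relations and tables as lists -/

section

variable {n m : ℕ}

theorem mem_pairs {x : ℕ × ℕ} : x ∈ pairs n ↔ ∃ p q : Fin n, (p.val, q.val) = x := by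
  obtain ⟨p, q⟩ := x
  simp only [pairs, List.mem_flatMap, List.mem_range, List.mem_map, Prod.mk.injEq]
  constructor
  · rintro ⟨p', hp, q', hq, rfl, rfl⟩
    exact ⟨⟨p', hp⟩, ⟨q', hq⟩, rfl, rfl⟩
  · rintro ⟨p', q', rfl, rfl⟩
    exact ⟨p', p'.2, q', q'.2, rfl, rfl⟩

theorem length_pairs (n : ℕ) : (pairs n).length = n * n := by
  simp [pairs, List.length_flatMap]

open Classical in
/-- The list that represents a relation between control states: the pairs in the relation, in the
order in which they occur in `pairs n`. -/
noncomputable def relList (B : Fin n → Fin n → Prop) : List (ℕ × ℕ) :=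
  (pairs n).filter fun x => ∃ p q : Fin n, B p q ∧ (p.val, q.val) = x

theorem mem_relList {B : Fin n → Fin n → Prop} {p q : Fin n} :
    (p.val, q.val) ∈ relList B ↔ B p q := by
  simp only [relList, List.mem_filter, mem_pairs, decide_eq_true_eq, Prod.mk.injEq, Fin.val_inj]
  constructor
  · rintro ⟨-, p', q', h, rfl, rfl⟩
    exact h
  · exact fun h => ⟨⟨p, q, rfl, rfl⟩, p, q, h, rfl, rfl⟩

theorem relList_injective :
    Function.Injective (relList : (Fin n → Fin n → Prop) → List (ℕ × ℕ)) := by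
  intro B B' h
  funext p q
  rw [← mem_relList (B := B), ← mem_relList (B := B'), h]

theorem filter_pairs_eq_relList {f : ℕ × ℕ → Bool} {B : Fin n → Fin n → Prop}
    (h : ∀ p q : Fin n, f (p.val, q.val) = true ↔ B p q) : (pairs n).filter f = relList B := by
  classical
  refine List.filter_congr fun x hx => ?_
  obtain ⟨p, q, rfl⟩ := mem_pairs.1 hx
  rw [Bool.eq_iff_iff, h, decide_eq_true_eq]
  simp only [Prod.mk.injEq, Fin.val_inj]
  constructor
  · exact fun h => ⟨p, q, h, rfl, rfl⟩
  · rintro ⟨p', q', h, rfl, rfl⟩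
    exact h

/-- The table that is represented by a list of tuples. -/
def tableRel (n m : ℕ) (T : List TableTuple) : Table (Fin n) (Fin m) := fun X Y B p q =>
  (X.val, Y.val, relList B, p.val, q.val) ∈ T

theorem lookup_relList (T : List TableTuple) (X Y : Fin m) (B : Fin n → Fin n → Prop) :
    lookup n T X Y (relList B) = relList (tableRel n m T X Y B) :=
  filter_pairs_eq_relList fun _ _ => decide_eq_true_iff

theorem targetTest_iff (T : List TableTuple) (B : Fin n → Fin n → Prop)
    (x y : Fin n × ShortWord (Fin m)) :
    targetTest n T (relList B) (natTarget x) (natTarget y) = true ↔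
      (tableRel n m T).targetRel B (x.1, x.2.1) (y.1, y.2.1) := by
  simp only [targetTest, Bool.and_eq_true, decide_eq_true_eq]
  rcases x with ⟨p, u, hu⟩
  rcases y with ⟨q, v, hv⟩
  rcases u with _ | ⟨X, _ | ⟨X', _ | _⟩⟩ <;> rcases v with _ | ⟨Y, _ | ⟨Y', _ | _⟩⟩ <;>
    simp at hu hv <;>
    simp [relAbove, natTarget, natConfig, NatConfig.state, NatConfig.stack,
      Table.targetRel, mem_relList, lookup_relList]

theorem mem_allTuples {N : ℕ} (hN : 2 ^ (n * n) ≤ N) (X Y : Fin m) (B : Fin n → Fin n → Prop)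
    (p q : Fin n) : (X.val, Y.val, relList B, p.val, q.val) ∈ allTuples N n m := by
  simp only [allTuples, boundedSublists_eq ((length_pairs n).symm ▸ hN), List.mem_flatMap,
    List.mem_map, List.mem_range]
  exact ⟨X, X.2, Y, Y.2, relList B, List.mem_sublists'.2 List.filter_sublist,
    (p.val, q.val), mem_pairs.2 ⟨p, q, rfl⟩, rfl⟩

theorem card_le_length_allTuples {N : ℕ} (hN : 2 ^ (n * n) ≤ N) :
    Nat.card (Fin m × Fin m × (Fin n → Fin n → Prop) × Fin n × Fin n) ≤
      (allTuples N n m).length := by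
  let tuple (v : Fin m × Fin m × (Fin n → Fin n → Prop) × Fin n × Fin n) :
      (allTuples N n m).toFinset :=
    ⟨(v.1.val, v.2.1.val, relList v.2.2.1, v.2.2.2.1.val, v.2.2.2.2.val),
      List.mem_toFinset.2 (mem_allTuples hN _ _ _ _ _)⟩
  have htuple : Function.Injective tuple := by
    rintro ⟨X, Y, B, p, q⟩ ⟨X', Y', B', p', q'⟩ h
    simp only [tuple, Subtype.mk.injEq, Prod.mk.injEq, Fin.val_inj] at h
    obtain ⟨rfl, rfl, h, rfl, rfl⟩ := h
    rw [relList_injective h]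
  refine (Nat.card_le_card_of_injective _ htuple).trans ?_
  rw [Nat.card_eq_fintype_card, Fintype.card_coe]
  exact List.toFinset_card_le _

end

/-! ### Correctness of the tests -/

section

variable {I : Instance} {D : PvPDA (Fin I.numStates) (Fin I.numSymbols) (Fin I.kinds.length)}
  {N : ℕ}

theorem applies_iff {n m k : ℕ} (p : Fin n) (X : Fin m) (r : RawRule n m k) :
    applies p X r.toNat = true ↔ r.state = p ∧ r.top = X := by
  simp [applies, RawRule.toNat, NatRule.state, NatRule.top, Fin.val_inj]

theorem stuckTest_iff (h : I.Presents D) (p : Fin I.numStates) (X : Fin I.numSymbols) :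
    stuckTest (I.rules.map RawRule.toNat) p X = true ↔ D.Stuck p X := by
  rw [stuckTest, List.all_map, List.all_eq_true]
  simp only [Function.comp, Bool.not_eq_true', ← Bool.not_eq_true, applies_iff]
  constructor
  · intro hstuck a d hd
    obtain ⟨r, hr, hstate, htop, -⟩ := h.2.2 _ _ _ _ hd
    exact hstuck r hr ⟨hstate, htop⟩
  · rintro hstuck r hr ⟨rfl, rfl⟩
    obtain ⟨d, hd, -⟩ := h.2.1 r hr
    exact hstuck _ _ hd

theorem simulates_iff (h : I.Presents D) {rel : List NatEntry → List NatEntry → Bool}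
    {R : PMF (Fin I.numStates × ShortWord (Fin I.numSymbols)) →
      PMF (Fin I.numStates × ShortWord (Fin I.numSymbols)) → Prop}
    (hR : ∀ r ∈ I.rules, ∀ r' ∈ I.rules, ∀ d d', PresentsDist r.dist d → PresentsDist r'.dist d' →
      (rel (r.dist.map Entry.toNat) (r'.dist.map Entry.toNat) = true ↔ R d d'))
    (p q : Fin I.numStates) (X Y : Fin I.numSymbols) :
    simulates rel (I.rules.map RawRule.toNat) p X q Y = true ↔
      ∀ a d, D.heads p X a d → ∃ d', D.heads q Y a d' ∧ R d d' := by
  simp only [simulates, List.all_map, List.any_map, List.all_eq_true, List.any_eq_true,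
    Function.comp, Bool.or_eq_true, Bool.and_eq_true, Bool.not_eq_true', ← Bool.not_eq_true,
    applies_iff, decide_eq_true_eq, ← imp_iff_not_or]
  constructor
  · intro hsim a d hd
    obtain ⟨r, hr, hstate, htop, rfl, hrd⟩ := h.2.2 _ _ _ _ hd
    obtain ⟨r', hr', ⟨rfl, rfl⟩, hval, hrel⟩ := hsim r hr ⟨hstate, htop⟩
    obtain ⟨d', hd', hrd'⟩ := h.2.1 r' hr'
    have haction : r'.action = r.action := Fin.val_injective hval
    exact ⟨d', haction ▸ hd', (hR r hr r' hr' d d' hrd hrd').1 hrel⟩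
  · rintro hsim r hr ⟨rfl, rfl⟩
    obtain ⟨d, hd, hrd⟩ := h.2.1 r hr
    obtain ⟨d', hd', hdd'⟩ := hsim _ _ hd
    obtain ⟨r', hr', hstate, htop, haction, hrd'⟩ := h.2.2 _ _ _ _ hd'
    exact ⟨r', hr', ⟨hstate, htop⟩, congrArg Fin.val haction,
      (hR r hr r' hr' d d' hrd hrd').2 hdd'⟩

theorem refineTest_iff (h : I.Presents D) (hN : I.Bounded N) (T : List TableTuple)
    (X Y : Fin I.numSymbols) (B : Fin I.numStates → Fin I.numStates → Prop)
    (p q : Fin I.numStates) :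
    refineTest N I.numStates (I.rules.map RawRule.toNat) T X Y (relList B) p q = true ↔
      D.refine (tableRel I.numStates I.numSymbols T) X Y B p q := by
  have hlift : ∀ r ∈ I.rules, ∀ r' ∈ I.rules, ∀ d d', PresentsDist r.dist d →
      PresentsDist r'.dist d' → (liftTest N (targetTest I.numStates T (relList B))
        (r.dist.map Entry.toNat) (r'.dist.map Entry.toNat) = true ↔
        Lift (fun x y => (tableRel I.numStates I.numSymbols T).targetRel B
          (x.1, x.2.1) (y.1, y.2.1)) d d') := fun r hr r' hr' d d' hd hd' =>
    liftTest_iff hd hd' (hN.entries r hr) (hN.frac r hr) (hN.frac r' hr') (targetTest_iff T B)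
  rw [refineTest, Bool.and_eq_true, PPDA.refine]
  exact and_congr (simulates_iff h hlift p q X Y)
    (simulates_iff h (fun r' hr' r hr d' d hd' hd => hlift r hr r' hr' d d' hd hd') q p Y X)

theorem tableRel_stableTable (h : I.Presents D) (hN : I.Bounded N) :
    tableRel I.numStates I.numSymbols
      (stableTable N I.numStates I.numSymbols (I.rules.map RawRule.toNat)) =
      D.approx (allTuples N I.numStates I.numSymbols).length := by
  rw [stableTable]
  generalize (allTuples N I.numStates I.numSymbols).length = k
  induction k with
  | zero =>
    funext X Y B p q
    exact eq_true (mem_allTuples hN.states X Y B p q)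
  | succ k ih =>
    rw [Function.iterate_succ_apply', PPDA.approx_succ, ← ih]
    funext X Y B p q
    rw [← refineTest_iff h hN, tableRel, List.mem_filter, eq_iff_iff]
    exact and_iff_right (mem_allTuples hN.states X Y B p q)

theorem relAbove_bottomRel (h : I.Presents D) (T : List TableTuple)
    (α β : List (Fin I.numSymbols)) :
    relAbove I.numStates T (α.map Fin.val) (β.map Fin.val)
      (bottomRel I.numStates (I.rules.map RawRule.toNat) (α.map Fin.val) (β.map Fin.val)) =
      relList (D.stackRel (tableRel I.numStates I.numSymbols T) α β) := by
  induction α generalizing β with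
  | nil =>
    cases β with
    | nil => exact filter_pairs_eq_relList fun p q => by simp [PPDA.stackRel]
    | cons Y β => exact filter_pairs_eq_relList fun p q => by simp [PPDA.stackRel, stuckTest_iff h]
  | cons X α ih =>
    cases β with
    | nil => exact filter_pairs_eq_relList fun p q => by simp [PPDA.stackRel, stuckTest_iff h]
    | cons Y β =>
      have hbottom : bottomRel I.numStates (I.rules.map RawRule.toNat) ((X :: α).map Fin.val)
          ((Y :: β).map Fin.val) = bottomRel I.numStates (I.rules.map RawRule.toNat)
          (α.map Fin.val) (β.map Fin.val) := by
        simp [bottomRel]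
      rw [hbottom, PPDA.stackRel, ← lookup_relList, ← ih]
      rfl

theorem bisimTest_iff (h : I.Presents D) (hN : I.Bounded N) :
    bisimTest N I.toNat = true ↔ D.toPLTS.Bisimilar I.left I.right := by
  rw [D.bisimilar_iff (D.approx_stable (card_le_length_allTuples hN.states)),
    ← tableRel_stableTable h hN,
    ← mem_relList (B := D.stackRel _ I.left.2 I.right.2), ← relAbove_bottomRel h]
  exact decide_eq_true_iff

theorem diracTest_iff (h : I.Presents D) : diracTest I.toNat = true ↔ D.IsStandard := by
  have hpure : ∀ (r : RawRule I.numStates I.numSymbols I.kinds.length) d,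
      PresentsDist r.dist d →
      ((r.toNat.dist.all fun e => r.toNat.dist.all fun e' =>
        decide (e.num = 0) || (decide (e'.num = 0) || decide (e.target = e'.target))) = true ↔
      ∃ x, d = PMF.pure x) := by
    intro r d hd
    rw [hd.exists_eq_pure_iff]
    simp only [RawRule.toNat, NatRule.dist, List.all_map, List.all_eq_true, Function.comp,
      Bool.or_eq_true, decide_eq_true_eq]
    simp only [Entry.toNat, NatEntry.num, NatEntry.target, natTarget_injective.eq_iff]
  rw [diracTest, NatInstance.rules, Instance.toNat, List.all_map, List.all_eq_true]
  constructor
  · intro hdirac q X a d hd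
    obtain ⟨r, hr, -, -, -, hrd⟩ := h.2.2 _ _ _ _ hd
    exact (hpure r d hrd).1 (hdirac r hr)
  · intro hstandard r hr
    obtain ⟨d, hd, hrd⟩ := h.2.1 r hr
    exact (hpure r d hrd).2 (hstandard _ _ _ _ hd)

end

/-! ### The automaton of an instance -/

/-- The targets of positive probability in the written-out rules have the width that the kind of the
action prescribes. -/
def Instance.IsVisible (I : Instance) : Prop :=
  ∀ r ∈ I.rules, ∀ e ∈ r.dist, e.num = 0 ∨ e.target.2.1.length = (I.kinds.get r.action).width

/-- The automaton with the rules that are written out in an instance, where a list of entries that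
does not present a distribution gives no rule. -/
def Instance.toPvPDA (I : Instance) (hI : I.IsVisible) :
    PvPDA (Fin I.numStates) (Fin I.numSymbols) (Fin I.kinds.length) where
  rules := {t | ∃ r ∈ I.rules, r.state = t.1 ∧ r.top = t.2.1 ∧ r.action = t.2.2.1 ∧
    PresentsDist r.dist t.2.2.2}
  finite_rules := by
    refine ((List.finite_toSet I.rules).biUnion
      (t := fun r => {t | (r.state, r.top, r.action) = (t.1, t.2.1, t.2.2.1) ∧
        PresentsDist r.dist t.2.2.2}) fun r _ => Set.Subsingleton.finite ?_).subset ?_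
    · rintro ⟨q, X, a, d⟩ ⟨h, hd⟩ ⟨q', X', a', d'⟩ ⟨h', hd'⟩
      cases h
      cases h'
      obtain rfl : d = d' := PresentsDist.unique hd hd'
      rfl
    · rintro ⟨q, X, a, d⟩ ⟨r, hr, rfl, rfl, rfl, hd⟩
      exact Set.mem_biUnion hr ⟨rfl, hd⟩
  rational := by
    rintro q X a d ⟨r, -, -, -, -, hd⟩
    exact hd.rational
  kind := I.kinds.get
  visibly := by
    rintro q X a d ⟨r, hr, -, -, rfl, hd⟩ x hx
    obtain ⟨e, he, hnum, rfl⟩ := (hd.mem_support_iff x).1 hx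
    exact (hI r hr e he).resolve_left hnum

theorem exists_presents_iff {I : Instance} :
    (∃ D, I.Presents D) ↔ (∀ r ∈ I.rules, ∃ d, PresentsDist r.dist d) ∧ I.IsVisible := by
  constructor
  · rintro ⟨D, h⟩
    refine ⟨fun r hr => (h.2.1 r hr).imp fun d hd => hd.2, fun r hr e he => ?_⟩
    obtain ⟨d, hd, hrd⟩ := h.2.1 r hr
    rw [or_iff_not_imp_left, ← h.1]
    exact fun hnum => D.visibly _ _ _ _ hd _ ((hrd.mem_support_iff _).2 ⟨e, he, hnum, rfl⟩)
  · rintro ⟨hdist, hI⟩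
    refine ⟨I.toPvPDA hI, fun _ => rfl, fun r hr => ?_, fun q X a d hd => hd⟩
    obtain ⟨d, hd⟩ := hdist r hr
    exact ⟨d, ⟨r, hr, rfl, rfl, rfl, hd⟩, hd⟩

theorem visiblyTest_iff {I : Instance} {N : ℕ} (hN : I.Bounded N) :
    visiblyTest N I.toNat = true ↔ ∃ D, I.Presents D := by
  rw [exists_presents_iff, Instance.IsVisible, ← forall₂_and, visiblyTest, NatInstance.rules,
    Instance.toNat, List.all_map, List.all_eq_true]
  refine forall₂_congr fun r hr => ?_
  rw [exists_presentsDist_iff, ← coe_natWeight, ENNReal.coe_eq_one,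
    ← fracSum_eq_iff (den_toNat_pos _) (hN.frac r hr), Function.comp, Bool.and_eq_true,
    decide_eq_true_eq, RawRule.toNat]
  refine and_congr_right fun _ => ?_
  simp only [NatRule.dist, List.all_map, List.all_eq_true, Function.comp, Bool.or_eq_true,
    decide_eq_true_eq]
  simp [Entry.toNat, natTarget, natConfig, NatEntry.num, NatEntry.target, NatConfig.stack,
    NatInstance.widths, NatRule.action, List.headD_eq_head?_getD]

/-! ### Correctness of the decision procedures -/

theorem decode_encode {I : Instance} {N : ℕ} (hN : 2 ^ I.encode.length ≤ N) :
    decode (I.encode, N) = I.toNat := by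
  rw [← encNatInstance_toNat] at hN ⊢
  have hinst := WordParser.inverts_inst N I.toNat [] (by simpa using hN)
  rw [List.append_nil] at hinst
  rw [decode, hinst]

theorem two_pow_length_le (w : List Letter) :
    2 ^ w.length ≤ 2 ^ (w.length * w.length + w.length) :=
  Nat.pow_le_pow_right two_pos (Nat.le_add_left _ _)

theorem exists_encode_eq_of_decidePvPDA {y : List Letter × ℕ} (h : decidePvPDA y = true) :
    ∃ I : Instance, I.encode = y.1 := by
  simp only [decidePvPDA, acceptTest, Bool.and_eq_true, decide_eq_true_eq, instanceTest_iff] at h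
  obtain ⟨henc, ⟨I, hI⟩, -⟩ := h
  exact ⟨I, by rw [← encNatInstance_toNat, hI, henc]⟩

theorem decidePvPDA_encode_iff (I : Instance) :
    decidePvPDA (I.encode, 2 ^ (I.encode.length * I.encode.length + I.encode.length)) = true ↔
      ∃ D, I.Presents D ∧ D.toPLTS.Bisimilar I.left I.right := by
  have hinstance : instanceTest I.toNat = true := instanceTest_iff.2 ⟨I, rfl⟩
  simp only [decidePvPDA, acceptTest, decode_encode (two_pow_length_le _), encNatInstance_toNat,
    decide_true, hinstance, Bool.true_and, Bool.and_eq_true, visiblyTest_iff I.bounded]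
  constructor
  · rintro ⟨⟨D, hD⟩, hbisim⟩
    exact ⟨D, hD, (bisimTest_iff hD I.bounded).1 hbisim⟩
  · rintro ⟨D, hD, hbisim⟩
    exact ⟨⟨D, hD⟩, (bisimTest_iff hD I.bounded).2 hbisim⟩

theorem mem_pvPDABisimilarity_iff (w : List Letter) : w ∈ pvPDABisimilarity ↔
    decidePvPDA (w, 2 ^ (w.length * w.length + w.length)) = true := by
  constructor
  · rintro ⟨I, rfl, hI⟩
    exact (decidePvPDA_encode_iff I).2 hI
  · intro h
    obtain ⟨I, rfl⟩ := exists_encode_eq_of_decidePvPDA h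
    exact ⟨I, rfl, (decidePvPDA_encode_iff I).1 h⟩

theorem mem_vPDABisimilarity_iff (w : List Letter) : w ∈ vPDABisimilarity ↔
    decideVPDA (w, 2 ^ (w.length * w.length + w.length)) = true := by
  rw [decideVPDA, Bool.and_eq_true]
  constructor
  · rintro ⟨I, rfl, D, hD, hstandard, hbisim⟩
    rw [decidePvPDA_encode_iff, decode_encode (two_pow_length_le _), diracTest_iff hD]
    exact ⟨⟨D, hD, hbisim⟩, hstandard⟩
  · rintro ⟨h, hdirac⟩
    obtain ⟨I, rfl⟩ := exists_encode_eq_of_decidePvPDA h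
    obtain ⟨D, hD, hbisim⟩ := (decidePvPDA_encode_iff I).1 h
    rw [decode_encode (two_pow_length_le _), diracTest_iff hD] at hdirac
    exact ⟨I, rfl, D, hD, hdirac, hbisim⟩

end PVPDA

theorem theorem4p2 :
    PVPDA.InEXPTIME PVPDA.pvPDABisimilarity ∧ PVPDA.InEXPTIME PVPDA.vPDABisimilarity := by
  have hq : StackProgram.PolyTime fun w : List PVPDA.Letter => w.length * w.length + w.length := by
    fun_prop
  exact ⟨StackProgram.inEXPTIME_of_polyTime _ hq PVPDA.polyTime_decidePvPDA
      PVPDA.mem_pvPDABisimilarity_iff,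
    StackProgram.inEXPTIME_of_polyTime _ hq PVPDA.polyTime_decideVPDA
      PVPDA.mem_vPDABisimilarity_iff⟩
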